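/- Let $M$ be a finite-dimensional smooth Hausdorff manifold without boundary, $\pi:TM\to M$ its tangent bundle and $TM\setminus 0$ the complement of the zero section. Let $F:TM\to[0,\infty)$ be a (not necessarily reversible) Finsler metric: $F$ is smooth on $TM\setminus 0$, $F(w)=0$ iff $w=0$, $F(\lambda w)=\lambda F(w)$ for $\lambda\ge 0$, and the fundamental tensor $g_F(w)=\tfrac12 d_f^2F^2(w)$ (second fibre derivative) is positive definite for every $w\neq 0$. *Geodesic flow.* Let $\mathscr L_F(w)=\tfrac12 d_fF^2(w)$ be the Legendre transformation, $(\alpha_F)_w(X)=\mathscr L_F(w)(d\pi(w)X)$ and $\omega_F=-d\alpha_F$ on $TM\setminus 0$. The geodesic spray $S=S_F$ is the vector field on $TM\setminus 0$ with $\omega_F(S,\cdot)=\tfrac12 dF^2$. Let $i_w(u)=\frac{d}{dt}\big|_{t=0}(w+tu)$ be the vertical lift of $u\in T_{\pi(w)}M$ at $w$, $\mathcal V_wTM=\ker d\pi(w)=i_w(T_{\pi(w)}M)$, $C_w=i_w(w)$ and $\mathcal J_w(X)=i_w(d\pi(w)X)$. *Flag curvature.* $\Gamma_S=-[S,\mathcal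 J]$ is a field of reflections of $T(TM\setminus 0)$ with $(-1)$-eigenspaces $\mathcal V_wTM$; its $1$-eigenspaces are the horizontal spaces. Let $\mathcal P_{\mathcal V}$ be the projection onto the vertical spaces along the horizontal ones and $u^{\mathfrak h}$ the horizontal lift at $w$ of $u\in T_{\pi(w)}M$. Let $\nabla$ be any smooth linear connection on the vector bundle $\mathcal VTM\to TM\setminus 0$ with $\nabla_XC=\mathcal P_{\mathcal V}(X)$ and $\nabla_S\mathcal J(X)-\nabla_X\mathcal J(S)-\mathcal J([S,X])=0$ for all vector fields $X$ on $TM\setminus 0$. With $\mathcal R(X,Y)Z=\nabla_{[X,Y]}Z-[\nabla_X,\nabla_Y]Z$, put $\mathbf R_w(u)=i_w^{-1}\,\mathcal R(w^{\mathfrak h},u^{\mathfrak h})C_w$ and, for a plane $\Pi=\mathrm{span}[w,u]\subset T_{\pi(w)}M$, $$K_F(w,\Pi)=\frac{g_F(w)(\mathbf R_w(u),u)}{g_F(w)(w,w)\,g_F(w)(u,u)-g_F(w)(w,u)^2},$$ the flag curvature of the flag $(w,\Pi)$. *Invariants of the Jacobi curve.* Let $v\in T_mM$, $v\ne0$, and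 let $\Phi_t$ be the local flow of $S$ near $v$. The Jacobi curve at $v$ is the curve of subspaces $\ell_v(t)=d\Phi_t(v)^{-1}\big(\mathcal V_{\Phi_t(v)}TM\big)$ of $T_vTM$, for $t$ near $0$. Near any time, choose a smooth frame $a_1(t),\dots,a_n(t)$ of $\ell_v(t)$; the curve is fanning at $t$ if $a_1,\dots,a_n,\dot a_1,\dots,\dot a_n$ is a basis of $T_vTM$ at $t$. The fundamental endomorphism $\mathbf F_v(t)$ is then given by $\mathbf F_v(t)a_i(t)=0$, $\mathbf F_v(t)\dot a_i(t)=a_i(t)$, the Jacobi endomorphism is $\mathbf K_v(t)=\tfrac14\ddot{\mathbf F}_v(t)^2$, and the Wronskian is the bilinear form $W_v(t)(x,y)=\omega_F(x,\dot b(t))$ on $\ell_v(t)$, for any smooth section $b$ of $\ell_v$ with $b(t)=y$. **Theorem.** Let $u\in T_mM$ be such that $v,u$ are linearly independent and $g_F(v)(v,u)=0$, let $\Pi=\mathrm{span}[v,u]$ and $a=i_v(u)\in\ell_v(0)=\mathcal V_vTM$. Then $\ell_v$ is fanning at $t=0$, $W_v(0)(a,a)\neq 0$, and $$K_F(v,\Pi)=\frac{1}{F(v)^2}\,\frac{W_v(0)\big(\mathbf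 K_v(0)a,a\big)}{W_v(0)(a,a)} .$$ -/

import Mathlib

open Bundle Set
open scoped Manifold ContDiff Topology

noncomputable section

namespace FinslerJacobi

section Curves

/-! Curves of subspaces of a finite-dimensional real vector space `V`, near a time `t`. -/

variable {V : Type*} [NormedAddCommGroup V] [NormedSpace ℝ V]

/-- `a` is a smooth section of the curve of subspaces `ℓ`, defined near the time `t`. -/
def IsSectionNear (ℓ : ℝ → Submodule ℝ V) (t : ℝ) (a : ℝ → V) : Prop :=
  ∃ J : Set ℝ, IsOpen J ∧ t ∈ J ∧ ContDiffOn ℝ ∞ a J ∧ ∀ s ∈ J, a s ∈ ℓ s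

/-- `(a₁, …, aₙ)` is a smooth frame of the curve of subspaces `ℓ`, defined near the time `t`. -/
def IsFrameNear {n : ℕ} (ℓ : ℝ → Submodule ℝ V) (t : ℝ) (a : Fin n → ℝ → V) : Prop :=
  ∃ J : Set ℝ, IsOpen J ∧ t ∈ J ∧ (∀ i, ContDiffOn ℝ ∞ (a i) J) ∧
    ∀ s ∈ J, LinearIndependent ℝ (fun i => a i s) ∧
      Submodule.span ℝ (Set.range fun i => a i s) = ℓ s

/-- `(a₁, …, aₙ, ȧ₁, …, ȧₙ)` is a basis of `V` at the time `t`. -/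
def IsFanningFrameAt {n : ℕ} (t : ℝ) (a : Fin n → ℝ → V) : Prop :=
  LinearIndependent ℝ (Sum.elim (fun i => a i t) (fun i => deriv (a i) t)) ∧
    Submodule.span ℝ (Set.range (Sum.elim (fun i => a i t) (fun i => deriv (a i) t))) = ⊤

/-- The curve of subspaces `ℓ` is smooth near `t` and fanning at `t`. -/
def IsFanningAt (ℓ : ℝ → Submodule ℝ V) (t : ℝ) : Prop :=
  ∃ (n : ℕ) (a : Fin n → ℝ → V), IsFrameNear ℓ t a ∧ IsFanningFrameAt t a

/-- `T` is the endomorphism with `T aᵢ(t) = 0` and `T ȧᵢ(t) = aᵢ(t)` for a frame `(aᵢ)` of the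
fanning curve `ℓ`. -/
def IsFundamentalEndomorphismAt (ℓ : ℝ → Submodule ℝ V) (t : ℝ) (T : V →L[ℝ] V) : Prop :=
  ∃ (n : ℕ) (a : Fin n → ℝ → V), IsFrameNear ℓ t a ∧ IsFanningFrameAt t a ∧
    ∀ i, T (a i t) = 0 ∧ T (deriv (a i) t) = a i t

/-- The fundamental endomorphism `𝐅(t)` of a fanning curve. -/
def fundamentalEndomorphism (ℓ : ℝ → Submodule ℝ V) (t : ℝ) : V →L[ℝ] V :=
  Classical.epsilon (IsFundamentalEndomorphismAt ℓ t)

/-- The Jacobi endomorphism `𝐊(t) = (1/4) 𝐅̈(t)²` of a fanning curve. -/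
def jacobiEndomorphism (ℓ : ℝ → Submodule ℝ V) (t : ℝ) : V →L[ℝ] V :=
  (1 / 4 : ℝ) • (deriv (deriv (fundamentalEndomorphism ℓ)) t ∘L
    deriv (deriv (fundamentalEndomorphism ℓ)) t)

/-- The Wronskian `W(t)(x, y) = Ω(x, ḃ(t))`, where `b` is any section of `ℓ` with `b(t) = y`, of a
curve `ℓ` of Lagrangian subspaces of `(V, Ω)`. -/
def wronskian (Ω : V → V → ℝ) (ℓ : ℝ → Submodule ℝ V) (t : ℝ) (x y : V) : ℝ :=
  Ω x (deriv (Classical.epsilon fun b : ℝ → V => IsSectionNear ℓ t b ∧ b t = y) t)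

end Curves

section TangentBundle

variable {E : Type*} [NormedAddCommGroup E] [NormedSpace ℝ E]
  {M : Type*} [TopologicalSpace M] [ChartedSpace E M] [IsManifold 𝓘(ℝ, E) ∞ M]

/-- The differential `dπ(w) : T_w TM → T_{π(w)} M` of the projection `π : TM → M`. -/
def dproj (w : TangentBundle 𝓘(ℝ, E) M) :
    TangentSpace 𝓘(ℝ, E).tangent w →L[ℝ] TangentSpace 𝓘(ℝ, E) w.proj :=
  mfderiv 𝓘(ℝ, E).tangent 𝓘(ℝ, E) (TotalSpace.proj : TangentBundle 𝓘(ℝ, E) M → M) w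

/-- The vertical space `𝒱_w TM`, the kernel of `dπ(w)`. -/
def verticalSpace (w : TangentBundle 𝓘(ℝ, E) M) :
    Submodule ℝ (TangentSpace 𝓘(ℝ, E).tangent w) :=
  LinearMap.ker (dproj w).toLinearMap

/-- The vertical lift `i_w(u) = d/dt|₀ (w + t u)`. -/
def verticalLift (w : TangentBundle 𝓘(ℝ, E) M) (u : TangentSpace 𝓘(ℝ, E) w.proj) :
    TangentSpace 𝓘(ℝ, E).tangent w :=
  mfderiv 𝓘(ℝ, ℝ) 𝓘(ℝ, E).tangent
    (fun t : ℝ => (⟨w.proj, w.2 + t • u⟩ : TangentBundle 𝓘(ℝ, E) M)) 0 (1 : ℝ)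

/-- The complement `TM \ 0` of the zero section. -/
def puncturedTangentBundle (E M : Type*) [NormedAddCommGroup E] [NormedSpace ℝ E]
    [TopologicalSpace M] [ChartedSpace E M] : Set (TangentBundle 𝓘(ℝ, E) M) :=
  {w | w.2 ≠ 0}

/-- The almost-tangent structure `𝒥_w(X) = i_w(dπ(w) X)`. -/
def almostTangent (w : TangentBundle 𝓘(ℝ, E) M) (X : TangentSpace 𝓘(ℝ, E).tangent w) :
    TangentSpace 𝓘(ℝ, E).tangent w :=
  verticalLift w (dproj w X)

end TangentBundle

section Finsler

variable {E : Type*} [NormedAddCommGroup E] [NormedSpace ℝ E]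
  {M : Type*} [TopologicalSpace M] [ChartedSpace E M] [IsManifold 𝓘(ℝ, E) ∞ M]

/-- The energy `(1/2) F²`. -/
def energy (F : TangentBundle 𝓘(ℝ, E) M → ℝ) (w : TangentBundle 𝓘(ℝ, E) M) : ℝ :=
  (1 / 2) * F w ^ 2

/-- The Legendre transformation `𝓛_F(w) = (1/2) d_f F²(w)`, the fibre derivative of `(1/2) F²`. -/
def legendre (F : TangentBundle 𝓘(ℝ, E) M → ℝ) (w : TangentBundle 𝓘(ℝ, E) M) :
    TangentSpace 𝓘(ℝ, E) w.proj →L[ℝ] ℝ :=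
  fderiv ℝ (fun y : TangentSpace 𝓘(ℝ, E) w.proj => energy F ⟨w.proj, y⟩) w.2

/-- The fundamental tensor `g_F(w) = (1/2) d_f² F²(w)`, the second fibre derivative of
`(1/2) F²`. -/
def fundamentalTensor (F : TangentBundle 𝓘(ℝ, E) M → ℝ) (w : TangentBundle 𝓘(ℝ, E) M) :
    TangentSpace 𝓘(ℝ, E) w.proj →L[ℝ] TangentSpace 𝓘(ℝ, E) w.proj →L[ℝ] ℝ :=
  fderiv ℝ (fderiv ℝ fun y : TangentSpace 𝓘(ℝ, E) w.proj => energy F ⟨w.proj, y⟩) w.2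

/-- Finsler metrics on `M` (positively homogeneous, not necessarily reversible). -/
structure IsFinslerMetric (F : TangentBundle 𝓘(ℝ, E) M → ℝ) : Prop where
  nonneg : ∀ w, 0 ≤ F w
  smooth : ContMDiffOn 𝓘(ℝ, E).tangent 𝓘(ℝ, ℝ) ∞ F (puncturedTangentBundle E M)
  eq_zero_iff : ∀ w, F w = 0 ↔ w.2 = 0
  homogeneous : ∀ (x : M) (y : TangentSpace 𝓘(ℝ, E) x) (c : ℝ), 0 ≤ c →
    F ⟨x, c • y⟩ = c * F ⟨x, y⟩
  posDef : ∀ w ∈ puncturedTangentBundle E M, ∀ u : TangentSpace 𝓘(ℝ, E) w.proj, u ≠ 0 →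
    0 < fundamentalTensor F w u u

/-- The pull-back `α_F` of the canonical 1-form of `T*M` by the Legendre transformation:
`(α_F)_w(X) = 𝓛_F(w)(dπ(w) X)`. -/
def alphaForm (F : TangentBundle 𝓘(ℝ, E) M → ℝ) (w : TangentBundle 𝓘(ℝ, E) M) :
    TangentSpace 𝓘(ℝ, E).tangent w →L[ℝ] ℝ :=
  (legendre F w).comp (dproj w)

/-- The 1-form `α` on `TM`, read in the preferred chart at `w`. -/
def formInChart (α : ∀ w : TangentBundle 𝓘(ℝ, E) M, TangentSpace 𝓘(ℝ, E).tangent w →L[ℝ] ℝ)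
    (w : TangentBundle 𝓘(ℝ, E) M) (p : E × E) : E × E →L[ℝ] ℝ :=
  (α ((extChartAt 𝓘(ℝ, E).tangent w).symm p)).comp
    (mfderiv 𝓘(ℝ, E × E) 𝓘(ℝ, E).tangent (extChartAt 𝓘(ℝ, E).tangent w).symm p)

/-- The exterior derivative `(dα)_w(X, Y)` of a 1-form on `TM`, computed in the preferred chart at
`w` by `dα(X, Y) = (D_X α)(Y) - (D_Y α)(X)`. -/
def extDerivForm (α : ∀ w : TangentBundle 𝓘(ℝ, E) M, TangentSpace 𝓘(ℝ, E).tangent w →L[ℝ] ℝ)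
    (w : TangentBundle 𝓘(ℝ, E) M) (X Y : TangentSpace 𝓘(ℝ, E).tangent w) : ℝ :=
  let φ := extChartAt 𝓘(ℝ, E).tangent w
  let X' : E × E := mfderiv 𝓘(ℝ, E).tangent 𝓘(ℝ, E × E) φ w X
  let Y' : E × E := mfderiv 𝓘(ℝ, E).tangent 𝓘(ℝ, E × E) φ w Y
  fderiv ℝ (formInChart α w) (φ w) X' Y' - fderiv ℝ (formInChart α w) (φ w) Y' X'

/-- The symplectic form `ω_F = -dα_F` on `TM \ 0`. -/
def omegaForm (F : TangentBundle 𝓘(ℝ, E) M → ℝ) (w : TangentBundle 𝓘(ℝ, E) M)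
    (X Y : TangentSpace 𝓘(ℝ, E).tangent w) : ℝ :=
  -extDerivForm (alphaForm F) w X Y

/-- The geodesic spray `S_F` of `F` on `TM \ 0`: the Hamiltonian vector field of `(1/2) F²` with
respect to `ω_F`, that is, the vector field with `ω_F(S_F, ·) = (1/2) dF²`. Its values on the zero
section are irrelevant. -/
def geodesicSpray (F : TangentBundle 𝓘(ℝ, E) M → ℝ) (w : TangentBundle 𝓘(ℝ, E) M) :
    TangentSpace 𝓘(ℝ, E).tangent w :=
  Classical.epsilon fun X => ∀ Y : TangentSpace 𝓘(ℝ, E).tangent w,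
    omegaForm F w X Y = mfderiv 𝓘(ℝ, E).tangent 𝓘(ℝ, ℝ) (energy F) w Y

end Finsler

section Flow

variable {E : Type*} [NormedAddCommGroup E] [NormedSpace ℝ E]
  {M : Type*} [TopologicalSpace M] [ChartedSpace E M] [IsManifold 𝓘(ℝ, E) ∞ M]

/-- `Φ` is a smooth local flow, near `v`, of the vector field `S` on `TM \ 0`. The values of `Φ`
outside of `(-ε, ε) × U` are irrelevant. -/
def IsLocalFlowNear (S : ∀ w : TangentBundle 𝓘(ℝ, E) M, TangentSpace 𝓘(ℝ, E).tangent w)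
    (v : TangentBundle 𝓘(ℝ, E) M)
    (Φ : ℝ → TangentBundle 𝓘(ℝ, E) M → TangentBundle 𝓘(ℝ, E) M) : Prop :=
  ∃ ε : ℝ, 0 < ε ∧ ∃ U : Set (TangentBundle 𝓘(ℝ, E) M), IsOpen U ∧ v ∈ U ∧
    ContMDiffOn (𝓘(ℝ, ℝ).prod 𝓘(ℝ, E).tangent) 𝓘(ℝ, E).tangent ∞
      (fun p : ℝ × TangentBundle 𝓘(ℝ, E) M => Φ p.1 p.2) (Ioo (-ε) ε ×ˢ U) ∧
    ∀ w ∈ U, Φ 0 w = w ∧ (∀ t ∈ Ioo (-ε) ε, Φ t w ∈ puncturedTangentBundle E M) ∧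
      IsMIntegralCurveOn (fun t => Φ t w) S (Ioo (-ε) ε)

/-- The Jacobi curve `ℓ_v(t) = (Φ_t^* 𝒱TM)(v) = dΦ_t(v)⁻¹ (𝒱_{Φ_t(v)} TM)` of the vertical
distribution, a curve of subspaces of `T_v TM` (in Mathlib `T_v TM` is the model space `E × E`). -/
def jacobiCurve (Φ : ℝ → TangentBundle 𝓘(ℝ, E) M → TangentBundle 𝓘(ℝ, E) M)
    (v : TangentBundle 𝓘(ℝ, E) M) (t : ℝ) : Submodule ℝ (E × E) :=
  Submodule.comap
    (mfderiv 𝓘(ℝ, E).tangent 𝓘(ℝ, E).tangent (Φ t) v).toLinearMap (verticalSpace (Φ t v))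

end Flow

section Connections

variable {E : Type*} [NormedAddCommGroup E] [NormedSpace ℝ E]
  {M : Type*} [TopologicalSpace M] [ChartedSpace E M] [IsManifold 𝓘(ℝ, E) ∞ M]

/-- The Lie derivative `[S, 𝒥](X) = [S, 𝒥 X] - 𝒥 [S, X]` at `w` of the almost-tangent structure,
computed with a local extension of `X ∈ T_w TM` to a smooth vector field. -/
def lieAlmostTangent (S : ∀ w : TangentBundle 𝓘(ℝ, E) M, TangentSpace 𝓘(ℝ, E).tangent w)
    (w : TangentBundle 𝓘(ℝ, E) M) (X : TangentSpace 𝓘(ℝ, E).tangent w) :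
    TangentSpace 𝓘(ℝ, E).tangent w :=
  VectorField.mlieBracket 𝓘(ℝ, E).tangent S
      (fun w' => almostTangent w' (FiberBundle.extend (E × E) X w')) w
    - almostTangent w
        (VectorField.mlieBracket 𝓘(ℝ, E).tangent S (FiberBundle.extend (E × E) X) w)

/-- The canonical connection `Γ_S = -[S, 𝒥]` of the spray `S`. -/
def canonicalConnection (S : ∀ w : TangentBundle 𝓘(ℝ, E) M, TangentSpace 𝓘(ℝ, E).tangent w)
    (w : TangentBundle 𝓘(ℝ, E) M) (X : TangentSpace 𝓘(ℝ, E).tangent w) :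
    TangentSpace 𝓘(ℝ, E).tangent w :=
  -lieAlmostTangent S w X

/-- The projection `P_𝒱` onto the vertical space (the `(-1)`-eigenspace of `Γ_S`) along the
horizontal space (the `1`-eigenspace of `Γ_S`). -/
def verticalProjection (S : ∀ w : TangentBundle 𝓘(ℝ, E) M, TangentSpace 𝓘(ℝ, E).tangent w)
    (w : TangentBundle 𝓘(ℝ, E) M) (X : TangentSpace 𝓘(ℝ, E).tangent w) :
    TangentSpace 𝓘(ℝ, E).tangent w :=
  (1 / 2 : ℝ) • (X - canonicalConnection S w X)

/-- The horizontal lift `u^𝔥` of `u` at `w`: the vector `X` in the horizontal space at `w` (the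
`1`-eigenspace of `Γ_S`) with `dπ(w) X = u`. -/
def horizontalLift (S : ∀ w : TangentBundle 𝓘(ℝ, E) M, TangentSpace 𝓘(ℝ, E).tangent w)
    (w : TangentBundle 𝓘(ℝ, E) M) (u : TangentSpace 𝓘(ℝ, E) w.proj) :
    TangentSpace 𝓘(ℝ, E).tangent w :=
  Classical.epsilon fun X => canonicalConnection S w X = X ∧ dproj w X = u

/-- The projection `π : TM → M` as a continuous map. -/
def projMap (E M : Type*) [NormedAddCommGroup E] [NormedSpace ℝ E]
    [TopologicalSpace M] [ChartedSpace E M] [IsManifold 𝓘(ℝ, E) ∞ M] :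
    C(TangentBundle 𝓘(ℝ, E) M, M) :=
  ⟨TotalSpace.proj, FiberBundle.continuous_proj E (TangentSpace 𝓘(ℝ, E) : M → Type _)⟩

/-- The vertical tangent bundle `𝒱TM → TM`, identified with the pull-back bundle `π^*TM` by means of
the vertical lifts `i_w : T_{π(w)} M → 𝒱_w TM`. -/
def VerticalBundle (E M : Type*) [NormedAddCommGroup E] [NormedSpace ℝ E]
    [TopologicalSpace M] [ChartedSpace E M] [IsManifold 𝓘(ℝ, E) ∞ M] :
    TangentBundle 𝓘(ℝ, E) M → Type _ :=
  (projMap E M : TangentBundle 𝓘(ℝ, E) M → M) *ᵖ (TangentSpace 𝓘(ℝ, E) : M → Type _)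

instance (w : TangentBundle 𝓘(ℝ, E) M) : AddCommGroup (VerticalBundle E M w) :=
  inferInstanceAs (AddCommGroup (TangentSpace 𝓘(ℝ, E) w.proj))

instance (w : TangentBundle 𝓘(ℝ, E) M) : Module ℝ (VerticalBundle E M w) :=
  inferInstanceAs (Module ℝ (TangentSpace 𝓘(ℝ, E) w.proj))

instance (w : TangentBundle 𝓘(ℝ, E) M) : TopologicalSpace (VerticalBundle E M w) :=
  inferInstanceAs (TopologicalSpace (TangentSpace 𝓘(ℝ, E) w.proj))

instance (w : TangentBundle 𝓘(ℝ, E) M) : IsTopologicalAddGroup (VerticalBundle E M w) :=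
  inferInstanceAs (IsTopologicalAddGroup (TangentSpace 𝓘(ℝ, E) w.proj))

instance (w : TangentBundle 𝓘(ℝ, E) M) : ContinuousSMul ℝ (VerticalBundle E M w) :=
  inferInstanceAs (ContinuousSMul ℝ (TangentSpace 𝓘(ℝ, E) w.proj))

instance : TopologicalSpace (TotalSpace E (VerticalBundle E M)) :=
  inferInstanceAs (TopologicalSpace (TotalSpace E
    ((projMap E M : TangentBundle 𝓘(ℝ, E) M → M) *ᵖ (TangentSpace 𝓘(ℝ, E) : M → Type _))))

instance : FiberBundle E (VerticalBundle E M) :=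
  inferInstanceAs (FiberBundle E
    ((projMap E M : TangentBundle 𝓘(ℝ, E) M → M) *ᵖ (TangentSpace 𝓘(ℝ, E) : M → Type _)))

instance : VectorBundle ℝ E (VerticalBundle E M) :=
  inferInstanceAs (VectorBundle ℝ E
    ((projMap E M : TangentBundle 𝓘(ℝ, E) M → M) *ᵖ (TangentSpace 𝓘(ℝ, E) : M → Type _)))

/-- The canonical vertical vector field `C_w = i_w(w)`, as a section of `π^*TM`. -/
def canonicalField (w : TangentBundle 𝓘(ℝ, E) M) : VerticalBundle E M w := w.2

/-- The section of the vertical bundle given by `𝒥(X)`, for a vector field `X` on `TM`. Since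
`𝒥(X) = i(dπ(X))`, as a section of `π^*TM` it is `dπ(X)`. -/
def almostTangentField (X : ∀ w : TangentBundle 𝓘(ℝ, E) M, TangentSpace 𝓘(ℝ, E).tangent w)
    (w : TangentBundle 𝓘(ℝ, E) M) : VerticalBundle E M w := dproj w (X w)

/-- `D` is a smooth linear connection on the restriction to `TM \ 0` of the vertical bundle
(`D Z w X` is `(∇_X Z)(w)`), satisfying, for the spray `S`,
* `lift`: `∇_X C = P_𝒱(X)`;
* `torsion`: `T(S, X) = ∇_S 𝒥(X) - ∇_X 𝒥(S) - 𝒥([S, X]) = 0`. -/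
structure IsSprayConnection
    (S : ∀ w : TangentBundle 𝓘(ℝ, E) M, TangentSpace 𝓘(ℝ, E).tangent w)
    (D : (∀ w : TangentBundle 𝓘(ℝ, E) M, VerticalBundle E M w) →
      ∀ w : TangentBundle 𝓘(ℝ, E) M,
        TangentSpace 𝓘(ℝ, E).tangent w →L[ℝ] VerticalBundle E M w) : Prop where
  isCovariantDerivativeOn :
    IsCovariantDerivativeOn (I := 𝓘(ℝ, E).tangent) E D (puncturedTangentBundle E M)
  smooth : ∀ U : Set (TangentBundle 𝓘(ℝ, E) M), IsOpen U → U ⊆ puncturedTangentBundle E M →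
    ContMDiffCovariantDerivativeOn (I := 𝓘(ℝ, E).tangent) E ∞ D U
  lift : ∀ w ∈ puncturedTangentBundle E M, ∀ X : TangentSpace 𝓘(ℝ, E).tangent w,
    verticalLift w (D canonicalField w X) = verticalProjection S w X
  torsion : ∀ X : (∀ w : TangentBundle 𝓘(ℝ, E) M, TangentSpace 𝓘(ℝ, E).tangent w),
    ContMDiffOn 𝓘(ℝ, E).tangent 𝓘(ℝ, E).tangent.tangent ∞
      (fun w => (⟨w, X w⟩ : TangentBundle 𝓘(ℝ, E).tangent (TangentBundle 𝓘(ℝ, E) M)))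
      (puncturedTangentBundle E M) →
    ∀ w ∈ puncturedTangentBundle E M,
      D (almostTangentField X) w (S w) - D (almostTangentField S) w (X w)
        - almostTangentField (VectorField.mlieBracket 𝓘(ℝ, E).tangent S X) w = 0

/-- The curvature `ℛ(X, Y)Z = ∇_{[X, Y]} Z - [∇_X, ∇_Y] Z` of `D` at `w`, for vector fields `X`, `Y`
on `TM` and a section `Z` of the vertical bundle. -/
def connectionCurvature
    (D : (∀ w : TangentBundle 𝓘(ℝ, E) M, VerticalBundle E M w) →
      ∀ w : TangentBundle 𝓘(ℝ, E) M,
        TangentSpace 𝓘(ℝ, E).tangent w →L[ℝ] VerticalBundle E M w)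
    (X Y : ∀ w : TangentBundle 𝓘(ℝ, E) M, TangentSpace 𝓘(ℝ, E).tangent w)
    (Z : ∀ w : TangentBundle 𝓘(ℝ, E) M, VerticalBundle E M w)
    (w : TangentBundle 𝓘(ℝ, E) M) : VerticalBundle E M w :=
  D Z w (VectorField.mlieBracket 𝓘(ℝ, E).tangent X Y w)
    - (D (fun w' => D Z w' (Y w')) w (X w) - D (fun w' => D Z w' (X w')) w (Y w))

/-- The curvature endomorphism `𝐑_w(u) = R_w(w, u)w`, where `R_w(u₁, u₂)z = ℛ(u₁^𝔥, u₂^𝔥)z^𝔳`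
with the horizontal and vertical lifts at `w`. The tensor `ℛ` is computed with local extensions of
these vectors to smooth fields. -/
def curvatureEndomorphism
    (S : ∀ w : TangentBundle 𝓘(ℝ, E) M, TangentSpace 𝓘(ℝ, E).tangent w)
    (D : (∀ w : TangentBundle 𝓘(ℝ, E) M, VerticalBundle E M w) →
      ∀ w : TangentBundle 𝓘(ℝ, E) M,
        TangentSpace 𝓘(ℝ, E).tangent w →L[ℝ] VerticalBundle E M w)
    (w : TangentBundle 𝓘(ℝ, E) M) (u : TangentSpace 𝓘(ℝ, E) w.proj) :
    TangentSpace 𝓘(ℝ, E) w.proj :=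
  connectionCurvature D
    (FiberBundle.extend (E × E) (horizontalLift S w w.2))
    (FiberBundle.extend (E × E) (horizontalLift S w u))
    (FiberBundle.extend E (canonicalField w)) w

/-- The flag curvature `K_F(w, Π)`, where `u` is any vector with `Π = span[w, u]`:
`K_F(w, Π) = g_F(w)(𝐑_w(u), u) / (g_F(w)(w, w) g_F(w)(u, u) - g_F(w)(w, u)²)`. -/
def flagCurvature (F : TangentBundle 𝓘(ℝ, E) M → ℝ)
    (D : (∀ w : TangentBundle 𝓘(ℝ, E) M, VerticalBundle E M w) →
      ∀ w : TangentBundle 𝓘(ℝ, E) M,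
        TangentSpace 𝓘(ℝ, E).tangent w →L[ℝ] VerticalBundle E M w)
    (w : TangentBundle 𝓘(ℝ, E) M) (P : Submodule ℝ (TangentSpace 𝓘(ℝ, E) w.proj)) : ℝ :=
  let u : TangentSpace 𝓘(ℝ, E) w.proj :=
    Classical.epsilon fun u => P = Submodule.span ℝ {w.2, u}
  fundamentalTensor F w (curvatureEndomorphism (geodesicSpray F) D w u) u /
    (fundamentalTensor F w w.2 w.2 * fundamentalTensor F w u u
      - fundamentalTensor F w w.2 u ^ 2)

end Connections

end FinslerJacobi

end

/-!
In a chart of `TM` the geodesic spray is a second order field `(y, f(x, y))`, with `f` homogeneous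
of degree two in `y`. Both sides of the formula are then computed from
`R = ½ 𝒟_S(∂_y f) - ∂_x f - ¼ (∂_y f)²`.

Let `M(t)` be the linearization of the flow along the orbit of `v`, and `J(x, y) = (0, x)`. The
Jacobi curve is `M(t)⁻¹ (0 × E)`, and its fundamental endomorphism is `-M⁻¹ J M`. Each derivative
of a curve `M⁻¹ T M` is again a conjugate by `M`, so two differentiations give `𝐅̈` without solving
any equation, and `¼ 𝐅̈²` acts on the vertical space as `R`. On the other hand, `∇C = P_𝒱` already
determines the connection form applied to `C`, which is all that `ℛ(w^𝔥, u^𝔥)C` depends on;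
this curvature is again `R`. The Wronskian restricts to the fundamental tensor `g` because
`ω_F(i_v(u), X) = -g(u, dπ(X))`.

Finally `R y = 0` by homogeneity, and `g(R u, y) = 0` since the energy is constant along horizontal
lifts. Hence the flag quotient does not depend on the vector which spans `Π` together with `v`, and
it reduces to `g(R u, u) / (F(v)² g(u, u))` when `u` is orthogonal to `v`.
-/

noncomputable section

namespace FinslerJacobi

section Calculus

variable {V W X Y G : Type*} [NormedAddCommGroup V] [NormedSpace ℝ V]
  [NormedAddCommGroup W] [NormedSpace ℝ W] [NormedAddCommGroup X] [NormedSpace ℝ X]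
  [NormedAddCommGroup Y] [NormedSpace ℝ Y] [NormedAddCommGroup G] [NormedSpace ℝ G]

lemma minSmoothness_two_le_infty : minSmoothness ℝ 2 ≤ (∞ : ℕ∞ω) := by
  simpa using WithTop.coe_le_coe.2 (le_top (a := (2 : ℕ∞)))

lemma hasFDerivAt_of_contDiffAt {f : V → W} {x : V} (hf : ContDiffAt ℝ ∞ f x) :
    HasFDerivAt f (fderiv ℝ f x) x :=
  (hf.differentiableAt (by simp)).hasFDerivAt

lemma contDiffAt_fderiv {f : V → W} {x : V} (hf : ContDiffAt ℝ ∞ f x) :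
    ContDiffAt ℝ ∞ (fderiv ℝ f) x :=
  hf.fderiv_right (by simp)

lemma hasFDerivAt_fderiv {f : V → W} {x : V} (hf : ContDiffAt ℝ ∞ f x) :
    HasFDerivAt (fderiv ℝ f) (fderiv ℝ (fderiv ℝ f) x) x :=
  hasFDerivAt_of_contDiffAt (contDiffAt_fderiv hf)

lemma fderiv_fderiv_comm {f : V → W} {x : V} (hf : ContDiffAt ℝ ∞ f x) (a b : V) :
    fderiv ℝ (fderiv ℝ f) x a b = fderiv ℝ (fderiv ℝ f) x b a :=
  (hf.isSymmSndFDerivAt minSmoothness_two_le_infty).eq a b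

lemma clm_apply_mk (T : X × Y →L[ℝ] G) (x : X) (y : Y) : T (x, y) = T (x, 0) + T (0, y) :=
  (T.comp_inl_add_comp_inr (x, y)).symm

lemma fderiv_comp_const_add {g : W → G} {B : V →L[ℝ] W} {w : W} {y : V}
    (hg : DifferentiableAt ℝ g (w + B y)) :
    fderiv ℝ (fun y => g (w + B y)) y = fderiv ℝ g (w + B y) ∘L B :=
  (hg.hasFDerivAt.comp y (B.hasFDerivAt.const_add w)).fderiv

lemma fderiv_fderiv_comp_const_add {g : W → G} {B : V →L[ℝ] W} {w : W} {y : V}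
    (hg : ContDiffAt ℝ ∞ g (w + B y)) (u₁ u₂ : V) :
    fderiv ℝ (fderiv ℝ fun y => g (w + B y)) y u₁ u₂ =
      fderiv ℝ (fderiv ℝ g) (w + B y) (B u₁) (B u₂) := by
  have hline : HasFDerivAt (fun y => w + B y) B y := B.hasFDerivAt.const_add w
  have hfirst : fderiv ℝ (fun y => g (w + B y)) =ᶠ[𝓝 y] fun y => fderiv ℝ g (w + B y) ∘L B := by
    have hC1 : ContDiffAt ℝ 1 g (w + B y) := hg.of_le (by simp)
    filter_upwards [hline.continuousAt.eventually (hC1.eventually (by simp))] with z hz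
    exact fderiv_comp_const_add (hz.differentiableAt (by simp))
  have hsecond : HasFDerivAt (fun y => fderiv ℝ g (w + B y) ∘L B) _ y :=
    ((hasFDerivAt_fderiv hg).comp y hline).clm_comp (hasFDerivAt_const B y)
  rw [hfirst.fderiv_eq, hsecond.fderiv]
  simp

lemma fderiv_pullback_sub_swap {τ : V → W} {β : W → W →L[ℝ] G} {q : V}
    (hτ : ContDiffAt ℝ ∞ τ q) (hβ : DifferentiableAt ℝ β (τ q)) (a b : V) :
    fderiv ℝ (fun q => β (τ q) ∘L fderiv ℝ τ q) q a b
        - fderiv ℝ (fun q => β (τ q) ∘L fderiv ℝ τ q) q b a =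
      fderiv ℝ β (τ q) (fderiv ℝ τ q a) (fderiv ℝ τ q b)
        - fderiv ℝ β (τ q) (fderiv ℝ τ q b) (fderiv ℝ τ q a) := by
  have hpullback : HasFDerivAt (fun q => β (τ q) ∘L fderiv ℝ τ q) _ q :=
    (hβ.hasFDerivAt.comp q (hasFDerivAt_of_contDiffAt hτ)).clm_comp (hasFDerivAt_fderiv hτ)
  rw [hpullback.fderiv]
  simp [fderiv_fderiv_comm hτ a b]

lemma differentiableAt_clm_of_forall_apply [FiniteDimensional ℝ V] {B : W → V →L[ℝ] G} {w : W}
    (hB : ∀ x, DifferentiableAt ℝ (fun q => B q x) w) : DifferentiableAt ℝ B w := by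
  let b := Module.finBasis ℝ V
  have hsum : B = fun q => ∑ i, (b.coord i).toContinuousLinearMap.smulRight (B q (b i)) := by
    refine funext fun q => ContinuousLinearMap.ext fun x => ?_
    conv_lhs => rw [← b.sum_repr x, map_sum]
    simp
  rw [hsum]
  exact DifferentiableAt.fun_sum fun i _ => ((ContinuousLinearMap.smulRightL ℝ V G
    (b.coord i).toContinuousLinearMap).differentiableAt).comp w (hB (b i))

section Scaling

variable {g : V → G} {σ : V →L[ℝ] V} {a : ℝ} {O : Set V} {p : V} (hO : IsOpen O)
  (hg : ContDiffOn ℝ ∞ g O) (hσ : MapsTo σ O O) (h : ∀ q ∈ O, g (σ q) = a • g q) (hp : p ∈ O)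
include hO hg hσ h hp

lemma fderiv_map_of_map_eq_smul (x : V) : fderiv ℝ g (σ p) (σ x) = a • fderiv ℝ g p x := by
  have hgAt : ∀ q ∈ O, HasFDerivAt g (fderiv ℝ g q) q := fun q hq =>
    hasFDerivAt_of_contDiffAt (hg.contDiffAt (hO.mem_nhds hq))
  have hcomp := (hgAt _ (hσ hp)).comp p σ.hasFDerivAt
  exact congrArg (· x) (hcomp.unique
    (((hgAt p hp).const_smul a).congr_of_eventuallyEq ((hO.eventually_mem hp).mono h)))

lemma fderiv_fderiv_map_of_map_eq_smul (x y : V) :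
    fderiv ℝ (fderiv ℝ g) (σ p) (σ x) (σ y) = a • fderiv ℝ (fderiv ℝ g) p x y := by
  have hgAt : ∀ q ∈ O, HasFDerivAt (fderiv ℝ g) (fderiv ℝ (fderiv ℝ g) q) q := fun q hq =>
    hasFDerivAt_fderiv (hg.contDiffAt (hO.mem_nhds hq))
  have hcomp := ((hgAt _ (hσ hp)).comp p σ.hasFDerivAt).clm_apply (hasFDerivAt_const (σ y) p)
  have hscaled := ((hgAt p hp).clm_apply (hasFDerivAt_const y p)).const_smul a
  have hev := (hO.eventually_mem hp).mono fun q hq =>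
    (fderiv_map_of_map_eq_smul hO hg hσ h hq y).symm
  simpa using congrArg (· x) ((hcomp.congr_of_eventuallyEq hev).unique hscaled)

end Scaling

/-- `g` is positively homogeneous of degree `k` in the second variable, at the points of `O`. -/
def IsFibreHomogeneousOn (k : ℕ) (O : Set (X × Y)) (g : X × Y → G) : Prop :=
  ∀ p ∈ O, ∀ c : ℝ, 0 < c → g (p.1, c • p.2) = c ^ k • g p

namespace IsFibreHomogeneousOn

variable {k : ℕ} {O : Set (X × Y)} {g : X × Y → G} (h : IsFibreHomogeneousOn k O g) {p : X × Y}
include h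

lemma fderiv_euler (hp : p ∈ O) (hg : DifferentiableAt ℝ g p) :
    fderiv ℝ g p (0, p.2) = (k : ℝ) • g p := by
  have hray : HasDerivAt (fun c : ℝ => (p.1, c • p.2)) (0, p.2) 1 := by
    simpa using (hasDerivAt_const (1 : ℝ) p.1).prodMk ((hasDerivAt_id (1 : ℝ)).smul_const p.2)
  have hcomp : HasDerivAt (fun c : ℝ => g (p.1, c • p.2)) (fderiv ℝ g p (0, p.2)) 1 :=
    HasFDerivAt.comp_hasDerivAt (l := g) 1 (by simpa using hg.hasFDerivAt) hray
  have hpow : HasDerivAt (fun c : ℝ => c ^ k • g p) ((k : ℝ) • g p) 1 := by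
    simpa using (hasDerivAt_pow k (1 : ℝ)).smul_const (g p)
  refine hcomp.unique (hpow.congr_of_eventuallyEq ?_)
  filter_upwards [lt_mem_nhds one_pos] with c hc using h p hp c hc

lemma fderiv_fderiv_euler (hO : IsOpen O) (hp : p ∈ O) (hg : ContDiffOn ℝ ∞ g O) (x : X × Y) :
    fderiv ℝ (fderiv ℝ g) p x (0, p.2) = (k : ℝ) • fderiv ℝ g p x - fderiv ℝ g p (0, x.2) := by
  have hgAt : ∀ q ∈ O, ContDiffAt ℝ ∞ g q := fun q hq => hg.contDiffAt (hO.mem_nhds hq)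
  have hleft := (hasFDerivAt_fderiv (hgAt p hp)).clm_apply
    ((ContinuousLinearMap.inr ℝ X Y).comp (ContinuousLinearMap.snd ℝ X Y)).hasFDerivAt
  have hright := (hasFDerivAt_of_contDiffAt (hgAt p hp)).const_smul (k : ℝ)
  have heuler : (fun q => (k : ℝ) • g q) =ᶠ[𝓝 p] fun q => fderiv ℝ g q (0, q.2) := by
    filter_upwards [hO.mem_nhds hp] with q hq
    exact (h.fderiv_euler hq ((hgAt q hq).differentiableAt (by simp))).symm
  have := congrArg (· x) ((hleft.congr_of_eventuallyEq heuler).unique hright)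
  simp only [ContinuousLinearMap.comp_apply, add_apply, smul_apply, ContinuousLinearMap.flip_apply,
    ContinuousLinearMap.inr_apply, ContinuousLinearMap.coe_snd'] at this
  rw [← this, add_sub_cancel_left]

end IsFibreHomogeneousOn

end Calculus

section Spray

variable {E : Type*} [NormedAddCommGroup E] [NormedSpace ℝ E]

/-- The second order vector field `(x, y) ↦ (y, f (x, y))` of the equation `ẍ = f (x, ẋ)`. -/
def sprayField (f : E × E → E) (p : E × E) : E × E := (p.2, f p)

/-- The curvature (Jacobi endomorphism) of the spray `(y, f)`. In terms of the coefficients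
`N = -(1/2) ∂_y f` of its nonlinear connection it is `-D_S N - ∂_x f - N²`. -/
def sprayCurvature (f : E × E → E) (p : E × E) : E →L[ℝ] E :=
  (1 / 2 : ℝ) • fderiv ℝ (fderiv ℝ f) p (sprayField f p) ∘L ContinuousLinearMap.inr ℝ E E
    - fderiv ℝ f p ∘L ContinuousLinearMap.inl ℝ E E
    - (1 / 4 : ℝ) • (fderiv ℝ f p ∘L ContinuousLinearMap.inr ℝ E E) ∘L
      (fderiv ℝ f p ∘L ContinuousLinearMap.inr ℝ E E)

lemma sprayCurvature_apply (f : E × E → E) (p : E × E) (u : E) :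
    sprayCurvature f p u = (1 / 2 : ℝ) • fderiv ℝ (fderiv ℝ f) p (sprayField f p) (0, u)
      - fderiv ℝ f p (u, 0) - (1 / 4 : ℝ) • fderiv ℝ f p (0, fderiv ℝ f p (0, u)) :=
  rfl

/-- The horizontal lift of `u` at `p` for the nonlinear connection of the spray `(y, f)`. -/
def sprayHorizontal (f : E × E → E) (p : E × E) (u : E) : E × E :=
  (u, (1 / 2 : ℝ) • fderiv ℝ f p (0, u))

/-- `(y, f)` is a spray on the open set `O` of `E × E`: `f` is smooth and positively homogeneous
of degree two in `y`. -/
structure IsSprayOn (O : Set (E × E)) (f : E × E → E) : Prop where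
  isOpen : IsOpen O
  contDiffOn : ContDiffOn ℝ ∞ f O
  homogeneous : IsFibreHomogeneousOn 2 O f

namespace IsSprayOn

variable {O : Set (E × E)} {f : E × E → E} (h : IsSprayOn O f) {p : E × E} (hp : p ∈ O)
include h hp

lemma contDiffAt : ContDiffAt ℝ ∞ f p := h.contDiffOn.contDiffAt (h.isOpen.mem_nhds hp)

lemma fderiv_vertical : fderiv ℝ f p (0, p.2) = (2 : ℝ) • f p :=
  h.homogeneous.fderiv_euler hp ((h.contDiffAt hp).differentiableAt (by simp))

lemma fderiv_fderiv_vertical (X : E × E) :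
    fderiv ℝ (fderiv ℝ f) p X (0, p.2) = (2 : ℝ) • fderiv ℝ f p X - fderiv ℝ f p (0, X.2) :=
  h.homogeneous.fderiv_fderiv_euler h.isOpen hp h.contDiffOn X

lemma sprayHorizontal_self : sprayHorizontal f p p.2 = sprayField f p := by
  rw [sprayHorizontal, h.fderiv_vertical hp, smul_smul]
  norm_num [sprayField]

lemma sprayCurvature_self : sprayCurvature f p p.2 = 0 := by
  have hspray : fderiv ℝ f p (sprayField f p) = fderiv ℝ f p (p.2, 0) + fderiv ℝ f p (0, f p) :=
    clm_apply_mk _ _ _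
  have hdouble : ((0, (2 : ℝ) • f p) : E × E) = (2 : ℝ) • (0, f p) := by simp
  rw [sprayCurvature_apply, h.fderiv_fderiv_vertical hp, h.fderiv_vertical hp, hspray, hdouble,
    map_smul, sprayField]
  module

lemma fderiv_fderiv_horizontal (u : E) :
    (1 / 2 : ℝ) • fderiv ℝ (fderiv ℝ f) p (sprayField f p) (0, u)
      - (1 / 2 : ℝ) • fderiv ℝ (fderiv ℝ f) p (sprayHorizontal f p u) (0, p.2)
      = sprayCurvature f p u := by
  have hhalf : ((0, (1 / 2 : ℝ) • fderiv ℝ f p (0, u)) : E × E) =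
    (1 / 2 : ℝ) • (0, fderiv ℝ f p (0, u)) := by simp
  rw [h.fderiv_fderiv_vertical hp, sprayCurvature_apply, sprayHorizontal, clm_apply_mk _ u, hhalf,
    map_smul]
  module

end IsSprayOn

end Spray

section CoordinateEnergy

variable {E : Type*} [NormedAddCommGroup E] [NormedSpace ℝ E]

/-- `L` is, on the open subset `O` of `E × E`, the coordinate expression of the energy of a
Finsler metric. -/
structure IsCoordEnergy (O : Set (E × E)) (L : E × E → ℝ) : Prop where
  isOpen : IsOpen O
  contDiffOn : ContDiffOn ℝ ∞ L O
  smul_mem : ∀ p ∈ O, ∀ c : ℝ, 0 < c → (p.1, c • p.2) ∈ O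
  homogeneous : IsFibreHomogeneousOn 2 O L
  posDef : ∀ p ∈ O, ∀ u : E, u ≠ 0 → 0 < fderiv ℝ (fderiv ℝ L) p (0, u) (0, u)

/-- The symplectic form `-d(∂_y L dx)`. -/
def coordOmega (L : E × E → ℝ) (p X Y : E × E) : ℝ :=
  fderiv ℝ (fderiv ℝ L) p Y (0, X.1) - fderiv ℝ (fderiv ℝ L) p X (0, Y.1)

/-- The second fibre derivative of `L`, the fundamental tensor in coordinates. -/
def coordMetric (L : E × E → ℝ) (p : E × E) : E →L[ℝ] E →L[ℝ] ℝ :=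
  ((ContinuousLinearMap.compL ℝ E (E × E) ℝ).flip (ContinuousLinearMap.inr ℝ E E)).comp
    ((fderiv ℝ (fderiv ℝ L) p).comp (ContinuousLinearMap.inr ℝ E E))

@[simp] lemma coordMetric_apply (L : E × E → ℝ) (p : E × E) (u e : E) :
    coordMetric L p u e = fderiv ℝ (fderiv ℝ L) p (0, u) (0, e) := rfl

lemma coordOmega_vertical (L : E × E → ℝ) (p : E × E) (u : E) (Y : E × E) :
    coordOmega L p (0, u) Y = -coordMetric L p u Y.1 := by
  rw [coordOmega, Prod.mk_zero_zero, map_zero, zero_sub, coordMetric_apply]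

/-- The force `f` of the geodesic spray `(y, f)` of `L`, that is, the solution of the
Euler–Lagrange equation `D²L(y, f)(0, ·) = ∂_x L`. -/
def coordForce (L : E × E → ℝ) (p : E × E) : E :=
  (coordMetric L p).inverse ((fderiv ℝ L p).comp (ContinuousLinearMap.inl ℝ E E)
    - (fderiv ℝ (fderiv ℝ L) p (p.2, 0)).comp (ContinuousLinearMap.inr ℝ E E))

namespace IsCoordEnergy

variable {O : Set (E × E)} {L : E × E → ℝ} (h : IsCoordEnergy O L) {p : E × E} (hp : p ∈ O)
include h hp

lemma contDiffAt : ContDiffAt ℝ ∞ L p := h.contDiffOn.contDiffAt (h.isOpen.mem_nhds hp)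

lemma symm (X Y : E × E) : fderiv ℝ (fderiv ℝ L) p X Y = fderiv ℝ (fderiv ℝ L) p Y X :=
  fderiv_fderiv_comm (h.contDiffAt hp) X Y

lemma fderiv_fderiv_vertical (X : E × E) :
    fderiv ℝ (fderiv ℝ L) p X (0, p.2) = 2 * fderiv ℝ L p X - fderiv ℝ L p (0, X.2) :=
  h.homogeneous.fderiv_fderiv_euler h.isOpen hp h.contDiffOn X

lemma fderiv_vertical_eq (u : E) : fderiv ℝ L p (0, u) = coordMetric L p p.2 u := by
  rw [coordMetric_apply, h.symm hp, h.fderiv_fderiv_vertical hp]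
  ring

lemma coordMetric_symm (u e : E) : coordMetric L p u e = coordMetric L p e u :=
  h.symm hp _ _

lemma coordMetric_self_self : coordMetric L p p.2 p.2 = 2 * L p := by
  rw [← h.fderiv_vertical_eq hp]
  exact h.homogeneous.fderiv_euler hp ((h.contDiffAt hp).differentiableAt (by simp))

lemma coordMetric_injective : Function.Injective (coordMetric L p) := by
  refine (injective_iff_map_eq_zero _).2 fun u hu => by_contra fun hne => ?_
  have hpos : 0 < coordMetric L p u u := h.posDef p hp u hne
  simp [hu] at hpos

lemma eq_of_fderiv_fderiv_eq {x e₁ e₂ : E} (he : ∀ u,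
    fderiv ℝ (fderiv ℝ L) p (x, e₁) (0, u) = fderiv ℝ (fderiv ℝ L) p (x, e₂) (0, u)) :
    e₁ = e₂ := by
  refine h.coordMetric_injective hp (ContinuousLinearMap.ext fun u => ?_)
  simpa [clm_apply_mk _ x e₁, clm_apply_mk _ x e₂] using he u

variable [FiniteDimensional ℝ E]

lemma exists_coordMetric_equiv :
    ∃ e : E ≃L[ℝ] (E →L[ℝ] ℝ), (e : E →L[ℝ] E →L[ℝ] ℝ) = coordMetric L p := by
  have hdim : Module.finrank ℝ E = Module.finrank ℝ (E →L[ℝ] ℝ) := by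
    rw [← (LinearMap.toContinuousLinearMap (𝕜 := ℝ) (E := E) (F' := ℝ)).finrank_eq]
    exact (Subspace.dual_finrank_eq (K := ℝ) (V := E)).symm
  exact ⟨(LinearEquiv.ofInjectiveOfFinrankEq (coordMetric L p).toLinearMap
    (h.coordMetric_injective hp) hdim).toContinuousLinearEquiv, rfl⟩

lemma coordForce_spec (u : E) :
    fderiv ℝ (fderiv ℝ L) p (sprayField (coordForce L) p) (0, u) = fderiv ℝ L p (u, 0) := by
  obtain ⟨e, he⟩ := h.exists_coordMetric_equiv hp
  have hforce : coordMetric L p (coordForce L p) =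
      (fderiv ℝ L p).comp (ContinuousLinearMap.inl ℝ E E)
      - (fderiv ℝ (fderiv ℝ L) p (p.2, 0)).comp (ContinuousLinearMap.inr ℝ E E) := by
    rw [coordForce, ← he, ContinuousLinearMap.inverse_equiv]
    simp
  have happly : fderiv ℝ (fderiv ℝ L) p (0, coordForce L p) (0, u) =
      fderiv ℝ L p (u, 0) - fderiv ℝ (fderiv ℝ L) p (p.2, 0) (0, u) := congrArg (· u) hforce
  rw [sprayField, clm_apply_mk _ p.2, add_apply, happly, add_sub_cancel]

lemma eq_coordForce {e : E}
    (he : ∀ u, fderiv ℝ (fderiv ℝ L) p (p.2, e) (0, u) = fderiv ℝ L p (u, 0)) :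
    e = coordForce L p :=
  h.eq_of_fderiv_fderiv_eq hp fun u => (he u).trans (h.coordForce_spec hp u).symm

lemma coordOmega_eq_iff {X : E × E} :
    (∀ Y, coordOmega L p X Y = fderiv ℝ L p Y) ↔ X = sprayField (coordForce L) p := by
  constructor
  · intro hX
    have hfst : X.1 = p.2 := by
      refine h.coordMetric_injective hp (ContinuousLinearMap.ext fun u => ?_)
      have hu := hX (0, u)
      rw [coordOmega, Prod.mk_zero_zero, map_zero, sub_zero, h.fderiv_vertical_eq hp] at hu
      rw [h.coordMetric_symm hp, coordMetric_apply, hu]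
    refine Prod.ext hfst (h.eq_coordForce hp fun u => ?_)
    have hu := hX (u, 0)
    rw [coordOmega, hfst, h.fderiv_fderiv_vertical hp, Prod.mk_zero_zero, map_zero] at hu
    rw [← hfst]
    linarith
  · rintro rfl ⟨Y₁, Y₂⟩
    have hspec := h.coordForce_spec hp Y₁
    have hY := clm_apply_mk (fderiv ℝ L p) Y₁ Y₂
    simp only [coordOmega, sprayField] at hspec ⊢
    rw [h.fderiv_fderiv_vertical hp]
    linarith

lemma contDiffAt_coordForce : ContDiffAt ℝ ∞ (coordForce L) p := by
  obtain ⟨e, he⟩ := h.exists_coordMetric_equiv hp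
  have hD := contDiffAt_fderiv (h.contDiffAt hp)
  have hD₂ := contDiffAt_fderiv hD
  have hmetric : ContDiffAt ℝ ∞ (coordMetric L) p :=
    contDiffAt_const.clm_comp (hD₂.clm_comp contDiffAt_const)
  have hinverse : ContDiffAt ℝ ∞ (fun q => (coordMetric L q).inverse) p :=
    ContDiffAt.comp p (g := ContinuousLinearMap.inverse)
      (by rw [← he]; exact contDiffAt_map_inverse e) hmetric
  refine hinverse.clm_apply ((hD.clm_comp contDiffAt_const).sub ?_)
  exact (hD₂.clm_apply (contDiffAt_snd.prodMk contDiffAt_const)).clm_comp contDiffAt_const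

lemma coordForce_smul {c : ℝ} (hc : 0 < c) :
    coordForce L (p.1, c • p.2) = c ^ 2 • coordForce L p := by
  let σ : E × E →L[ℝ] E × E :=
    (ContinuousLinearMap.fst ℝ E E).prod (c • ContinuousLinearMap.snd ℝ E E)
  have hσ : MapsTo σ O O := fun q hq => h.smul_mem q hq c hc
  have hL : ∀ q ∈ O, L (σ q) = c ^ 2 • L q := fun q hq => h.homogeneous q hq c hc
  refine (h.eq_coordForce (h.smul_mem p hp c hc) fun u => ?_).symm
  have hfield : ((c • p.2, c ^ 2 • coordForce L p) : E × E) =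
      c • σ (sprayField (coordForce L) p) := by
    simp [σ, sprayField, smul_smul, pow_two]
  have hvert : ((0, u) : E × E) = c⁻¹ • σ (0, u) := by simp [σ, smul_smul, hc.ne']
  have hhor : ((u, 0) : E × E) = σ (u, 0) := by simp [σ]
  calc fderiv ℝ (fderiv ℝ L) (σ p) (c • p.2, c ^ 2 • coordForce L p) (0, u)
      = c * (c⁻¹ * (c ^ 2 * fderiv ℝ L p (u, 0))) := by
        rw [hfield, hvert, map_smul, map_smul, smul_apply,
          fderiv_fderiv_map_of_map_eq_smul h.isOpen h.contDiffOn hσ hL hp, h.coordForce_spec hp]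
        simp only [smul_eq_mul]
        ring
    _ = fderiv ℝ L (σ p) (u, 0) := by
        rw [hhor, fderiv_map_of_map_eq_smul h.isOpen h.contDiffOn hσ hL hp, ← hhor, smul_eq_mul]
        field_simp

omit hp in
lemma isSprayOn : IsSprayOn O (coordForce L) where
  isOpen := h.isOpen
  contDiffOn _ hq := (h.contDiffAt_coordForce hq).contDiffWithinAt
  homogeneous _ hq _ hc := h.coordForce_smul hq hc

lemma fderiv_sprayField : fderiv ℝ L p (sprayField (coordForce L) p) = 0 := by
  have hspec := h.coordForce_spec hp p.2
  have hsplit := clm_apply_mk (fderiv ℝ L p) p.2 (coordForce L p)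
  rw [h.fderiv_fderiv_vertical hp] at hspec
  simp only [sprayField] at hspec ⊢
  linarith

lemma fderiv_fderiv_sprayField (X : E × E) :
    fderiv ℝ (fderiv ℝ L) p X (sprayField (coordForce L) p) =
      -fderiv ℝ L p (X.2, fderiv ℝ (coordForce L) p X) := by
  have hderiv := (hasFDerivAt_fderiv (h.contDiffAt hp)).clm_apply
    (hasFDerivAt_snd.prodMk (hasFDerivAt_of_contDiffAt (h.contDiffAt_coordForce hp)))
  have hzero : (fun _ => (0 : ℝ)) =ᶠ[𝓝 p] fun q => fderiv ℝ L q (q.2, coordForce L q) :=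
    (h.isOpen.eventually_mem hp).mono fun q hq => (h.fderiv_sprayField hq).symm
  have := congrArg (· X)
    ((hderiv.congr_of_eventuallyEq hzero).unique (hasFDerivAt_const (0 : ℝ) p))
  simp only [ContinuousLinearMap.comp_apply, add_apply, ContinuousLinearMap.flip_apply,
    ContinuousLinearMap.prod_apply, ContinuousLinearMap.coe_snd', zero_apply] at this
  rw [sprayField]
  linarith

-- The energy is constant along the horizontal lifts `(u, ½ ∂_y f u)`.
lemma fderiv_sprayHorizontal (u : E) :
    2 * fderiv ℝ L p (u, 0) + fderiv ℝ L p (0, fderiv ℝ (coordForce L) p (0, u)) = 0 := by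
  have hS := h.fderiv_fderiv_sprayField hp (0, u)
  rw [h.symm hp, h.coordForce_spec hp] at hS
  have hsplit := clm_apply_mk (fderiv ℝ L p) u (fderiv ℝ (coordForce L) p (0, u))
  dsimp only at hS
  linarith

lemma fderiv_fderiv_sprayHorizontal (u : E) (X : E × E) :
    2 * fderiv ℝ (fderiv ℝ L) p X (u, 0)
      + (fderiv ℝ (fderiv ℝ L) p X (0, fderiv ℝ (coordForce L) p (0, u))
        + fderiv ℝ L p (0, fderiv ℝ (fderiv ℝ (coordForce L)) p X (0, u))) = 0 := by
  have hD := hasFDerivAt_fderiv (h.contDiffAt hp)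
  have hbase := (hD.clm_apply (hasFDerivAt_const ((u, 0) : E × E) p)).const_mul 2
  have hfibre := hD.clm_apply ((hasFDerivAt_const (0 : E) p).prodMk
    ((hasFDerivAt_fderiv (h.contDiffAt_coordForce hp)).clm_apply
      (hasFDerivAt_const ((0, u) : E × E) p)))
  have hzero := (h.isOpen.eventually_mem hp).mono fun q hq =>
    (h.fderiv_sprayHorizontal hq u).symm
  have := congrArg (· X) (((hbase.add hfibre).congr_of_eventuallyEq hzero).unique
    (hasFDerivAt_const (0 : ℝ) p))
  simpa [add_comm] using this

lemma fderiv_sprayCurvature (u : E) :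
    fderiv ℝ L p (0, sprayCurvature (coordForce L) p u) = 0 := by
  have hhor := h.fderiv_fderiv_sprayHorizontal hp u (sprayField (coordForce L) p)
  rw [h.symm hp, h.fderiv_fderiv_sprayField hp, h.coordForce_spec hp] at hhor
  have hNu := h.fderiv_sprayHorizontal hp (fderiv ℝ (coordForce L) p (0, u))
  dsimp only at hhor
  have hsplit : ∀ a b c : E, fderiv ℝ L p (0, (1 / 2 : ℝ) • a - b - (1 / 4 : ℝ) • c) =
      1 / 2 * fderiv ℝ L p (0, a) - fderiv ℝ L p (0, b) - 1 / 4 * fderiv ℝ L p (0, c) :=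
    fun a b c => by simp [← smul_eq_mul, ← map_smul, ← map_sub]
  rw [sprayCurvature_apply, hsplit]
  linarith

lemma coordMetric_sprayCurvature_self (u : E) :
    coordMetric L p (sprayCurvature (coordForce L) p u) p.2 = 0 := by
  rw [h.coordMetric_symm hp, ← h.fderiv_vertical_eq hp, h.fderiv_sprayCurvature hp]

end IsCoordEnergy

end CoordinateEnergy

section FanningCurves

variable {V : Type*} [NormedAddCommGroup V] [NormedSpace ℝ V] {ℓ : ℝ → Submodule ℝ V} {t : ℝ}

lemma IsSectionNear.hasDerivAt {a : ℝ → V} (ha : IsSectionNear ℓ t a) :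
    HasDerivAt a (deriv a t) t := by
  obtain ⟨J, hJ, ht, hsmooth, -⟩ := ha
  exact ((hsmooth.contDiffAt (hJ.mem_nhds ht)).differentiableAt (by simp)).hasDerivAt

lemma IsSectionNear.eventually_mem {a : ℝ → V} (ha : IsSectionNear ℓ t a) :
    ∀ᶠ s in 𝓝 t, a s ∈ ℓ s := by
  obtain ⟨J, hJ, ht, -, hmem⟩ := ha
  exact (hJ.eventually_mem ht).mono hmem

lemma IsFrameNear.isSectionNear {n : ℕ} {a : Fin n → ℝ → V} (ha : IsFrameNear ℓ t a) (i : Fin n) :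
    IsSectionNear ℓ t (a i) := by
  obtain ⟨J, hJ, ht, hsmooth, hframe⟩ := ha
  exact ⟨J, hJ, ht, hsmooth i, fun s hs => (hframe s hs).2 ▸ Submodule.subset_span ⟨i, rfl⟩⟩

lemma fundamentalEndomorphism_eq_of_forall_section (hfan : IsFanningAt ℓ t) {B : V →L[ℝ] V}
    (hB : ∀ a, IsSectionNear ℓ t a → B (a t) = 0 ∧ B (deriv a t) = a t) :
    fundamentalEndomorphism ℓ t = B := by
  obtain ⟨m, b, hb, hbfan⟩ := hfan
  obtain ⟨n, a, ha, hafan, hT⟩ : IsFundamentalEndomorphismAt ℓ t (fundamentalEndomorphism ℓ t) :=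
    Classical.epsilon_spec ⟨B, m, b, hb, hbfan, fun i => hB _ (hb.isSectionNear i)⟩
  refine ContinuousLinearMap.coe_injective (LinearMap.ext_on_range hafan.2 ?_)
  rintro (i | i)
  · exact (hT i).1.trans (hB _ (ha.isSectionNear i)).1.symm
  · exact (hT i).2.trans (hB _ (ha.isSectionNear i)).2.symm

lemma wronskian_eq_of_forall_section {Ω : V → V → ℝ} {x y : V} {r : ℝ}
    (hex : ∃ b, IsSectionNear ℓ t b ∧ b t = y)
    (hr : ∀ b, IsSectionNear ℓ t b → b t = y → Ω x (deriv b t) = r) :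
    wronskian Ω ℓ t x y = r :=
  hr _ (Classical.epsilon_spec hex).1 (Classical.epsilon_spec hex).2

end FanningCurves

section LinearFlow

variable {V : Type*} [NormedAddCommGroup V] [NormedSpace ℝ V]

/-- `M` is the fundamental solution of the linear differential equation `Ẋ = A X` on the open set
of times `T`. -/
structure IsLinearFlow (T : Set ℝ) (A M : ℝ → V →L[ℝ] V) : Prop where
  isOpen : IsOpen T
  zero_mem : 0 ∈ T
  contDiffOn : ContDiffOn ℝ ∞ M T
  apply_zero : M 0 = ContinuousLinearMap.id ℝ V
  hasDerivAt : ∀ t ∈ T, HasDerivAt M (A t ∘L M t) t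
  isInvertible : ∀ t ∈ T, (M t).IsInvertible

namespace IsLinearFlow

variable {T : Set ℝ} {A M : ℝ → V →L[ℝ] V} (h : IsLinearFlow T A M) {t : ℝ} (ht : t ∈ T)
include h

lemma inverse_zero : (M 0).inverse = ContinuousLinearMap.id ℝ V := by
  rw [h.apply_zero, ContinuousLinearMap.inverse_id]

variable [CompleteSpace V]
include ht

lemma contDiffAt_inverse : ContDiffAt ℝ ∞ (fun s => (M s).inverse) t :=
  (h.isInvertible t ht).contDiffAt_map_inverse.comp t
    (h.contDiffOn.contDiffAt (h.isOpen.mem_nhds ht))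

lemma hasDerivAt_inverse : HasDerivAt (fun s => (M s).inverse) (-((M t).inverse ∘L A t)) t := by
  have hinv := ((h.contDiffAt_inverse ht).differentiableAt (by simp)).hasDerivAt
  have hid : (fun _ => ContinuousLinearMap.id ℝ V) =ᶠ[𝓝 t] fun s => (M s).inverse ∘L M s :=
    (h.isOpen.eventually_mem ht).mono fun s hs => (h.isInvertible s hs).inverse_comp_self.symm
  have hzero := ((hinv.clm_comp (h.hasDerivAt t ht)).congr_of_eventuallyEq hid).unique
    (hasDerivAt_const t _)
  refine hinv.congr_deriv (eq_neg_of_add_eq_zero_left ?_)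
  simpa [ContinuousLinearMap.add_comp, ContinuousLinearMap.comp_assoc,
    (h.isInvertible t ht).self_comp_inverse] using congrArg (· ∘L (M t).inverse) hzero

lemma hasDerivAt_conj {B : ℝ → V →L[ℝ] V} {B' : V →L[ℝ] V} (hB : HasDerivAt B B' t) :
    HasDerivAt (fun s => (M s).inverse ∘L B s ∘L M s)
      ((M t).inverse ∘L (B' + B t ∘L A t - A t ∘L B t) ∘L M t) t := by
  refine ((h.hasDerivAt_inverse ht).clm_comp
    (hB.clm_comp (h.hasDerivAt t ht))).congr_deriv ?_
  ext X
  simp only [ContinuousLinearMap.comp_apply, add_apply, sub_apply, neg_apply, map_add, map_sub]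
  abel

end IsLinearFlow

end LinearFlow

lemma linearIndependent_sum_elim_of_comp {ι κ V W : Type*} [AddCommGroup V] [Module ℝ V]
    [AddCommGroup W] [Module ℝ W] {f : V →ₗ[ℝ] W} {v : ι → V} {w : κ → V}
    (hv : LinearIndependent ℝ v) (hfv : ∀ i, f (v i) = 0) (hfw : LinearIndependent ℝ (f ∘ w)) :
    LinearIndependent ℝ (Sum.elim v w) := by
  refine hv.sum_type (LinearIndependent.of_comp f hfw) ?_
  have hker : Submodule.span ℝ (range v) ≤ LinearMap.ker f :=
    Submodule.span_le.2 (range_subset_iff.2 hfv)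
  exact ((Submodule.range_ker_disjoint hfw).mono_right hker).symm

section SecondOrder

variable {E : Type*} [NormedAddCommGroup E] [NormedSpace ℝ E]

/-- The first order system `(x, y) ↦ (y, P x + Q y)` of the linear equation `ẍ = P x + Q ẋ`. -/
def companion (P Q : E →L[ℝ] E) : E × E →L[ℝ] E × E :=
  (ContinuousLinearMap.snd ℝ E E).prod (P.coprod Q)

@[simp] lemma companion_apply (P Q : E →L[ℝ] E) (X : E × E) :
    companion P Q X = (X.2, P X.1 + Q X.2) := rfl

/-- The almost-tangent structure `(x, y) ↦ (0, x)` of `E × E`. -/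
def coordAlmostTangent (E : Type*) [NormedAddCommGroup E] [NormedSpace ℝ E] :
    E × E →L[ℝ] E × E :=
  ContinuousLinearMap.inr ℝ E E ∘L ContinuousLinearMap.fst ℝ E E

@[simp] lemma coordAlmostTangent_apply (X : E × E) : coordAlmostTangent E X = (0, X.1) := rfl

/-- The reflection of `E × E` with `(-1)`-eigenspace `0 × E` and with the graph of `Q / 2` as
`1`-eigenspace. For `Q = ∂_y f` it is the canonical connection of the spray `(y, f)`. -/
def coordReflection (Q : E →L[ℝ] E) : E × E →L[ℝ] E × E :=
  (ContinuousLinearMap.fst ℝ E E).prod (Q.coprod (-ContinuousLinearMap.id ℝ E))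

@[simp] lemma coordReflection_apply (Q : E →L[ℝ] E) (X : E × E) :
    coordReflection Q X = (X.1, Q X.1 - X.2) := by
  simp [coordReflection, sub_eq_add_neg]

lemma companion_coordAlmostTangent_commutator (P Q : E →L[ℝ] E) :
    (-coordAlmostTangent E) ∘L companion P Q - companion P Q ∘L (-coordAlmostTangent E) =
      coordReflection Q := by
  refine ContinuousLinearMap.ext fun X => ?_
  simp [neg_add_eq_sub]

/-- The second derivative of the fundamental endomorphism of the curve `M(t)⁻¹ (0 × E)`, where `M`
is the flow of `ẍ = P x + Q ẋ`, conjugated by `M(t)`; here `Q'` is the derivative of `Q`. -/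
def coordFundamentalSecondDeriv (P Q Q' : E →L[ℝ] E) : E × E →L[ℝ] E × E :=
  ContinuousLinearMap.inr ℝ E E ∘L Q' ∘L ContinuousLinearMap.fst ℝ E E
    + coordReflection Q ∘L companion P Q - companion P Q ∘L coordReflection Q

lemma coordFundamentalSecondDeriv_apply (P Q Q' : E →L[ℝ] E) (X : E × E) :
    coordFundamentalSecondDeriv P Q Q' X =
      ((2 : ℝ) • X.2 - Q X.1, Q' X.1 - (2 : ℝ) • P X.1 - Q (Q X.1) + Q X.2) := by
  simp only [coordFundamentalSecondDeriv, add_apply, sub_apply, ContinuousLinearMap.comp_apply,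
    ContinuousLinearMap.inr_apply, ContinuousLinearMap.coe_fst', companion_apply,
    coordReflection_apply, map_sub, Prod.mk_add_mk, Prod.mk_sub_mk]
  congr 1 <;> module

lemma coordFundamentalSecondDeriv_sq_vertical (P Q Q' : E →L[ℝ] E) (e : E) :
    (1 / 4 : ℝ) • coordFundamentalSecondDeriv P Q Q' (coordFundamentalSecondDeriv P Q Q' (0, e)) =
      (0, (1 / 2 : ℝ) • Q' e - P e - (1 / 4 : ℝ) • Q (Q e)) := by
  simp only [coordFundamentalSecondDeriv_apply, map_zero, sub_zero, zero_add, map_smul,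
    smul_zero, Prod.smul_mk]
  congr 1 <;> module

section VerticalCurve

variable {T : Set ℝ} {P Q : ℝ → E →L[ℝ] E} {M : ℝ → E × E →L[ℝ] E × E}
  {ℓ : ℝ → Submodule ℝ (E × E)} {t : ℝ}
  (h : IsLinearFlow T (fun s => companion (P s) (Q s)) M)
  (hℓ : ∀ s ∈ T, ∀ X, X ∈ ℓ s ↔ (M s X).1 = 0)
include h hℓ

lemma fst_flow_deriv_section (ht : t ∈ T) {a : ℝ → E × E} (ha : IsSectionNear ℓ t a) :
    (M t (deriv a t)).1 = -(M t (a t)).2 := by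
  have hzero : (fun _ => (0 : E)) =ᶠ[𝓝 t] fun s => (M s (a s)).1 := by
    filter_upwards [ha.eventually_mem, h.isOpen.mem_nhds ht] with s hs hsT
    exact ((hℓ s hsT _).1 hs).symm
  have hderiv := hasFDerivAt_fst.comp_hasDerivAt t ((h.hasDerivAt t ht).clm_apply ha.hasDerivAt)
  exact eq_neg_of_add_eq_zero_right
    ((hderiv.congr_of_eventuallyEq hzero).unique (hasDerivAt_const t (0 : E)))

lemma inverse_vertical_mem (ht : t ∈ T) (e : E) : (M t).inverse (0, e) ∈ ℓ t := by
  rw [hℓ t ht, (h.isInvertible t ht).self_apply_inverse]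

lemma span_inverse_vertical (ht : t ∈ T) {ι : Type*} {b : ι → E}
    (hb : Submodule.span ℝ (range b) = ⊤) :
    Submodule.span ℝ (range fun i => (M t).inverse (0, b i)) = ℓ t := by
  have hrange : range (fun i => (M t).inverse (0, b i)) =
      ((M t).inverse ∘L ContinuousLinearMap.inr ℝ E E).toLinearMap '' range b := by
    rw [← range_comp]
    rfl
  rw [hrange, Submodule.span_image, hb, Submodule.map_top]
  refine le_antisymm ?_ fun X hX => ⟨(M t X).2, ?_⟩
  · rintro _ ⟨e, rfl⟩
    exact inverse_vertical_mem h hℓ ht e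
  · have hMX : M t X = (0, (M t X).2) := Prod.ext ((hℓ t ht X).1 hX) rfl
    exact hMX ▸ (h.isInvertible t ht).inverse_apply_self X

variable [CompleteSpace E]

lemma isSectionNear_inverse_vertical (ht : t ∈ T) (e : E) :
    IsSectionNear ℓ t fun s => (M s).inverse (0, e) :=
  ⟨T, h.isOpen, ht, fun _ hs =>
    ((h.contDiffAt_inverse hs).clm_apply contDiffAt_const).contDiffWithinAt,
    fun _ hs => inverse_vertical_mem h hℓ hs e⟩

lemma wronskian_vertical {Ω : E × E → E × E → ℝ} {x : E × E} {c : E → ℝ}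
    (hΩ : ∀ Y, Ω x Y = c Y.1) (e : E) : wronskian Ω ℓ 0 x (0, e) = c (-e) := by
  refine wronskian_eq_of_forall_section
    ⟨_, isSectionNear_inverse_vertical h hℓ h.zero_mem e, by simp [h.inverse_zero]⟩
    fun a ha ha₀ => ?_
  have hfst := fst_flow_deriv_section h hℓ h.zero_mem ha
  simp only [h.apply_zero, ha₀, ContinuousLinearMap.id_apply] at hfst
  rw [hΩ, hfst]

lemma isFanningAt_vertical [FiniteDimensional ℝ E] (ht : t ∈ T) : IsFanningAt ℓ t := by
  let b := Module.finBasis ℝ E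
  let a : Fin (Module.finrank ℝ E) → ℝ → E × E := fun i s => (M s).inverse (0, b i)
  have hsection : ∀ i, IsSectionNear ℓ t (a i) := fun i =>
    isSectionNear_inverse_vertical h hℓ ht (b i)
  have hindep : ∀ s ∈ T, LinearIndependent ℝ fun i => a i s := fun s hs =>
    b.linearIndependent.map' ((M s).inverse ∘L ContinuousLinearMap.inr ℝ E E).toLinearMap
      (LinearMap.ker_eq_bot.2 ((h.isInvertible s hs).inverse.injective.comp
        LinearMap.inr_injective))
  have hfst : ∀ i, (M t (a i t)).1 = 0 := fun i =>
    (hℓ t ht _).1 (inverse_vertical_mem h hℓ ht (b i))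
  have hfst_deriv : ∀ i, (M t (deriv (a i) t)).1 = -b i := fun i => by
    rw [fst_flow_deriv_section h hℓ ht (hsection i), (h.isInvertible t ht).self_apply_inverse]
  have hfanning : LinearIndependent ℝ
      (Sum.elim (fun i => a i t) fun i => deriv (a i) t) := by
    refine linearIndependent_sum_elim_of_comp
      (f := (ContinuousLinearMap.fst ℝ E E ∘L M t).toLinearMap) (hindep t ht) hfst ?_
    have hcomp : (ContinuousLinearMap.fst ℝ E E ∘L M t).toLinearMap ∘ (fun i => deriv (a i) t) =
        -b := funext hfst_deriv
    exact hcomp ▸ b.linearIndependent.neg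
  refine ⟨_, a, ⟨T, h.isOpen, ht, fun i s hs =>
    ((h.contDiffAt_inverse hs).clm_apply contDiffAt_const).contDiffWithinAt, fun s hs =>
    ⟨hindep s hs, span_inverse_vertical h hℓ hs b.span_eq⟩⟩, hfanning, ?_⟩
  exact hfanning.span_eq_top_of_card_eq_finrank' (by simp [Module.finrank_prod])

variable [FiniteDimensional ℝ E]

lemma fundamentalEndomorphism_vertical (ht : t ∈ T) :
    fundamentalEndomorphism ℓ t = (M t).inverse ∘L (-coordAlmostTangent E) ∘L M t := by
  refine fundamentalEndomorphism_eq_of_forall_section (isFanningAt_vertical h hℓ ht)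
    fun a ha => ?_
  have hfst : (M t (a t)).1 = 0 := (hℓ t ht _).1 ha.eventually_mem.self_of_nhds
  have hMa : M t (a t) = (0, (M t (a t)).2) := Prod.ext hfst rfl
  constructor
  · simp [hfst, Prod.mk_zero_zero]
  · simp only [ContinuousLinearMap.comp_apply, neg_apply, coordAlmostTangent_apply,
      fst_flow_deriv_section h hℓ ht ha, Prod.neg_mk, neg_neg, neg_zero, ← hMa,
      (h.isInvertible t ht).inverse_apply_self]

lemma hasDerivAt_fundamentalEndomorphism_vertical (ht : t ∈ T) :
    HasDerivAt (fundamentalEndomorphism ℓ) ((M t).inverse ∘L coordReflection (Q t) ∘L M t) t := by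
  have hconj := h.hasDerivAt_conj ht (hasDerivAt_const t (-coordAlmostTangent E))
  rw [zero_add, companion_coordAlmostTangent_commutator] at hconj
  exact hconj.congr_of_eventuallyEq
    ((h.isOpen.eventually_mem ht).mono fun s hs => fundamentalEndomorphism_vertical h hℓ hs)

lemma deriv_deriv_fundamentalEndomorphism_vertical (ht : t ∈ T) {Q' : E →L[ℝ] E}
    (hQ : HasDerivAt Q Q' t) :
    deriv (deriv (fundamentalEndomorphism ℓ)) t =
      (M t).inverse ∘L coordFundamentalSecondDeriv (P t) (Q t) Q' ∘L M t := by
  have hreflection : HasDerivAt (fun s => coordReflection (Q s))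
      (ContinuousLinearMap.inr ℝ E E ∘L Q' ∘L ContinuousLinearMap.fst ℝ E E) t := by
    have hsplit : ∀ s, coordReflection (Q s) = coordReflection 0 +
        ContinuousLinearMap.inr ℝ E E ∘L Q s ∘L ContinuousLinearMap.fst ℝ E E := fun s =>
      ContinuousLinearMap.ext fun X => by simp [sub_eq_neg_add]
    simpa only [hsplit, ContinuousLinearMap.zero_comp, ContinuousLinearMap.comp_zero, zero_add,
      add_zero] using
      ((hasDerivAt_const t (ContinuousLinearMap.inr ℝ E E)).clm_comp
      (hQ.clm_comp (hasDerivAt_const t (ContinuousLinearMap.fst ℝ E E)))).const_add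
        (coordReflection 0)
  exact ((h.hasDerivAt_conj ht hreflection).congr_of_eventuallyEq
    ((h.isOpen.eventually_mem ht).mono fun s hs =>
      (hasDerivAt_fundamentalEndomorphism_vertical h hℓ hs).deriv)).deriv

lemma jacobiEndomorphism_vertical {Q' : E →L[ℝ] E} (hQ : HasDerivAt Q Q' 0) (e : E) :
    jacobiEndomorphism ℓ 0 (0, e) =
      (0, (1 / 2 : ℝ) • Q' e - P 0 e - (1 / 4 : ℝ) • Q 0 (Q 0 e)) := by
  have hsecond : deriv (deriv (fundamentalEndomorphism ℓ)) 0 =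
      coordFundamentalSecondDeriv (P 0) (Q 0) Q' := by
    rw [deriv_deriv_fundamentalEndomorphism_vertical h hℓ h.zero_mem hQ, h.inverse_zero,
      h.apply_zero, ContinuousLinearMap.id_comp, ContinuousLinearMap.comp_id]
  rw [jacobiEndomorphism, hsecond]
  exact coordFundamentalSecondDeriv_sq_vertical (P 0) (Q 0) Q' e

end VerticalCurve

end SecondOrder

section LocalFlow

variable {V : Type*} [NormedAddCommGroup V] [NormedSpace ℝ V]

/-- `Ψ` is, on the open set `W` of times and initial points, a smooth flow in `O` of the vector
field `S`. -/
structure IsLocalFlow (O : Set V) (S : V → V) (W : Set (ℝ × V)) (Ψ : ℝ × V → V) : Prop where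
  isOpen : IsOpen W
  contDiffOn : ContDiffOn ℝ ∞ Ψ W
  mapsTo : MapsTo Ψ W O
  apply_zero : ∀ p, (0, p) ∈ W → Ψ (0, p) = p
  hasDerivAt : ∀ z ∈ W, HasDerivAt (fun s => Ψ (s, z.2)) (S (Ψ z)) z.1

namespace IsLocalFlow

variable {O : Set V} {S : V → V} {W : Set (ℝ × V)} {Ψ : ℝ × V → V} (h : IsLocalFlow O S W Ψ)
  {z : ℝ × V} {p : V}
include h

lemma contDiffAt (hz : z ∈ W) : ContDiffAt ℝ ∞ Ψ z :=
  h.contDiffOn.contDiffAt (h.isOpen.mem_nhds hz)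

lemma fderiv_time (hz : z ∈ W) : fderiv ℝ Ψ z (1, 0) = S (Ψ z) :=
  ((hasFDerivAt_of_contDiffAt (h.contDiffAt hz)).comp_hasDerivAt z.1
    ((hasDerivAt_id z.1).prodMk (hasDerivAt_const z.1 z.2))).unique (h.hasDerivAt z hz)

lemma fderiv_space (hz : z ∈ W) :
    fderiv ℝ (fun q => Ψ (z.1, q)) z.2 = fderiv ℝ Ψ z ∘L ContinuousLinearMap.inr ℝ ℝ V :=
  ((hasFDerivAt_of_contDiffAt (h.contDiffAt hz)).comp z.2 (hasFDerivAt_prodMk_right z.1 z.2)).fderiv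

lemma fderiv_fderiv_time (hz : z ∈ W) (hS : DifferentiableAt ℝ S (Ψ z)) (Y : ℝ × V) :
    fderiv ℝ (fderiv ℝ Ψ) z (1, 0) Y = fderiv ℝ S (Ψ z) (fderiv ℝ Ψ z Y) := by
  have htime := (hasFDerivAt_fderiv (h.contDiffAt hz)).clm_apply
    (hasFDerivAt_const ((1, 0) : ℝ × V) z)
  have hev : (fun y => S (Ψ y)) =ᶠ[𝓝 z] fun y => fderiv ℝ Ψ y (1, 0) :=
    (h.isOpen.eventually_mem hz).mono fun y hy => (h.fderiv_time hy).symm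
  have hfield := hS.hasFDerivAt.comp z (hasFDerivAt_of_contDiffAt (h.contDiffAt hz))
  rw [fderiv_fderiv_comm (h.contDiffAt hz)]
  simpa using congrArg (· Y) ((htime.congr_of_eventuallyEq hev).unique hfield)

lemma hasDerivAt_fderiv_space (hz : z ∈ W) (hS : DifferentiableAt ℝ S (Ψ z)) :
    HasDerivAt (fun s => fderiv ℝ (fun q => Ψ (s, q)) z.2)
      (fderiv ℝ S (Ψ z) ∘L fderiv ℝ (fun q => Ψ (z.1, q)) z.2) z.1 := by
  have hline : HasDerivAt (fun s : ℝ => (s, z.2)) ((1 : ℝ), (0 : V)) z.1 :=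
    (hasDerivAt_id z.1).prodMk (hasDerivAt_const z.1 z.2)
  have hderiv : HasDerivAt (fun s => fderiv ℝ Ψ (s, z.2)) (fderiv ℝ (fderiv ℝ Ψ) z (1, 0)) z.1 :=
    (hasFDerivAt_fderiv (h.contDiffAt hz)).comp_hasDerivAt z.1 hline
  have hrestrict := hderiv.clm_comp
    (hasDerivAt_const z.1 (ContinuousLinearMap.inr ℝ ℝ V))
  have hspace : (fun s => fderiv ℝ (fun q => Ψ (s, q)) z.2) =ᶠ[𝓝 z.1]
      fun s => fderiv ℝ Ψ (s, z.2) ∘L ContinuousLinearMap.inr ℝ ℝ V :=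
    (hline.continuousAt.eventually (h.isOpen.eventually_mem hz)).mono fun s hs =>
      h.fderiv_space hs
  refine (hrestrict.congr_of_eventuallyEq hspace).congr_deriv
    (ContinuousLinearMap.ext fun X => ?_)
  rw [h.fderiv_space hz]
  simpa using h.fderiv_fderiv_time hz hS (0, X)

lemma fderiv_space_zero (hp : (0, p) ∈ W) :
    fderiv ℝ (fun q => Ψ (0, q)) p = ContinuousLinearMap.id ℝ V := by
  have hid : (fun q => Ψ (0, q)) =ᶠ[𝓝 p] id :=
    ((Continuous.prodMk_right (0 : ℝ)).continuousAt.eventually (h.isOpen.eventually_mem hp)).mono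
      h.apply_zero
  rw [hid.fderiv_eq, fderiv_id]

lemma contDiffOn_fderiv_space :
    ContDiffOn ℝ ∞ (fun s => fderiv ℝ (fun q => Ψ (s, q)) p) {s | (s, p) ∈ W} := by
  have hsmooth : ContDiffOn ℝ ∞ (fun s => fderiv ℝ Ψ (s, p) ∘L ContinuousLinearMap.inr ℝ ℝ V)
      {s | (s, p) ∈ W} := fun s hs =>
    (((contDiffAt_fderiv (h.contDiffAt hs)).comp s
      (contDiffAt_id.prodMk contDiffAt_const)).clm_comp contDiffAt_const).contDiffWithinAt
  exact hsmooth.congr fun s hs => h.fderiv_space hs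

lemma exists_isLinearFlow [CompleteSpace V] (hS : DifferentiableOn ℝ S O) (hO : IsOpen O)
    (hp : (0, p) ∈ W) : ∃ T ⊆ {t | (t, p) ∈ W},
      IsLinearFlow T (fun t => fderiv ℝ S (Ψ (t, p))) fun t => fderiv ℝ (fun q => Ψ (t, q)) p := by
  have hopen : IsOpen {t : ℝ | (t, p) ∈ W} := h.isOpen.preimage (Continuous.prodMk_left p)
  have hinvertible :
      ∀ᶠ t in 𝓝 (0 : ℝ), (fderiv ℝ (fun q => Ψ (t, q)) p).IsInvertible := by
    refine ((h.contDiffOn_fderiv_space.continuousOn.continuousAt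
      (hopen.mem_nhds hp)).eventually (p := fun B => B.IsInvertible) ?_)
    simpa only [h.fderiv_space_zero hp] using! (ContinuousLinearEquiv.refl ℝ V).nhds
  obtain ⟨T, hT, hTopen, hT₀⟩ :=
    mem_nhds_iff.1 (Filter.inter_mem (hopen.mem_nhds hp) hinvertible)
  exact ⟨T, fun t ht => (hT ht).1,
    { isOpen := hTopen
      zero_mem := hT₀
      contDiffOn := h.contDiffOn_fderiv_space.mono fun t ht => (hT ht).1
      apply_zero := h.fderiv_space_zero hp
      hasDerivAt := fun t ht => h.hasDerivAt_fderiv_space (hT ht).1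
        (hS.differentiableAt (hO.mem_nhds (h.mapsTo (hT ht).1)))
      isInvertible := fun t ht => (hT ht).2 }⟩

end IsLocalFlow

lemma fderiv_sprayField {E : Type*} [NormedAddCommGroup E] [NormedSpace ℝ E] {f : E × E → E}
    {p : E × E} (hf : DifferentiableAt ℝ f p) :
    fderiv ℝ (sprayField f) p = companion (fderiv ℝ f p ∘L ContinuousLinearMap.inl ℝ E E)
      (fderiv ℝ f p ∘L ContinuousLinearMap.inr ℝ E E) := by
  have hfield : HasFDerivAt (sprayField f) _ p := hasFDerivAt_snd.prodMk hf.hasFDerivAt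
  rw [hfield.fderiv, companion, ContinuousLinearMap.coprod_comp_inl_inr]

end LocalFlow

section Charts

variable {E : Type*} [NormedAddCommGroup E] [NormedSpace ℝ E]
  {M : Type*} [TopologicalSpace M] [ChartedSpace E M] [IsManifold 𝓘(ℝ, E) ∞ M]

/-- The chart of `TM` around the fibre through `v` which is induced by the preferred chart of `M`
at `π(v)`. -/
abbrev tangentChart (v : TangentBundle 𝓘(ℝ, E) M) :
    PartialEquiv (TangentBundle 𝓘(ℝ, E) M) (E × E) :=
  extChartAt 𝓘(ℝ, E).tangent v

/-- The differential at `w` of the chart of `TM` at `v`. -/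
def chartDeriv (v w : TangentBundle 𝓘(ℝ, E) M) : E × E →L[ℝ] E × E :=
  mfderiv 𝓘(ℝ, E).tangent 𝓘(ℝ, E × E) (tangentChart v) w

/-- The differential at `p` of the inverse of the chart of `TM` at `v`. -/
def chartSymmDeriv (v : TangentBundle 𝓘(ℝ, E) M) (p : E × E) : E × E →L[ℝ] E × E :=
  mfderiv 𝓘(ℝ, E × E) 𝓘(ℝ, E).tangent (tangentChart v).symm p

/-- The differential at `x` of the preferred chart of `M` at `π(v)`, which is the restriction of
the chart of `TM` at `v` to the fibre over `x`. -/
def fibreDeriv (v : TangentBundle 𝓘(ℝ, E) M) (x : M) : E →L[ℝ] E :=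
  mfderiv 𝓘(ℝ, E) 𝓘(ℝ, E) (extChartAt 𝓘(ℝ, E) v.proj) x

variable {v w : TangentBundle 𝓘(ℝ, E) M} {p : E × E} {x : M}

lemma mem_tangentChart_source_iff : w ∈ (tangentChart v).source ↔
    w.proj ∈ (extChartAt 𝓘(ℝ, E) v.proj).source := by
  simp

lemma tangentChart_apply (hx : x ∈ (extChartAt 𝓘(ℝ, E) v.proj).source)
    (y : TangentSpace 𝓘(ℝ, E) x) :
    tangentChart v ⟨x, y⟩ = (extChartAt 𝓘(ℝ, E) v.proj x, fibreDeriv v x y) := by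
  have hx' : x ∈ (chartAt E v.proj).source := by simpa using hx
  have htrivialization : fibreDeriv v x =
      (trivializationAt E (TangentSpace 𝓘(ℝ, E)) v.proj).continuousLinearMapAt ℝ x :=
    (TangentBundle.continuousLinearMapAt_trivializationAt hx').symm
  rw [htrivialization]
  exact Prod.ext rfl (congrFun
    ((trivializationAt E (TangentSpace 𝓘(ℝ, E)) v.proj).coe_linearMapAt_of_mem (R := ℝ) hx') y).symm

lemma isInvertible_fibreDeriv (hx : x ∈ (extChartAt 𝓘(ℝ, E) v.proj).source) :
    (fibreDeriv v x).IsInvertible :=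
  isInvertible_mfderiv_extChartAt hx

lemma fibreDeriv_self : fibreDeriv v v.proj = ContinuousLinearMap.id ℝ E :=
  mfderiv_extChartAt_self (I := 𝓘(ℝ, E)) (x := v.proj)

lemma contMDiffAt_tangentChart (hw : w ∈ (tangentChart v).source) :
    ContMDiffAt 𝓘(ℝ, E).tangent 𝓘(ℝ, E × E) ∞ (tangentChart v) w :=
  contMDiffAt_extChartAt' (by simpa using hw)

lemma hasMFDerivAt_tangentChart (hw : w ∈ (tangentChart v).source) :
    HasMFDerivAt 𝓘(ℝ, E).tangent 𝓘(ℝ, E × E) (tangentChart v) w (chartDeriv v w) :=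
  ((contMDiffAt_tangentChart hw).mdifferentiableAt (by simp)).hasMFDerivAt

lemma contMDiffAt_tangentChart_symm (hp : p ∈ (tangentChart v).target) :
    ContMDiffAt 𝓘(ℝ, E × E) 𝓘(ℝ, E).tangent ∞ (tangentChart v).symm p :=
  (contMDiffOn_extChartAt_symm v).contMDiffAt (extChartAt_target_mem_nhds' hp)

lemma hasMFDerivAt_tangentChart_symm (hp : p ∈ (tangentChart v).target) :
    HasMFDerivAt 𝓘(ℝ, E × E) 𝓘(ℝ, E).tangent (tangentChart v).symm p (chartSymmDeriv v p) :=
  ((contMDiffAt_tangentChart_symm hp).mdifferentiableAt (by simp)).hasMFDerivAt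

lemma chartDeriv_self : chartDeriv v v = ContinuousLinearMap.id ℝ (E × E) :=
  mfderiv_extChartAt_self (I := 𝓘(ℝ, E).tangent) (x := v)

lemma chartDeriv_comp_chartSymmDeriv (hp : p ∈ (tangentChart v).target) :
    chartDeriv v ((tangentChart v).symm p) ∘L chartSymmDeriv v p =
      ContinuousLinearMap.id ℝ (E × E) := by
  have hcomp : HasFDerivAt (tangentChart v ∘ (tangentChart v).symm)
      (chartDeriv v ((tangentChart v).symm p) ∘L chartSymmDeriv v p) p :=
    ((hasMFDerivAt_tangentChart ((tangentChart v).map_target hp)).comp p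
      (hasMFDerivAt_tangentChart_symm hp)).hasFDerivAt
  refine (hcomp.congr_of_eventuallyEq (f₁ := id) ?_).unique (hasFDerivAt_id p)
  filter_upwards [extChartAt_target_mem_nhds' hp] with q hq
  exact ((tangentChart v).right_inv hq).symm

lemma isInvertible_chartDeriv (hw : w ∈ (tangentChart v).source) :
    (chartDeriv v w).IsInvertible :=
  isInvertible_mfderiv_extChartAt hw

lemma fibreDeriv_dproj (hw : w ∈ (tangentChart v).source)
    (X : TangentSpace 𝓘(ℝ, E).tangent w) :
    fibreDeriv v w.proj (dproj w X) = (chartDeriv v w X).1 := by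
  have hproj : HasMFDerivAt 𝓘(ℝ, E).tangent 𝓘(ℝ, E)
      (TotalSpace.proj : TangentBundle 𝓘(ℝ, E) M → M) w (dproj w) :=
    ((contMDiff_proj (n := 1) (TangentSpace 𝓘(ℝ, E) : M → Type _)).mdifferentiable
      (by simp) w).hasMFDerivAt
  have hbase : HasMFDerivAt 𝓘(ℝ, E) 𝓘(ℝ, E) (extChartAt 𝓘(ℝ, E) v.proj) w.proj
      (fibreDeriv v w.proj : E →L[ℝ] E) :=
    (mdifferentiableAt_extChartAt
      (by simpa using mem_tangentChart_source_iff.1 hw)).hasMFDerivAt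
  have hfst : HasMFDerivAt 𝓘(ℝ, E × E) 𝓘(ℝ, E) (Prod.fst : E × E → E) (tangentChart v w)
      (ContinuousLinearMap.fst ℝ E E) :=
    (ContinuousLinearMap.fst ℝ E E).hasFDerivAt.hasMFDerivAt
  exact congrArg (fun B : E × E →L[ℝ] E => B X)
    (hasMFDerivAt_unique (hbase.comp w hproj) (hfst.comp w (hasMFDerivAt_tangentChart hw)))

lemma mem_verticalSpace_iff (hw : w ∈ (tangentChart v).source)
    (X : TangentSpace 𝓘(ℝ, E).tangent w) :
    X ∈ verticalSpace w ↔ (chartDeriv v w X).1 = 0 := by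
  rw [← fibreDeriv_dproj hw]
  exact ((isInvertible_fibreDeriv (mem_tangentChart_source_iff.1 hw)).injective.eq_iff'
    (map_zero (fibreDeriv v w.proj))).symm

lemma fibreLine_eq_tangentChart_symm (hw : w ∈ (tangentChart v).source)
    (u : TangentSpace 𝓘(ℝ, E) w.proj) (t : ℝ) :
    (⟨w.proj, w.2 + t • u⟩ : TangentBundle 𝓘(ℝ, E) M) =
      (tangentChart v).symm (tangentChart v w + t • (0, fibreDeriv v w.proj u)) := by
  have hbase := mem_tangentChart_source_iff.1 hw
  have hlinear : fibreDeriv v w.proj (w.2 + t • u) =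
      fibreDeriv v w.proj w.2 + t • fibreDeriv v w.proj u :=
    ((fibreDeriv v w.proj).map_add w.2 (t • u)).trans
      (congrArg _ ((fibreDeriv v w.proj).map_smul t u))
  have hpoint : tangentChart v ⟨w.proj, w.2 + t • u⟩ =
      tangentChart v w + t • (0, fibreDeriv v w.proj u) := by
    rw [tangentChart_apply hbase, hlinear, ← TotalSpace.eta w, tangentChart_apply hbase]
    simp
  rw [← hpoint]
  exact ((tangentChart v).left_inv (x := ⟨w.proj, w.2 + t • u⟩)
    (mem_tangentChart_source_iff.2 hbase)).symm

lemma verticalLift_eq_chartSymmDeriv (hw : w ∈ (tangentChart v).source)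
    (u : TangentSpace 𝓘(ℝ, E) w.proj) :
    verticalLift w u = chartSymmDeriv v (tangentChart v w) (0, fibreDeriv v w.proj u) := by
  have hline : HasFDerivAt
      (fun t : ℝ => tangentChart v w + t • ((0 : E), fibreDeriv v w.proj u))
      (ContinuousLinearMap.toSpanSingleton ℝ ((0 : E), fibreDeriv v w.proj u)) 0 := by
    simpa using ((hasDerivAt_id (0 : ℝ)).smul_const
      ((0 : E), fibreDeriv v w.proj u)).hasFDerivAt.const_add (tangentChart v w)
  have hsymm : HasMFDerivAt 𝓘(ℝ, E × E) 𝓘(ℝ, E).tangent (tangentChart v).symm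
      (tangentChart v w + (0 : ℝ) • ((0 : E), fibreDeriv v w.proj u))
      (chartSymmDeriv v (tangentChart v w)) := by
    rw [zero_smul, add_zero]
    exact hasMFDerivAt_tangentChart_symm ((tangentChart v).map_source hw)
  have hcurve := ((hsymm.comp (0 : ℝ) hline.hasMFDerivAt).congr_of_eventuallyEq
    (Filter.Eventually.of_forall (fibreLine_eq_tangentChart_symm hw u))).mfderiv
  exact (congrArg (fun B : ℝ →L[ℝ] E × E => B 1) hcurve).trans
    (congrArg (chartSymmDeriv v (tangentChart v w)) (one_smul ℝ _))

lemma chartDeriv_verticalLift (hw : w ∈ (tangentChart v).source)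
    (u : TangentSpace 𝓘(ℝ, E) w.proj) :
    chartDeriv v w (verticalLift w u) = (0, fibreDeriv v w.proj u) := by
  have hinverse := chartDeriv_comp_chartSymmDeriv ((tangentChart v).map_source hw)
  rw [(tangentChart v).left_inv hw] at hinverse
  rw [verticalLift_eq_chartSymmDeriv hw]
  exact congrArg (fun B : E × E →L[ℝ] E × E => B (0, fibreDeriv v w.proj u)) hinverse

lemma chartDeriv_almostTangent (hw : w ∈ (tangentChart v).source)
    (X : TangentSpace 𝓘(ℝ, E).tangent w) :
    chartDeriv v w (almostTangent w X) = coordAlmostTangent E (chartDeriv v w X) := by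
  rw [almostTangent, chartDeriv_verticalLift hw, coordAlmostTangent_apply, fibreDeriv_dproj hw]

end Charts

section ExteriorDerivative

variable {E : Type*} [NormedAddCommGroup E] [NormedSpace ℝ E]
  {M : Type*} [TopologicalSpace M] [ChartedSpace E M] [IsManifold 𝓘(ℝ, E) ∞ M]

/-- The change of charts of `TM` from the chart at `w` to the chart at `v`. -/
def tangentTransition (v w : TangentBundle 𝓘(ℝ, E) M) : E × E → E × E :=
  tangentChart v ∘ (tangentChart w).symm

variable {α : ∀ w : TangentBundle 𝓘(ℝ, E) M, TangentSpace 𝓘(ℝ, E).tangent w →L[ℝ] ℝ}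
  {v w : TangentBundle 𝓘(ℝ, E) M} {q : E × E}

lemma contDiffAt_tangentTransition (hq : q ∈ (tangentChart w).target)
    (hv : (tangentChart w).symm q ∈ (tangentChart v).source) :
    ContDiffAt ℝ ∞ (tangentTransition v w) q :=
  ((contMDiffAt_tangentChart hv).comp q (contMDiffAt_tangentChart_symm hq)).contDiffAt

lemma fderiv_tangentTransition (hq : q ∈ (tangentChart w).target)
    (hv : (tangentChart w).symm q ∈ (tangentChart v).source) :
    fderiv ℝ (tangentTransition v w) q =
      chartDeriv v ((tangentChart w).symm q) ∘L chartSymmDeriv w q := by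
  have hcomp : HasFDerivAt (tangentTransition v w)
      (chartDeriv v ((tangentChart w).symm q) ∘L chartSymmDeriv w q) q :=
    ((hasMFDerivAt_tangentChart hv).comp q (hasMFDerivAt_tangentChart_symm hq)).hasFDerivAt
  exact hcomp.fderiv

lemma fderiv_tangentTransition_self (hw : w ∈ (tangentChart v).source) :
    fderiv ℝ (tangentTransition v w) (tangentChart w w) = chartDeriv v w := by
  have hw₀ : (tangentChart w).symm (tangentChart w w) = w :=
    (tangentChart w).left_inv (mem_extChartAt_source w)
  have hsymm := chartDeriv_comp_chartSymmDeriv (mem_extChartAt_target (I := 𝓘(ℝ, E).tangent) w)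
  rw [hw₀, chartDeriv_self, ContinuousLinearMap.id_comp] at hsymm
  rw [fderiv_tangentTransition (mem_extChartAt_target w) (by rwa [hw₀]), hsymm, hw₀,
    ContinuousLinearMap.comp_id]

lemma formInChart_comp_chartDeriv (hw : w ∈ (tangentChart v).source) :
    formInChart α v (tangentChart v w) ∘L chartDeriv v w = (show E × E →L[ℝ] ℝ from α w) := by
  have hleft := (tangentChart v).left_inv hw
  have hinverse : chartSymmDeriv v (tangentChart v w) ∘L chartDeriv v w =
      ContinuousLinearMap.id ℝ (E × E) := by
    have hcomp := chartDeriv_comp_chartSymmDeriv ((tangentChart v).map_source hw)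
    rw [hleft] at hcomp
    exact ContinuousLinearMap.ext fun X => (isInvertible_chartDeriv hw).injective
      (congrArg (· (chartDeriv v w X)) hcomp)
  have hform : formInChart α v (tangentChart v w) =
      (show E × E →L[ℝ] ℝ from α w) ∘L chartSymmDeriv v (tangentChart v w) :=
    congrArg (fun z => (show E × E →L[ℝ] ℝ from α z) ∘L chartSymmDeriv v (tangentChart v w)) hleft
  rw [hform, ContinuousLinearMap.comp_assoc, hinverse]
  exact ContinuousLinearMap.comp_id _

lemma formInChart_eq_pullback (hq : q ∈ (tangentChart w).target)
    (hv : (tangentChart w).symm q ∈ (tangentChart v).source) :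
    formInChart α w q =
      formInChart α v (tangentTransition v w q) ∘L fderiv ℝ (tangentTransition v w) q := by
  rw [fderiv_tangentTransition hq hv, ← ContinuousLinearMap.comp_assoc, tangentTransition,
    Function.comp_apply, formInChart_comp_chartDeriv hv]
  rfl

lemma extDerivForm_eq (hw : w ∈ (tangentChart v).source)
    (hα : DifferentiableAt ℝ (formInChart α v) (tangentChart v w))
    (X Y : TangentSpace 𝓘(ℝ, E).tangent w) :
    extDerivForm α w X Y =
      fderiv ℝ (formInChart α v) (tangentChart v w) (chartDeriv v w X) (chartDeriv v w Y)
        - fderiv ℝ (formInChart α v) (tangentChart v w) (chartDeriv v w Y) (chartDeriv v w X) := by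
  have htarget := mem_extChartAt_target (I := 𝓘(ℝ, E).tangent) w
  have hw₀ : (tangentChart w).symm (tangentChart w w) = w :=
    (tangentChart w).left_inv (mem_extChartAt_source w)
  have hsource : ∀ᶠ q in 𝓝 (tangentChart w w),
      (tangentChart w).symm q ∈ (tangentChart v).source :=
    (contMDiffAt_tangentChart_symm htarget).continuousAt
      (by rw [hw₀]; exact (isOpen_extChartAt_source v).mem_nhds hw)
  have hpullback : formInChart α w =ᶠ[𝓝 (tangentChart w w)] fun q =>
      formInChart α v (tangentTransition v w q) ∘L fderiv ℝ (tangentTransition v w) q := by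
    filter_upwards [extChartAt_target_mem_nhds w, hsource] with q using formInChart_eq_pullback
  have htransition : tangentTransition v w (tangentChart w w) = tangentChart v w :=
    congrArg (tangentChart v) hw₀
  have hself : extDerivForm α w X Y = fderiv ℝ (formInChart α w) (tangentChart w w)
      (chartDeriv w w X) (chartDeriv w w Y) - fderiv ℝ (formInChart α w) (tangentChart w w)
      (chartDeriv w w Y) (chartDeriv w w X) := rfl
  have hswap := fderiv_pullback_sub_swap
    (contDiffAt_tangentTransition htarget (by rwa [hw₀])) (by rwa [htransition]) X Y
  rw [fderiv_tangentTransition_self hw, htransition] at hswap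
  rw [hself, chartDeriv_self, hpullback.fderiv_eq]
  exact hswap

end ExteriorDerivative

section EnergyInChart

variable {E : Type*} [NormedAddCommGroup E] [NormedSpace ℝ E]
  {M : Type*} [TopologicalSpace M] [ChartedSpace E M] [IsManifold 𝓘(ℝ, E) ∞ M]

/-- The energy of `F` in the chart of `TM` at `v`. -/
def coordEnergy (F : TangentBundle 𝓘(ℝ, E) M → ℝ) (v : TangentBundle 𝓘(ℝ, E) M) (p : E × E) : ℝ :=
  energy F ((tangentChart v).symm p)

/-- The image of `TM \ 0` in the chart of `TM` at `v`. -/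
def chartDomain (v : TangentBundle 𝓘(ℝ, E) M) : Set (E × E) :=
  (tangentChart v).target ∩ {p | p.2 ≠ 0}

variable {F : TangentBundle 𝓘(ℝ, E) M → ℝ} {v w : TangentBundle 𝓘(ℝ, E) M} {p : E × E}

lemma coordEnergy_tangentChart (hw : w ∈ (tangentChart v).source) :
    coordEnergy F v (tangentChart v w) = energy F w := by
  rw [coordEnergy, (tangentChart v).left_inv hw]

lemma coordEnergy_tangentChart_mk (hw : w ∈ (tangentChart v).source)
    (y : TangentSpace 𝓘(ℝ, E) w.proj) :
    coordEnergy F v (tangentChart v ⟨w.proj, y⟩) = energy F ⟨w.proj, y⟩ :=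
  coordEnergy_tangentChart (w := ⟨w.proj, y⟩)
    (mem_tangentChart_source_iff.2 (mem_tangentChart_source_iff.1 hw))

lemma snd_tangentChart (hw : w ∈ (tangentChart v).source) :
    (tangentChart v w).2 = fibreDeriv v w.proj w.2 :=
  congrArg Prod.snd (tangentChart_apply (mem_tangentChart_source_iff.1 hw) w.2)

lemma snd_tangentChart_self : (tangentChart v v).2 = v.2 := by
  rw [snd_tangentChart (mem_extChartAt_source v), fibreDeriv_self]
  rfl

lemma tangentChart_mk (hw : w ∈ (tangentChart v).source) (y : TangentSpace 𝓘(ℝ, E) w.proj) :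
    tangentChart v ⟨w.proj, y⟩ = ((tangentChart v w).1, 0) +
      (ContinuousLinearMap.inr ℝ E E ∘L fibreDeriv v w.proj) y := by
  rw [tangentChart_apply (mem_tangentChart_source_iff.1 hw)]
  refine Prod.ext (add_zero _).symm (zero_add _).symm

lemma tangentChart_eq_add (hw : w ∈ (tangentChart v).source) :
    tangentChart v w = ((tangentChart v w).1, 0) +
      (ContinuousLinearMap.inr ℝ E E ∘L fibreDeriv v w.proj) w.2 :=
  tangentChart_mk hw w.2

lemma tangentChart_mem_chartDomain_iff (hw : w ∈ (tangentChart v).source) :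
    tangentChart v w ∈ chartDomain v ↔ w ∈ puncturedTangentBundle E M := by
  have hzero : (tangentChart v w).2 = 0 ↔ w.2 = 0 := by
    rw [snd_tangentChart hw]
    exact (isInvertible_fibreDeriv (mem_tangentChart_source_iff.1 hw)).injective.eq_iff'
      (map_zero (fibreDeriv v w.proj))
  exact ⟨fun h => mt hzero.2 h.2, fun h => ⟨(tangentChart v).map_source hw, mt hzero.1 h⟩⟩

lemma tangentChart_symm_mem_punctured (hp : p ∈ chartDomain v) :
    (tangentChart v).symm p ∈ puncturedTangentBundle E M := by
  rwa [← tangentChart_mem_chartDomain_iff ((tangentChart v).map_target hp.1),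
    (tangentChart v).right_inv hp.1]

lemma isOpen_chartDomain : IsOpen (chartDomain v) :=
  (isOpen_extChartAt_target v).inter (isOpen_ne.preimage continuous_snd)

lemma contDiffOn_coordEnergy (hF : IsFinslerMetric F) :
    ContDiffOn ℝ ∞ (coordEnergy F v) (chartDomain v) := by
  have hF' : ContMDiffOn 𝓘(ℝ, E × E) 𝓘(ℝ, ℝ) ∞ (F ∘ (tangentChart v).symm) (chartDomain v) :=
    hF.smooth.comp ((contMDiffOn_extChartAt_symm v).mono inter_subset_left)
      fun p hp => tangentChart_symm_mem_punctured hp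
  exact contDiffOn_const.mul (hF'.contDiffOn.pow 2)

lemma energy_fibre_eq (hw : w ∈ (tangentChart v).source) :
    (fun y : E => energy F ⟨w.proj, y⟩) = fun y : E =>
      coordEnergy F v (((tangentChart v w).1, 0) +
        (ContinuousLinearMap.inr ℝ E E ∘L fibreDeriv v w.proj) y) :=
  funext fun y =>
    (coordEnergy_tangentChart_mk hw y).symm.trans
      (congrArg (coordEnergy F v) (tangentChart_mk hw y))

section FibreDerivatives

variable (hF : IsFinslerMetric F) (hw : w ∈ (tangentChart v).source)
  (hw₀ : w ∈ puncturedTangentBundle E M)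
include hF hw hw₀

lemma contDiffAt_coordEnergy : ContDiffAt ℝ ∞ (coordEnergy F v) (tangentChart v w) :=
  (contDiffOn_coordEnergy hF).contDiffAt
    (isOpen_chartDomain.mem_nhds ((tangentChart_mem_chartDomain_iff hw).2 hw₀))

lemma legendre_apply (u : TangentSpace 𝓘(ℝ, E) w.proj) :
    legendre F w u =
      fderiv ℝ (coordEnergy F v) (tangentChart v w) (0, fibreDeriv v w.proj u) := by
  have hsmooth := contDiffAt_coordEnergy hF hw hw₀
  rw [tangentChart_eq_add hw] at hsmooth
  have hderiv : legendre F w = fderiv ℝ (coordEnergy F v) _ ∘L _ :=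
    (congrArg (fderiv ℝ · (show E from w.2)) (energy_fibre_eq hw)).trans
      (fderiv_comp_const_add (hsmooth.differentiableAt (by simp)))
  rw [← tangentChart_eq_add hw] at hderiv
  exact congrArg (fun B : E →L[ℝ] ℝ => B u) hderiv

lemma fundamentalTensor_apply (u₁ u₂ : TangentSpace 𝓘(ℝ, E) w.proj) :
    fundamentalTensor F w u₁ u₂ = coordMetric (coordEnergy F v) (tangentChart v w)
      (fibreDeriv v w.proj u₁) (fibreDeriv v w.proj u₂) := by
  have hsmooth := contDiffAt_coordEnergy hF hw hw₀
  rw [tangentChart_eq_add hw] at hsmooth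
  have hderiv : fundamentalTensor F w u₁ u₂ = fderiv ℝ (fderiv ℝ (coordEnergy F v)) _ _ _ :=
    (congrArg (fun g : E → ℝ => fderiv ℝ (fderiv ℝ g) w.2 u₁ u₂) (energy_fibre_eq hw)).trans
      (fderiv_fderiv_comp_const_add hsmooth u₁ u₂)
  rwa [← tangentChart_eq_add hw] at hderiv

end FibreDerivatives

lemma tangentChart_smul (hw : w ∈ (tangentChart v).source) (c : ℝ) :
    tangentChart v ⟨w.proj, c • w.2⟩ = ((tangentChart v w).1, c • (tangentChart v w).2) := by
  rw [tangentChart_apply (mem_tangentChart_source_iff.1 hw), snd_tangentChart hw]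
  exact Prod.ext rfl ((fibreDeriv v w.proj).map_smul c w.2)

lemma isCoordEnergy (hF : IsFinslerMetric F) : IsCoordEnergy (chartDomain v) (coordEnergy F v) where
  isOpen := isOpen_chartDomain
  contDiffOn := contDiffOn_coordEnergy hF
  smul_mem p hp c hc := by
    refine ⟨?_, smul_ne_zero hc.ne' hp.2⟩
    have hsource := (tangentChart v).map_target hp.1
    have hscaled := tangentChart_smul hsource c
    rw [(tangentChart v).right_inv hp.1] at hscaled
    rw [← hscaled]
    exact (tangentChart v).map_source
      (mem_tangentChart_source_iff.2 (mem_tangentChart_source_iff.1 hsource))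
  homogeneous p hp c hc := by
    have hsource := (tangentChart v).map_target hp.1
    have hscaled := tangentChart_smul hsource c
    rw [(tangentChart v).right_inv hp.1] at hscaled
    rw [← hscaled, coordEnergy_tangentChart_mk hsource, energy,
      hF.homogeneous _ _ _ hc.le, coordEnergy, energy, smul_eq_mul]
    ring
  posDef p hp u hu := by
    have hsource := (tangentChart v).map_target hp.1
    obtain ⟨u, rfl⟩ :=
      (isInvertible_fibreDeriv (mem_tangentChart_source_iff.1 hsource)).surjective u
    have hpos := hF.posDef _ (tangentChart_symm_mem_punctured hp) u
      (by rintro rfl; exact hu (map_zero _))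
    have hmetric := fundamentalTensor_apply hF hsource (tangentChart_symm_mem_punctured hp) u u
    rw [(tangentChart v).right_inv hp.1, coordMetric_apply] at hmetric
    exact hpos.trans_eq hmetric

lemma formInChart_alphaForm (hF : IsFinslerMetric F) (hp : p ∈ chartDomain v) :
    formInChart (alphaForm F) v p = fderiv ℝ (coordEnergy F v) p ∘L coordAlmostTangent E := by
  have hsource := (tangentChart v).map_target hp.1
  refine ContinuousLinearMap.ext fun X => ?_
  have hform : formInChart (alphaForm F) v p X =
      legendre F ((tangentChart v).symm p) (dproj _ (chartSymmDeriv v p X)) := rfl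
  have hX : chartDeriv v ((tangentChart v).symm p) (chartSymmDeriv v p X) = X :=
    congrArg (fun B : E × E →L[ℝ] E × E => B X) (chartDeriv_comp_chartSymmDeriv hp.1)
  rw [hform, legendre_apply hF hsource (tangentChart_symm_mem_punctured hp),
    (tangentChart v).right_inv hp.1]
  exact congrArg (fun y : E => fderiv ℝ (coordEnergy F v) p (0, y))
    ((fibreDeriv_dproj hsource _).trans (congrArg Prod.fst hX))

section GeodesicSpray

variable (hF : IsFinslerMetric F) (hw : w ∈ (tangentChart v).source)
  (hw₀ : w ∈ puncturedTangentBundle E M)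
include hF hw hw₀

lemma omegaForm_eq (X Y : TangentSpace 𝓘(ℝ, E).tangent w) :
    omegaForm F w X Y = coordOmega (coordEnergy F v) (tangentChart v w)
      (chartDeriv v w X) (chartDeriv v w Y) := by
  have hform : formInChart (alphaForm F) v =ᶠ[𝓝 (tangentChart v w)] fun p =>
      fderiv ℝ (coordEnergy F v) p ∘L coordAlmostTangent E :=
    (isOpen_chartDomain.eventually_mem ((tangentChart_mem_chartDomain_iff hw).2 hw₀)).mono
      fun p hp => formInChart_alphaForm hF hp
  have hderiv : HasFDerivAt (formInChart (alphaForm F) v) _ (tangentChart v w) :=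
    ((hasFDerivAt_fderiv (contDiffAt_coordEnergy hF hw hw₀)).clm_comp
      (hasFDerivAt_const (coordAlmostTangent E) _)).congr_of_eventuallyEq hform
  rw [omegaForm, extDerivForm_eq hw hderiv.differentiableAt, hderiv.fderiv, coordOmega]
  simp

lemma mfderiv_energy (Y : TangentSpace 𝓘(ℝ, E).tangent w) :
    mfderiv 𝓘(ℝ, E).tangent 𝓘(ℝ, ℝ) (energy F) w Y =
      fderiv ℝ (coordEnergy F v) (tangentChart v w) (chartDeriv v w Y) := by
  have henergy : HasMFDerivAt 𝓘(ℝ, E).tangent 𝓘(ℝ, ℝ) (energy F) w _ :=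
    ((hasFDerivAt_of_contDiffAt (contDiffAt_coordEnergy hF hw hw₀)).hasMFDerivAt.comp w
      (hasMFDerivAt_tangentChart hw)).congr_of_eventuallyEq
      (((isOpen_extChartAt_source v).eventually_mem hw).mono fun q hq =>
        (coordEnergy_tangentChart hq).symm)
  rw [henergy.mfderiv]
  rfl

lemma chartDeriv_geodesicSpray [FiniteDimensional ℝ E] :
    chartDeriv v w (geodesicSpray F w) =
      sprayField (coordForce (coordEnergy F v)) (tangentChart v w) := by
  have hsurjective := (isInvertible_chartDeriv hw).surjective
  have hiff : ∀ X : TangentSpace 𝓘(ℝ, E).tangent w, (∀ Y : TangentSpace 𝓘(ℝ, E).tangent w,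
      omegaForm F w X Y = mfderiv 𝓘(ℝ, E).tangent 𝓘(ℝ, ℝ) (energy F) w Y) ↔
      chartDeriv v w X = sprayField (coordForce (coordEnergy F v)) (tangentChart v w) := by
    intro X
    rw [← (isCoordEnergy hF).coordOmega_eq_iff ((tangentChart_mem_chartDomain_iff hw).2 hw₀),
      hsurjective.forall]
    exact forall_congr' fun Y => by rw [omegaForm_eq hF hw hw₀, mfderiv_energy hF hw hw₀]
  exact (hiff _).1 (Classical.epsilon_spec
    ((hsurjective (sprayField (coordForce (coordEnergy F v)) (tangentChart v w))).imp
      fun X hX => (hiff X).2 hX))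

end GeodesicSpray

end EnergyInChart

section VectorFields

variable {E : Type*} [NormedAddCommGroup E] [NormedSpace ℝ E]
  {M : Type*} [TopologicalSpace M] [ChartedSpace E M] [IsManifold 𝓘(ℝ, E) ∞ M]

/-- The expression in the chart of `TM` at `v` of a vector field on `TM`. -/
def readField (v : TangentBundle 𝓘(ℝ, E) M)
    (V : ∀ w : TangentBundle 𝓘(ℝ, E) M, TangentSpace 𝓘(ℝ, E).tangent w) (p : E × E) : E × E :=
  chartDeriv v ((tangentChart v).symm p) (V ((tangentChart v).symm p))

variable {v w : TangentBundle 𝓘(ℝ, E) M} {p : E × E}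
  {V W : ∀ w : TangentBundle 𝓘(ℝ, E) M, TangentSpace 𝓘(ℝ, E).tangent w}

lemma readField_tangentChart (hw : w ∈ (tangentChart v).source) :
    readField v V (tangentChart v w) = chartDeriv v w (V w) := by
  rw [readField, (tangentChart v).left_inv hw]

lemma mdifferentiableAt_iff_comp_tangentChart_symm {G : Type*} [NormedAddCommGroup G]
    [NormedSpace ℝ G] {g : TangentBundle 𝓘(ℝ, E) M → G} (hw : w ∈ (tangentChart v).source) :
    MDifferentiableAt 𝓘(ℝ, E).tangent 𝓘(ℝ, G) g w ↔
      DifferentiableAt ℝ (g ∘ (tangentChart v).symm) (tangentChart v w) := by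
  rw [mdifferentiableAt_iff_source_of_mem_source (x := v) (by simpa using hw)]
  have hrange : range 𝓘(ℝ, E).tangent = univ := ModelWithCorners.range_eq_univ _
  rw [hrange]
  exact mdifferentiableWithinAt_univ.trans mdifferentiableAt_iff_differentiableAt

lemma trivializationAt_snd_eq_chartDeriv (hw : w ∈ (tangentChart v).source)
    (X : TangentSpace 𝓘(ℝ, E).tangent w) :
    (trivializationAt (E × E) (TangentSpace 𝓘(ℝ, E).tangent :
      TangentBundle 𝓘(ℝ, E) M → Type _) v ⟨w, X⟩).2 = chartDeriv v w X := by
  have hw' : w ∈ (chartAt (ModelProd E E) v).source := by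
    rwa [extChartAt_source] at hw
  have hderiv : chartDeriv v w = (trivializationAt (E × E) (TangentSpace 𝓘(ℝ, E).tangent :
      TangentBundle 𝓘(ℝ, E) M → Type _) v).continuousLinearMapAt ℝ w :=
    (TangentBundle.continuousLinearMapAt_trivializationAt hw').symm
  rw [hderiv]
  exact (congrFun ((trivializationAt (E × E) (TangentSpace 𝓘(ℝ, E).tangent :
      TangentBundle 𝓘(ℝ, E) M → Type _) v).coe_linearMapAt_of_mem (R := ℝ) hw') X).symm

lemma mdifferentiableAt_field_iff (hw : w ∈ (tangentChart v).source) :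
    MDifferentiableAt 𝓘(ℝ, E).tangent 𝓘(ℝ, E).tangent.tangent
      (fun w => (⟨w, V w⟩ : TangentBundle 𝓘(ℝ, E).tangent (TangentBundle 𝓘(ℝ, E) M))) w ↔
      DifferentiableAt ℝ (readField v V) (tangentChart v w) := by
  have hw' : w ∈ (chartAt (ModelProd E E) v).source := by
    rwa [extChartAt_source] at hw
  rw [(trivializationAt (E × E) (TangentSpace 𝓘(ℝ, E).tangent :
      TangentBundle 𝓘(ℝ, E) M → Type _) v).mdifferentiableAt_section_iff 𝓘(ℝ, E).tangent V hw',
    mdifferentiableAt_iff_comp_tangentChart_symm hw]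
  refine Filter.EventuallyEq.differentiableAt_iff ?_
  filter_upwards [extChartAt_target_mem_nhds' ((tangentChart v).map_source hw)] with q hq
  exact trivializationAt_snd_eq_chartDeriv ((tangentChart v).map_target hq) _

lemma chartSymmDeriv_inverse (hp : p ∈ (tangentChart v).target) :
    (chartSymmDeriv v p).inverse = chartDeriv v ((tangentChart v).symm p) := by
  obtain ⟨e, he⟩ := isInvertible_chartDeriv ((tangentChart v).map_target hp)
  have hcomp := chartDeriv_comp_chartSymmDeriv hp
  have hsymm : chartSymmDeriv v p = e.symm := by
    refine ContinuousLinearMap.ext fun X => e.injective ?_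
    rw [← he] at hcomp
    simpa using congrArg (fun B : E × E →L[ℝ] E × E => B X) hcomp
  rw [hsymm, ContinuousLinearMap.inverse_equiv, ← he]
  simp

lemma mpullback_tangentChart_symm (V : ∀ w : TangentBundle 𝓘(ℝ, E) M,
    TangentSpace 𝓘(ℝ, E).tangent w) (hp : p ∈ (tangentChart v).target) :
    VectorField.mpullback 𝓘(ℝ, E × E) 𝓘(ℝ, E).tangent (tangentChart v).symm V p =
      readField v V p :=
  congrArg (fun B : E × E →L[ℝ] E × E => B (V _)) (chartSymmDeriv_inverse hp)

lemma chartDeriv_mlieBracket [CompleteSpace E] (hw : w ∈ (tangentChart v).source)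
    (hV : DifferentiableAt ℝ (readField v V) (tangentChart v w))
    (hW : DifferentiableAt ℝ (readField v W) (tangentChart v w)) :
    chartDeriv v w (VectorField.mlieBracket 𝓘(ℝ, E).tangent V W w) =
      VectorField.lieBracket ℝ (readField v V) (readField v W) (tangentChart v w) := by
  have hp := (tangentChart v).map_source hw
  rw [← mdifferentiableAt_field_iff hw, ← (tangentChart v).left_inv hw] at hV hW
  have : IsManifold 𝓘(ℝ, E).tangent (minSmoothness ℝ 2) (TangentBundle 𝓘(ℝ, E) M) :=
    IsManifold.of_le (n := ∞) minSmoothness_two_le_infty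
  have hpullback := VectorField.mpullback_mlieBracket (n := ∞) (I := 𝓘(ℝ, E × E)) hV hW
    (contMDiffAt_tangentChart_symm hp) minSmoothness_two_le_infty
  have hread : ∀ U : ∀ w : TangentBundle 𝓘(ℝ, E) M, TangentSpace 𝓘(ℝ, E).tangent w,
      VectorField.mpullback 𝓘(ℝ, E × E) 𝓘(ℝ, E).tangent (tangentChart v).symm U
        =ᶠ[𝓝 (tangentChart v w)] readField v U := fun U => by
    filter_upwards [extChartAt_target_mem_nhds' hp] with q hq
    exact mpullback_tangentChart_symm U hq
  rw [← readField_tangentChart (V := VectorField.mlieBracket 𝓘(ℝ, E).tangent V W) hw]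
  refine ((mpullback_tangentChart_symm _ hp).symm.trans hpullback).trans ?_
  rw [← VectorField.mlieBracketWithin_univ, VectorField.mlieBracketWithin_eq_lieBracketWithin]
  exact (congrFun (VectorField.lieBracketWithin_univ (E := E × E)) _).trans
    ((hread V).lieBracket_vectorField_eq (hread W))

lemma differentiableAt_readField_extend (hw : w ∈ (tangentChart v).source)
    (X : TangentSpace 𝓘(ℝ, E).tangent w) :
    DifferentiableAt ℝ (readField v (FiberBundle.extend (E × E) X)) (tangentChart v w) :=
  (mdifferentiableAt_field_iff hw).1
    (FiberBundle.mdifferentiableAt_extend 𝓘(ℝ, E).tangent (E × E) X)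

lemma readField_extend (X : TangentSpace 𝓘(ℝ, E).tangent v) (hp : p ∈ (tangentChart v).target) :
    readField v (FiberBundle.extend (E × E) X) p = X := by
  have hsource := (tangentChart v).map_target hp
  have hsource' : (tangentChart v).symm p ∈ (chartAt (ModelProd E E) v).source := by
    rwa [extChartAt_source] at hsource
  rw [readField, ← trivializationAt_snd_eq_chartDeriv hsource]
  refine (congrArg Prod.snd ((trivializationAt (E × E) (TangentSpace 𝓘(ℝ, E).tangent :
    TangentBundle 𝓘(ℝ, E) M → Type _) v).apply_mk_symm hsource'
      ((trivializationAt (E × E) (TangentSpace 𝓘(ℝ, E).tangent :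
        TangentBundle 𝓘(ℝ, E) M → Type _) v ⟨v, X⟩).2))).trans ?_
  rw [trivializationAt_snd_eq_chartDeriv (mem_extChartAt_source v), chartDeriv_self]
  rfl

end VectorFields

section CanonicalConnection

variable {E : Type*} [NormedAddCommGroup E] [NormedSpace ℝ E]
  {M : Type*} [TopologicalSpace M] [ChartedSpace E M] [IsManifold 𝓘(ℝ, E) ∞ M]
  {v w : TangentBundle 𝓘(ℝ, E) M} {p : E × E} {f : E × E → E}
  {S : ∀ w : TangentBundle 𝓘(ℝ, E) M, TangentSpace 𝓘(ℝ, E).tangent w}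

lemma lieBracket_sprayField_coordAlmostTangent_sub {Z : E × E → E × E}
    (hf : DifferentiableAt ℝ f p) (hZ : DifferentiableAt ℝ Z p) :
    VectorField.lieBracket ℝ (sprayField f) (fun q => coordAlmostTangent E (Z q)) p
        - coordAlmostTangent E (VectorField.lieBracket ℝ (sprayField f) Z p) =
      -coordReflection (fderiv ℝ f p ∘L ContinuousLinearMap.inr ℝ E E) (Z p) := by
  have hJZ : fderiv ℝ (fun q => coordAlmostTangent E (Z q)) p =
      coordAlmostTangent E ∘L fderiv ℝ Z p :=
    ((coordAlmostTangent E).hasFDerivAt.comp p hZ.hasFDerivAt).fderiv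
  rw [VectorField.lieBracket, VectorField.lieBracket, hJZ, fderiv_sprayField hf]
  have hzero : fderiv ℝ f p (0, 0) = 0 := map_zero _
  simp [hzero]

lemma chartDeriv_canonicalConnection [CompleteSpace E] (hw : w ∈ (tangentChart v).source)
    (hS : readField v S =ᶠ[𝓝 (tangentChart v w)] sprayField f)
    (hf : DifferentiableAt ℝ f (tangentChart v w)) (X : TangentSpace 𝓘(ℝ, E).tangent w) :
    chartDeriv v w (canonicalConnection S w X) =
      coordReflection (fderiv ℝ f (tangentChart v w) ∘L ContinuousLinearMap.inr ℝ E E)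
        (chartDeriv v w X) := by
  let Z : ∀ w : TangentBundle 𝓘(ℝ, E) M, TangentSpace 𝓘(ℝ, E).tangent w :=
    FiberBundle.extend (E × E) X
  have hZ : DifferentiableAt ℝ (readField v Z) (tangentChart v w) :=
    differentiableAt_readField_extend hw X
  have hZw : readField v Z (tangentChart v w) = chartDeriv v w X :=
    (readField_tangentChart hw).trans
      (congrArg (chartDeriv v w) (FiberBundle.extend_apply_self (E × E) X))
  have hSd : DifferentiableAt ℝ (readField v S) (tangentChart v w) :=
    hS.differentiableAt_iff.2 (differentiableAt_snd.prodMk hf)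
  have hJZ : readField v (fun w' => almostTangent w' (Z w')) =ᶠ[𝓝 (tangentChart v w)]
      fun q => coordAlmostTangent E (readField v Z q) := by
    filter_upwards [extChartAt_target_mem_nhds' ((tangentChart v).map_source hw)] with q hq
    exact chartDeriv_almostTangent ((tangentChart v).map_target hq) _
  have hJZd := hJZ.differentiableAt_iff.2 ((coordAlmostTangent E).differentiableAt.comp _ hZ)
  have hbracketJ := (chartDeriv_mlieBracket hw hSd hJZd).trans
    (hS.lieBracket_vectorField_eq hJZ)
  have hbracket := (chartDeriv_almostTangent hw _).trans (congrArg (coordAlmostTangent E)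
    ((chartDeriv_mlieBracket hw hSd hZ).trans (hS.lieBracket_vectorField_eq (.refl _ _))))
  have hlie : chartDeriv v w (lieAlmostTangent S w X) =
      -coordReflection (fderiv ℝ f (tangentChart v w) ∘L ContinuousLinearMap.inr ℝ E E)
        (chartDeriv v w X) :=
    (((chartDeriv v w).map_sub _ _).trans (congrArg₂ (· - ·) hbracketJ hbracket)).trans
      ((lieBracket_sprayField_coordAlmostTangent_sub hf hZ).trans (by rw [hZw]))
  exact ((chartDeriv v w).map_neg _).trans (neg_eq_iff_eq_neg.2 hlie)

lemma chartDeriv_verticalProjection [CompleteSpace E] (hw : w ∈ (tangentChart v).source)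
    (hS : readField v S =ᶠ[𝓝 (tangentChart v w)] sprayField f)
    (hf : DifferentiableAt ℝ f (tangentChart v w)) (X : TangentSpace 𝓘(ℝ, E).tangent w) :
    chartDeriv v w (verticalProjection S w X) = (0, (chartDeriv v w X).2 -
      (1 / 2 : ℝ) • fderiv ℝ f (tangentChart v w) (0, (chartDeriv v w X).1)) := by
  have hlinear : chartDeriv v w (verticalProjection S w X) =
      (1 / 2 : ℝ) • (chartDeriv v w X - chartDeriv v w (canonicalConnection S w X)) :=
    ((chartDeriv v w).map_smul (1 / 2 : ℝ) _).trans
      (congrArg ((1 / 2 : ℝ) • ·) ((chartDeriv v w).map_sub _ _))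
  rw [hlinear, chartDeriv_canonicalConnection hw hS hf]
  refine Prod.ext ?_ ?_
  · simp
  · simp only [coordReflection_apply, Prod.smul_snd, Prod.snd_sub,
      ContinuousLinearMap.comp_apply, ContinuousLinearMap.inr_apply]
    module

lemma coordReflection_eq_self_iff (Q : E →L[ℝ] E) (X : E × E) :
    coordReflection Q X = X ↔ X.2 = (1 / 2 : ℝ) • Q X.1 := by
  rw [coordReflection_apply, Prod.ext_iff, and_iff_right rfl, sub_eq_iff_eq_add, ← two_smul ℝ X.2]
  constructor
  · intro h
    rw [h, smul_smul]
    norm_num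
  · intro h
    rw [h, smul_smul]
    norm_num

lemma horizontalLift_eq_sprayHorizontal [CompleteSpace E]
    (hS : readField v S =ᶠ[𝓝 (tangentChart v v)] sprayField f)
    (hf : DifferentiableAt ℝ f (tangentChart v v)) (u : E) :
    horizontalLift S v u = sprayHorizontal f (tangentChart v v) u := by
  have hreflection : ∀ X : E × E, canonicalConnection S v X =
      coordReflection (fderiv ℝ f (tangentChart v v) ∘L ContinuousLinearMap.inr ℝ E E) X := by
    intro X
    have h := chartDeriv_canonicalConnection (mem_extChartAt_source v) hS hf X
    rwa [chartDeriv_self] at h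
  have hproj : ∀ X : E × E, dproj v X = X.1 := by
    intro X
    have h := fibreDeriv_dproj (mem_extChartAt_source v) X
    rwa [chartDeriv_self, fibreDeriv_self] at h
  have hiff : ∀ X : E × E, (canonicalConnection S v X = X ∧ dproj v X = u) ↔
      X = sprayHorizontal f (tangentChart v v) u := by
    intro X
    rw [hreflection, hproj]
    refine (and_congr_left' (coordReflection_eq_self_iff _ X)).trans ?_
    rw [sprayHorizontal, Prod.ext_iff]
    constructor
    · rintro ⟨hvertical, rfl⟩
      exact ⟨rfl, hvertical⟩
    · rintro ⟨rfl, hvertical⟩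
      exact ⟨hvertical, rfl⟩
  have hexists : ∃ X : E × E, canonicalConnection S v X = X ∧ dproj v X = u :=
    ⟨_, (hiff _).2 rfl⟩
  exact (hiff _).1 (Classical.epsilon_spec hexists)

lemma readField_geodesicSpray_eventuallyEq [FiniteDimensional ℝ E]
    {F : TangentBundle 𝓘(ℝ, E) M → ℝ} (hF : IsFinslerMetric F) (hp : p ∈ chartDomain v) :
    readField v (geodesicSpray F) =ᶠ[𝓝 p] sprayField (coordForce (coordEnergy F v)) := by
  filter_upwards [isOpen_chartDomain.mem_nhds hp] with q hq
  rw [readField, chartDeriv_geodesicSpray hF ((tangentChart v).map_target hq.1)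
    (tangentChart_symm_mem_punctured hq), (tangentChart v).right_inv hq.1]

end CanonicalConnection

section VerticalSections

variable {E : Type*} [NormedAddCommGroup E] [NormedSpace ℝ E]
  {M : Type*} [TopologicalSpace M] [ChartedSpace E M] [IsManifold 𝓘(ℝ, E) ∞ M]

instance : ContMDiffVectorBundle ∞ E (VerticalBundle E M) 𝓘(ℝ, E).tangent :=
  let proj : ContMDiffMap 𝓘(ℝ, E).tangent 𝓘(ℝ, E) (TangentBundle 𝓘(ℝ, E) M) M ∞ :=
    ⟨TotalSpace.proj, contMDiff_proj _⟩
  ContMDiffVectorBundle.pullback E (TangentSpace 𝓘(ℝ, E) : M → Type _) 𝓘(ℝ, E).tangent proj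

instance : ContMDiffVectorBundle 1 E (VerticalBundle E M) 𝓘(ℝ, E).tangent :=
  let proj : ContMDiffMap 𝓘(ℝ, E).tangent 𝓘(ℝ, E) (TangentBundle 𝓘(ℝ, E) M) M 1 :=
    ⟨TotalSpace.proj, contMDiff_proj _⟩
  ContMDiffVectorBundle.pullback E (TangentSpace 𝓘(ℝ, E) : M → Type _) 𝓘(ℝ, E).tangent proj

/-- The expression in the chart of `TM` at `v` of a section of the vertical bundle. -/
def readSection (v : TangentBundle 𝓘(ℝ, E) M)
    (σ : ∀ w : TangentBundle 𝓘(ℝ, E) M, VerticalBundle E M w) (p : E × E) : E :=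
  fibreDeriv v ((tangentChart v).symm p).proj (σ ((tangentChart v).symm p))

variable {v w : TangentBundle 𝓘(ℝ, E) M} {p : E × E}
  {σ : ∀ w : TangentBundle 𝓘(ℝ, E) M, VerticalBundle E M w}

lemma readSection_tangentChart (hw : w ∈ (tangentChart v).source) :
    readSection v σ (tangentChart v w) = fibreDeriv v w.proj (σ w) := by
  rw [readSection, (tangentChart v).left_inv hw]

lemma mem_verticalBundle_baseSet (hw : w ∈ (tangentChart v).source) :
    w ∈ (trivializationAt E (VerticalBundle E M) v).baseSet := by
  have hw' : w.proj ∈ (chartAt E v.proj).source := by simpa using hw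
  exact hw'

lemma trivializationAt_snd_eq_fibreDeriv (hw : w ∈ (tangentChart v).source)
    (z : VerticalBundle E M w) :
    (trivializationAt E (VerticalBundle E M) v ⟨w, z⟩).2 = fibreDeriv v w.proj z :=
  (congrArg Prod.snd (tangentChart_apply (mem_tangentChart_source_iff.1 hw) z) :)

lemma mdifferentiableAt_verticalSection_iff (hw : w ∈ (tangentChart v).source) :
    MDifferentiableAt 𝓘(ℝ, E).tangent (𝓘(ℝ, E).tangent.prod 𝓘(ℝ, E))
      (fun w => (⟨w, σ w⟩ : TotalSpace E (VerticalBundle E M))) w ↔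
      DifferentiableAt ℝ (readSection v σ) (tangentChart v w) := by
  rw [(trivializationAt E (VerticalBundle E M) v).mdifferentiableAt_section_iff 𝓘(ℝ, E).tangent σ
    (mem_verticalBundle_baseSet hw), mdifferentiableAt_iff_comp_tangentChart_symm hw]
  refine Filter.EventuallyEq.differentiableAt_iff ?_
  filter_upwards [extChartAt_target_mem_nhds' ((tangentChart v).map_source hw)] with q hq
  exact trivializationAt_snd_eq_fibreDeriv ((tangentChart v).map_target hq) _

lemma readSection_extend (z : VerticalBundle E M v) (hp : p ∈ (tangentChart v).target) :
    readSection v (FiberBundle.extend E z) p = z := by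
  have hsource := (tangentChart v).map_target hp
  rw [readSection, ← trivializationAt_snd_eq_fibreDeriv hsource]
  refine (congrArg Prod.snd ((trivializationAt E (VerticalBundle E M) v).apply_mk_symm
    (mem_verticalBundle_baseSet hsource)
    ((trivializationAt E (VerticalBundle E M) v ⟨v, z⟩).2))).trans ?_
  rw [trivializationAt_snd_eq_fibreDeriv (mem_extChartAt_source v), fibreDeriv_self]
  rfl

lemma hasFDerivAt_readSection_extend (z : VerticalBundle E M v)
    (hp : p ∈ (tangentChart v).target) :
    HasFDerivAt (readSection v (FiberBundle.extend E z)) (0 : E × E →L[ℝ] E) p := by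
  refine (hasFDerivAt_const (z : E) p).congr_of_eventuallyEq ?_
  filter_upwards [extChartAt_target_mem_nhds' hp] with q hq
  exact readSection_extend z hq

lemma hasFDerivAt_readSection_canonicalField (hp : p ∈ (tangentChart v).target) :
    HasFDerivAt (readSection v canonicalField) (ContinuousLinearMap.snd ℝ E E) p := by
  refine (ContinuousLinearMap.snd ℝ E E).hasFDerivAt.congr_of_eventuallyEq ?_
  filter_upwards [extChartAt_target_mem_nhds' hp] with q hq
  have hsnd := snd_tangentChart ((tangentChart v).map_target hq)
  rw [(tangentChart v).right_inv hq] at hsnd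
  exact hsnd.symm

lemma mvfderiv_eq_fderiv_comp_tangentChart_symm {G : Type*} [NormedAddCommGroup G]
    [NormedSpace ℝ G] {g : TangentBundle 𝓘(ℝ, E) M → G} (hw : w ∈ (tangentChart v).source)
    (hg : MDifferentiableAt 𝓘(ℝ, E).tangent 𝓘(ℝ, G) g w) (X : TangentSpace 𝓘(ℝ, E).tangent w) :
    mvfderiv 𝓘(ℝ, E).tangent g w X =
      fderiv ℝ (g ∘ (tangentChart v).symm) (tangentChart v w) (chartDeriv v w X) := by
  have hcomp := ((mdifferentiableAt_iff_comp_tangentChart_symm hw).1 hg).hasFDerivAt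
    |>.hasMFDerivAt.comp w (hasMFDerivAt_tangentChart hw)
  have hg' : HasMFDerivAt 𝓘(ℝ, E).tangent 𝓘(ℝ, G) g w _ :=
    hcomp.congr_of_eventuallyEq (by
      filter_upwards [(isOpen_extChartAt_source v).mem_nhds hw] with q hq
      exact congrArg g ((tangentChart v).left_inv hq).symm)
  have hmfderiv := hg'.mfderiv
  exact congrArg (fun B : E × E →L[ℝ] G => B X) hmfderiv

end VerticalSections

section ConnectionForm

variable {E : Type*} [NormedAddCommGroup E] [NormedSpace ℝ E]
  {M : Type*} [TopologicalSpace M] [ChartedSpace E M] [IsManifold 𝓘(ℝ, E) ∞ M]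

/-- The flat connection, over the chart of `TM` at `v`, for which the sections that are constant
in this chart are parallel. -/
def flatConnection (v : TangentBundle 𝓘(ℝ, E) M)
    (σ : ∀ w : TangentBundle 𝓘(ℝ, E) M, VerticalBundle E M w) (w : TangentBundle 𝓘(ℝ, E) M) :
    TangentSpace 𝓘(ℝ, E).tangent w →L[ℝ] VerticalBundle E M w :=
  show E × E →L[ℝ] E from (fibreDeriv v w.proj).inverse ∘L
    fderiv ℝ (readSection v σ) (tangentChart v w) ∘L chartDeriv v w

variable {v w : TangentBundle 𝓘(ℝ, E) M} {p : E × E}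
  {σ : ∀ w : TangentBundle 𝓘(ℝ, E) M, VerticalBundle E M w}

lemma fibreDeriv_inverse_fibreDeriv (hw : w ∈ (tangentChart v).source) (z : E) :
    (fibreDeriv v w.proj).inverse (fibreDeriv v w.proj z) = z := by
  obtain ⟨e, he⟩ := isInvertible_fibreDeriv (mem_tangentChart_source_iff.1 hw)
  rw [← he, ContinuousLinearMap.inverse_equiv]
  simp

lemma fibreDeriv_fibreDeriv_inverse (hw : w ∈ (tangentChart v).source) (z : E) :
    fibreDeriv v w.proj ((fibreDeriv v w.proj).inverse z) = z := by
  obtain ⟨e, he⟩ := isInvertible_fibreDeriv (mem_tangentChart_source_iff.1 hw)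
  rw [← he, ContinuousLinearMap.inverse_equiv]
  simp

lemma isCovariantDerivativeOn_flatConnection (v : TangentBundle 𝓘(ℝ, E) M) :
    IsCovariantDerivativeOn (I := 𝓘(ℝ, E).tangent) E (flatConnection v)
      (tangentChart v).source where
  add {σ σ' w} hσ hσ' hw := by
    rw [mdifferentiableAt_verticalSection_iff hw] at hσ hσ'
    have hread : readSection v (σ + σ') = readSection v σ + readSection v σ' :=
      funext fun q => (fibreDeriv v ((tangentChart v).symm q).proj).map_add _ _
    refine ContinuousLinearMap.ext fun X : E × E => ?_
    have hderiv : fderiv ℝ (readSection v (σ + σ')) (tangentChart v w) (chartDeriv v w X) =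
        fderiv ℝ (readSection v σ) (tangentChart v w) (chartDeriv v w X) +
        fderiv ℝ (readSection v σ') (tangentChart v w) (chartDeriv v w X) := by
      rw [hread, fderiv_add hσ hσ', add_apply]
    exact (congrArg (fibreDeriv v w.proj).inverse hderiv).trans
      ((fibreDeriv v w.proj).inverse.map_add _ _)
  leibniz {σ g w} hσ hg hw := by
    rw [mdifferentiableAt_verticalSection_iff hw] at hσ
    have hg' := (mdifferentiableAt_iff_comp_tangentChart_symm hw).1 hg
    have hread : readSection v (g • σ) = (g ∘ (tangentChart v).symm) • readSection v σ :=
      funext fun q => (fibreDeriv v ((tangentChart v).symm q).proj).map_smul _ _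
    refine ContinuousLinearMap.ext fun X : E × E => ?_
    have hderiv : fderiv ℝ (readSection v (g • σ)) (tangentChart v w) (chartDeriv v w X) =
        g w • fderiv ℝ (readSection v σ) (tangentChart v w) (chartDeriv v w X) +
        mvfderiv 𝓘(ℝ, E).tangent g w X • fibreDeriv v w.proj (σ w) := by
      rw [hread, fderiv_smul hg' hσ, ← readSection_tangentChart (σ := σ) hw]
      refine Eq.trans ?_ (congrArg (_ + · • _)
        (mvfderiv_eq_fderiv_comp_tangentChart_symm hw hg X).symm)
      rw [add_apply, smul_apply, ContinuousLinearMap.smulRight_apply, Function.comp_apply,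
        (tangentChart v).left_inv hw]
    refine (congrArg (fibreDeriv v w.proj).inverse hderiv).trans ?_
    rw [map_add, map_smul, map_smul]
    exact congrArg (_ + ·) (congrArg (_ • ·) (fibreDeriv_inverse_fibreDeriv hw (σ w)))

variable [FiniteDimensional ℝ E]
  {D : (∀ w : TangentBundle 𝓘(ℝ, E) M, VerticalBundle E M w) →
    ∀ w : TangentBundle 𝓘(ℝ, E) M,
      TangentSpace 𝓘(ℝ, E).tangent w →L[ℝ] VerticalBundle E M w}
  (hD : IsCovariantDerivativeOn (I := 𝓘(ℝ, E).tangent) E D (puncturedTangentBundle E M))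

/-- The connection form of `D` in the chart of `TM` at `v`, that is, the difference of `D` and the
flat connection of the chart. The first argument of the bilinear map is the section, the second
one is the direction of the derivative. -/
def connectionForm (v : TangentBundle 𝓘(ℝ, E) M) (p : E × E) : E →L[ℝ] E × E →L[ℝ] E :=
  let w := (tangentChart v).symm p
  let A : E →L[ℝ] E × E →L[ℝ] E := IsCovariantDerivativeOn.difference
    (hD.mono (inter_subset_right (s := (tangentChart v).source)))
    ((isCovariantDerivativeOn_flatConnection v).mono inter_subset_left) w
  ContinuousLinearMap.compL ℝ (E × E) E E (fibreDeriv v w.proj) ∘L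
    A.bilinearComp (fibreDeriv v w.proj).inverse (chartDeriv v w).inverse

lemma fibreDeriv_connection (hw : w ∈ (tangentChart v).source)
    (hw₀ : w ∈ puncturedTangentBundle E M)
    (hσ : DifferentiableAt ℝ (readSection v σ) (tangentChart v w))
    (X : TangentSpace 𝓘(ℝ, E).tangent w) :
    fibreDeriv v w.proj (D σ w X) =
      fderiv ℝ (readSection v σ) (tangentChart v w) (chartDeriv v w X) +
      connectionForm hD v (tangentChart v w) (fibreDeriv v w.proj (σ w)) (chartDeriv v w X) := by
  have hX : (chartDeriv v w).inverse (chartDeriv v w X) = X := by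
    obtain ⟨e, he⟩ := isInvertible_chartDeriv hw
    rw [← he, ContinuousLinearMap.inverse_equiv]
    exact e.symm_apply_apply X
  have hflat : fibreDeriv v w.proj (flatConnection v σ w X) =
      fderiv ℝ (readSection v σ) (tangentChart v w) (chartDeriv v w X) :=
    fibreDeriv_fibreDeriv_inverse hw _
  let A : E →L[ℝ] E × E →L[ℝ] E := IsCovariantDerivativeOn.difference
    (hD.mono (inter_subset_right (s := (tangentChart v).source)))
    ((isCovariantDerivativeOn_flatConnection v).mono inter_subset_left) w
  have hw' : w ∈ (tangentChart v).source ∩ puncturedTangentBundle E M := ⟨hw, hw₀⟩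
  have hdiff : A (σ w) = D σ w - flatConnection v σ w :=
    IsCovariantDerivativeOn.difference_apply _ _ hw'
      ((mdifferentiableAt_verticalSection_iff hw).2 hσ)
  have hform : connectionForm hD v (tangentChart v w) (fibreDeriv v w.proj (σ w))
      (chartDeriv v w X) = fibreDeriv v w.proj (D σ w X - flatConnection v σ w X) := by
    rw [connectionForm, (tangentChart v).left_inv hw]
    refine congrArg (fibreDeriv v w.proj) (Eq.trans ?_
      (congrArg (fun B : E × E →L[ℝ] E => B X) hdiff))
    exact congrArg₂ (fun z Y => A z Y) (fibreDeriv_inverse_fibreDeriv hw (σ w)) hX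
  rw [hform, ← hflat]
  exact ((fibreDeriv v w.proj).map_add _ _).symm.trans
    (congrArg (fibreDeriv v w.proj) (add_sub_cancel _ _)) |>.symm

end ConnectionForm

section Curvature

variable {E : Type*} [NormedAddCommGroup E] [NormedSpace ℝ E]
  {M : Type*} [TopologicalSpace M] [ChartedSpace E M] [IsManifold 𝓘(ℝ, E) ∞ M]
  {D : (∀ w : TangentBundle 𝓘(ℝ, E) M, VerticalBundle E M w) →
    ∀ w : TangentBundle 𝓘(ℝ, E) M,
      TangentSpace 𝓘(ℝ, E).tangent w →L[ℝ] VerticalBundle E M w}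
  {v : TangentBundle 𝓘(ℝ, E) M} {p : E × E} {f : E × E → E}
  {S : ∀ w : TangentBundle 𝓘(ℝ, E) M, TangentSpace 𝓘(ℝ, E).tangent w}

lemma mlieBracket_extend_self [CompleteSpace E] (X Y : E × E) :
    VectorField.mlieBracket 𝓘(ℝ, E).tangent
      (FiberBundle.extend (E × E) (show TangentSpace 𝓘(ℝ, E).tangent v from X))
      (FiberBundle.extend (E × E) (show TangentSpace 𝓘(ℝ, E).tangent v from Y)) v = 0 := by
  have hsource := mem_extChartAt_source (I := 𝓘(ℝ, E).tangent) v
  have hconst : ∀ Z : TangentSpace 𝓘(ℝ, E).tangent v,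
      readField v (FiberBundle.extend (E × E) Z) =ᶠ[𝓝 (tangentChart v v)] fun _ => Z := fun Z => by
    filter_upwards [extChartAt_target_mem_nhds' ((tangentChart v).map_source hsource)] with q hq
    exact readField_extend Z hq
  have h := chartDeriv_mlieBracket hsource (differentiableAt_readField_extend hsource X)
    (differentiableAt_readField_extend hsource Y)
  rw [(hconst X).lieBracket_vectorField_eq (hconst Y)] at h
  refine (isInvertible_chartDeriv hsource).injective ((h.trans ?_).trans
    (map_zero (chartDeriv v v)).symm)
  simp [VectorField.lieBracket]

section Form

variable (hsmooth : ∀ U : Set (TangentBundle 𝓘(ℝ, E) M), IsOpen U →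
    U ⊆ puncturedTangentBundle E M →
      ContMDiffCovariantDerivativeOn (I := 𝓘(ℝ, E).tangent) E ∞ D U)

include hsmooth in
lemma differentiableAt_readSection_connection_extend (hv : v ∈ puncturedTangentBundle E M)
    (z : VerticalBundle E M v) (X : TangentSpace 𝓘(ℝ, E).tangent v) :
    DifferentiableAt ℝ (readSection v (fun w =>
      D (FiberBundle.extend E z) w (FiberBundle.extend (E × E) X w))) (tangentChart v v) := by
  have hvsource := mem_extChartAt_source (I := 𝓘(ℝ, E).tangent) v
  obtain ⟨s, hs, hσ⟩ := FiberBundle.exists_contMDiffOn_extend (k := ∞) 𝓘(ℝ, E).tangent E z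
  let U := interior s ∩ ((tangentChart v).source ∩ tangentChart v ⁻¹' chartDomain v)
  have hU : IsOpen U := isOpen_interior.inter
    ((continuousOn_extChartAt v).isOpen_inter_preimage (isOpen_extChartAt_source v)
      isOpen_chartDomain)
  have hvU : v ∈ U := ⟨mem_interior_iff_mem_nhds.2 hs, hvsource,
    (tangentChart_mem_chartDomain_iff hvsource).2 hv⟩
  have hDσ := (hsmooth U hU fun w hw =>
    (tangentChart_mem_chartDomain_iff hw.2.1).1 hw.2.2).contMDiff
    (hσ.mono fun w hw => interior_subset hw.1)
  have hDσv := (hDσ.contMDiffAt (hU.mem_nhds hvU)).mdifferentiableAt (by simp)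
  exact (mdifferentiableAt_verticalSection_iff hvsource).1 (hDσv.clm_bundle_apply
    (FiberBundle.mdifferentiableAt_extend 𝓘(ℝ, E).tangent (E × E) X))

variable [FiniteDimensional ℝ E]
  (hD : IsCovariantDerivativeOn (I := 𝓘(ℝ, E).tangent) E D (puncturedTangentBundle E M))

lemma connectionForm_eq_readSection (hp : p ∈ chartDomain v) (z : VerticalBundle E M v)
    (X : TangentSpace 𝓘(ℝ, E).tangent v) :
    connectionForm hD v p z X = readSection v (fun w =>
      D (FiberBundle.extend E z) w (FiberBundle.extend (E × E) X w)) p := by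
  have hsource := (tangentChart v).map_target hp.1
  have hz := hasFDerivAt_readSection_extend z hp.1
  rw [← (tangentChart v).right_inv hp.1] at hz
  have h := fibreDeriv_connection hD hsource (tangentChart_symm_mem_punctured hp)
    hz.differentiableAt (FiberBundle.extend (E × E) X ((tangentChart v).symm p))
  rw [hz.fderiv, zero_apply, zero_add, (tangentChart v).right_inv hp.1] at h
  refine (h.trans ?_).symm
  exact congrArg₂ (fun z X => connectionForm hD v p z X) (readSection_extend z hp.1)
    (readField_extend X hp.1)

include hsmooth

lemma differentiableAt_connectionForm (hv : v ∈ puncturedTangentBundle E M) :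
    DifferentiableAt ℝ (connectionForm hD v) (tangentChart v v) := by
  have hp := (tangentChart_mem_chartDomain_iff (mem_extChartAt_source v)).2 hv
  refine differentiableAt_clm_of_forall_apply fun z =>
    differentiableAt_clm_of_forall_apply fun X => ?_
  refine (differentiableAt_readSection_connection_extend hsmooth hv z X).congr_of_eventuallyEq ?_
  filter_upwards [isOpen_chartDomain.mem_nhds hp] with q hq
  exact connectionForm_eq_readSection hD hq z X

lemma connection_connection_extend (hv : v ∈ puncturedTangentBundle E M) (X Y : E × E) (z : E) :
    D (fun w => D (FiberBundle.extend E (show VerticalBundle E M v from z)) w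
        (FiberBundle.extend (E × E) (show TangentSpace 𝓘(ℝ, E).tangent v from Y) w)) v X =
      fderiv ℝ (connectionForm hD v) (tangentChart v v) X z Y
        + connectionForm hD v (tangentChart v v)
          (connectionForm hD v (tangentChart v v) z Y) X := by
  have hsource := mem_extChartAt_source (I := 𝓘(ℝ, E).tangent) v
  have hp := (tangentChart_mem_chartDomain_iff hsource).2 hv
  have hderiv : HasFDerivAt (fun q => connectionForm hD v q z Y) _ (tangentChart v v) :=
    ((differentiableAt_connectionForm hsmooth hD hv).hasFDerivAt.clm_apply
      (hasFDerivAt_const z _)).clm_apply (hasFDerivAt_const Y _)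
  have hread : readSection v (fun w =>
      D (FiberBundle.extend E (show VerticalBundle E M v from z)) w
        (FiberBundle.extend (E × E) (show TangentSpace 𝓘(ℝ, E).tangent v from Y) w))
      =ᶠ[𝓝 (tangentChart v v)] fun q => connectionForm hD v q z Y := by
    filter_upwards [isOpen_chartDomain.mem_nhds hp] with q hq
    exact (connectionForm_eq_readSection hD hq z Y).symm
  have h := fibreDeriv_connection hD hsource hv
    (differentiableAt_readSection_connection_extend hsmooth hv z Y) X
  rw [hread.fderiv_eq, hderiv.fderiv, ← readSection_tangentChart (σ := fun w =>
      D (FiberBundle.extend E (show VerticalBundle E M v from z)) w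
        (FiberBundle.extend (E × E) (show TangentSpace 𝓘(ℝ, E).tangent v from Y) w)) hsource,
    hread.self_of_nhds, chartDeriv_self, fibreDeriv_self] at h
  simpa using! h

lemma connectionCurvature_extend (hv : v ∈ puncturedTangentBundle E M) (X Y : E × E) (z : E) :
    connectionCurvature D
        (FiberBundle.extend (E × E) (show TangentSpace 𝓘(ℝ, E).tangent v from X))
        (FiberBundle.extend (E × E) (show TangentSpace 𝓘(ℝ, E).tangent v from Y))
        (FiberBundle.extend E (show VerticalBundle E M v from z)) v =
      (fderiv ℝ (connectionForm hD v) (tangentChart v v) Y z X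
        + connectionForm hD v (tangentChart v v)
          (connectionForm hD v (tangentChart v v) z X) Y)
      - (fderiv ℝ (connectionForm hD v) (tangentChart v v) X z Y
        + connectionForm hD v (tangentChart v v)
          (connectionForm hD v (tangentChart v v) z Y) X) := by
  have : CompleteSpace E := FiniteDimensional.complete ℝ E
  let Z := FiberBundle.extend E (show VerticalBundle E M v from z)
  have hbracket := (congrArg (D Z v) (mlieBracket_extend_self (M := M) (v := v) X Y)).trans
    (map_zero (D Z v))
  have hself : ∀ A : E × E, FiberBundle.extend (E × E)
      (show TangentSpace 𝓘(ℝ, E).tangent v from A) v = A := fun A =>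
    FiberBundle.extend_apply_self (E × E) (show TangentSpace 𝓘(ℝ, E).tangent v from A)
  have hXY := (congrArg (fun B : E × E => D (fun w => D Z w (FiberBundle.extend (E × E)
    (show TangentSpace 𝓘(ℝ, E).tangent v from Y) w)) v B) (hself X)).trans
    (connection_connection_extend hsmooth hD hv X Y z)
  have hYX := (congrArg (fun B : E × E => D (fun w => D Z w (FiberBundle.extend (E × E)
    (show TangentSpace 𝓘(ℝ, E).tangent v from X) w)) v B) (hself Y)).trans
    (connection_connection_extend hsmooth hD hv Y X z)
  refine (congrArg₂ HSub.hSub hbracket (congrArg₂ HSub.hSub hXY hYX)).trans ?_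
  exact (zero_sub _).trans (neg_sub _ _)

end Form

/-- `D` is a smooth linear connection on the restriction to `TM \ 0` of the vertical bundle for
which `∇_X C = P_𝒱(X)`: a spray connection, but without the condition on the torsion. -/
structure IsVerticalConnection
    (S : ∀ w : TangentBundle 𝓘(ℝ, E) M, TangentSpace 𝓘(ℝ, E).tangent w)
    (D : (∀ w : TangentBundle 𝓘(ℝ, E) M, VerticalBundle E M w) →
      ∀ w : TangentBundle 𝓘(ℝ, E) M,
        TangentSpace 𝓘(ℝ, E).tangent w →L[ℝ] VerticalBundle E M w) : Prop where
  isCovariantDerivativeOn :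
    IsCovariantDerivativeOn (I := 𝓘(ℝ, E).tangent) E D (puncturedTangentBundle E M)
  smooth : ∀ U : Set (TangentBundle 𝓘(ℝ, E) M), IsOpen U → U ⊆ puncturedTangentBundle E M →
    ContMDiffCovariantDerivativeOn (I := 𝓘(ℝ, E).tangent) E ∞ D U
  lift : ∀ w ∈ puncturedTangentBundle E M, ∀ X : TangentSpace 𝓘(ℝ, E).tangent w,
    verticalLift w (D canonicalField w X) = verticalProjection S w X

section Lift

variable [FiniteDimensional ℝ E]
  (hD : IsCovariantDerivativeOn (I := 𝓘(ℝ, E).tangent) E D (puncturedTangentBundle E M))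

lemma connectionForm_snd
    (hlift : ∀ w ∈ puncturedTangentBundle E M, ∀ X : TangentSpace 𝓘(ℝ, E).tangent w,
      verticalLift w (D canonicalField w X) = verticalProjection S w X)
    (hp : p ∈ chartDomain v) (hS : readField v S =ᶠ[𝓝 p] sprayField f)
    (hf : DifferentiableAt ℝ f p) (X : E × E) :
    connectionForm hD v p p.2 X = -((1 / 2 : ℝ) • fderiv ℝ f p (0, X.1)) := by
  have : CompleteSpace E := FiniteDimensional.complete ℝ E
  obtain ⟨w, hsource, rfl⟩ : ∃ w ∈ (tangentChart v).source, tangentChart v w = p :=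
    ⟨_, (tangentChart v).map_target hp.1, (tangentChart v).right_inv hp.1⟩
  have hw := (tangentChart_mem_chartDomain_iff hsource).1 hp
  obtain ⟨X, rfl⟩ := (isInvertible_chartDeriv hsource).surjective X
  have hC := hasFDerivAt_readSection_canonicalField hp.1
  have hconn := fibreDeriv_connection hD hsource hw hC.differentiableAt X
  rw [hC.fderiv] at hconn
  have hproj := congrArg Prod.snd ((chartDeriv_verticalLift hsource _).symm.trans
    ((congrArg (chartDeriv v w) (hlift w hw X)).trans
      (chartDeriv_verticalProjection hsource hS hf X)))
  have hsnd : fibreDeriv v w.proj (canonicalField w) = (tangentChart v w).2 :=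
    (snd_tangentChart hsource).symm
  have h := hconn.symm.trans hproj
  rw [hsnd] at h
  rw [sub_eq_add_neg] at h
  exact add_left_cancel h

lemma fderiv_connectionForm_snd
    (hsmooth : ∀ U : Set (TangentBundle 𝓘(ℝ, E) M), IsOpen U →
      U ⊆ puncturedTangentBundle E M →
        ContMDiffCovariantDerivativeOn (I := 𝓘(ℝ, E).tangent) E ∞ D U)
    (hform : ∀ p ∈ chartDomain v, ∀ X : E × E,
      connectionForm hD v p p.2 X = -((1 / 2 : ℝ) • fderiv ℝ f p (0, X.1)))
    (hv : v ∈ puncturedTangentBundle E M) (hf : ContDiffAt ℝ ∞ f (tangentChart v v))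
    (X Y : E × E) :
    fderiv ℝ (connectionForm hD v) (tangentChart v v) Y (tangentChart v v).2 X
        + connectionForm hD v (tangentChart v v) Y.2 X =
      -((1 / 2 : ℝ) • fderiv ℝ (fderiv ℝ f) (tangentChart v v) Y (0, X.1)) := by
  have hp := (tangentChart_mem_chartDomain_iff (mem_extChartAt_source v)).2 hv
  have hleft : HasFDerivAt (fun p => connectionForm hD v p p.2 X) _ (tangentChart v v) :=
    ((differentiableAt_connectionForm hsmooth hD hv).hasFDerivAt.clm_apply
      hasFDerivAt_snd).clm_apply (hasFDerivAt_const X _)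
  have hright : HasFDerivAt (fun p => -((1 / 2 : ℝ) • fderiv ℝ f p (0, X.1))) _
      (tangentChart v v) :=
    (((hasFDerivAt_fderiv hf).clm_apply
      (hasFDerivAt_const ((0, X.1) : E × E) _)).const_smul (1 / 2 : ℝ)).neg
  have heq := hright.congr_of_eventuallyEq <| by
    filter_upwards [isOpen_chartDomain.mem_nhds hp] with p hp using hform p hp X
  have h := congrArg (fun B : E × E →L[ℝ] E => B Y) (hleft.unique heq)
  simpa [add_comm] using h

end Lift

section SprayConnection

variable [FiniteDimensional ℝ E] (hD : IsVerticalConnection S D)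
  (hf : IsSprayOn (chartDomain v) f)
  (hS : ∀ p ∈ chartDomain v, readField v S =ᶠ[𝓝 p] sprayField f)
  (hv : v ∈ puncturedTangentBundle E M)
include hf hS hv

lemma curvatureEndomorphism_eq_connectionForm (u : E) :
    let p := tangentChart v v
    let Γ := connectionForm hD.isCovariantDerivativeOn v
    let X := sprayHorizontal f p p.2
    let Y := sprayHorizontal f p u
    (show E from curvatureEndomorphism S D v u) = (fderiv ℝ Γ p Y p.2 X + Γ p (Γ p p.2 X) Y)
      - (fderiv ℝ Γ p X p.2 Y + Γ p (Γ p p.2 Y) X) := by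
  intro p Γ X Y
  have hp : p ∈ chartDomain v := (tangentChart_mem_chartDomain_iff (mem_extChartAt_source v)).2 hv
  have hhorizontal : ∀ u : E, horizontalLift S v u = sprayHorizontal f p u :=
    horizontalLift_eq_sprayHorizontal (hS p hp) ((hf.contDiffAt hp).differentiableAt (by simp))
  have hX : horizontalLift S v v.2 = X :=
    (hhorizontal v.2).trans (congrArg (sprayHorizontal f p) snd_tangentChart_self.symm)
  let R : E × E → E × E → E → E := fun X Y z => connectionCurvature D
    (FiberBundle.extend (E × E) (show TangentSpace 𝓘(ℝ, E).tangent v from X))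
    (FiberBundle.extend (E × E) (show TangentSpace 𝓘(ℝ, E).tangent v from Y))
    (FiberBundle.extend E (show VerticalBundle E M v from z)) v
  have hR : curvatureEndomorphism S D v u = R X Y p.2 :=
    (congrArg₂ (fun X Y => R X Y v.2) hX (hhorizontal u)).trans
      (congrArg (R _ _) snd_tangentChart_self.symm)
  exact hR.trans (connectionCurvature_extend hD.smooth hD.isCovariantDerivativeOn hv X Y p.2)

include hD in
theorem curvatureEndomorphism_eq_sprayCurvature (u : E) :
    curvatureEndomorphism S D v u = sprayCurvature f (tangentChart v v) u := by
  have hp := (tangentChart_mem_chartDomain_iff (mem_extChartAt_source v)).2 hv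
  have hdiff : ∀ p ∈ chartDomain v, DifferentiableAt ℝ f p := fun p hp =>
    (hf.contDiffAt hp).differentiableAt (by simp)
  have hform := fun p (hp : p ∈ chartDomain v) => connectionForm_snd
    hD.isCovariantDerivativeOn hD.lift hp (hS p hp) (hdiff p hp)
  have hderiv := fderiv_connectionForm_snd hD.isCovariantDerivativeOn hD.smooth hform hv
    (hf.contDiffAt hp)
  refine (curvatureEndomorphism_eq_connectionForm hD hf hS hv u).trans ?_
  set p₀ := tangentChart v v
  set Γ := connectionForm hD.isCovariantDerivativeOn v
  have hΓ : ∀ u, Γ p₀ p₀.2 (sprayHorizontal f p₀ u) = -(sprayHorizontal f p₀ u).2 :=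
    fun u => hform p₀ hp _
  have hself := hf.sprayHorizontal_self hp
  have hXY := eq_sub_of_add_eq (hderiv (sprayHorizontal f p₀ p₀.2) (sprayHorizontal f p₀ u))
  have hYX := eq_sub_of_add_eq (hderiv (sprayHorizontal f p₀ u) (sprayHorizontal f p₀ p₀.2))
  rw [hΓ, hΓ, hXY, hYX, map_neg, map_neg, hself, ← hf.fderiv_fderiv_horizontal hp u]
  simp only [neg_apply, sprayHorizontal, sprayField]
  module

end SprayConnection

end Curvature

section SprayFlow

variable {E : Type*} [NormedAddCommGroup E] [NormedSpace ℝ E] {O : Set (E × E)} {f : E × E → E}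
  {W : Set (ℝ × (E × E))} {Ψ : ℝ × (E × E) → E × E} {p : E × E} {ℓ : ℝ → Submodule ℝ (E × E)}
  (h : IsLocalFlow O (sprayField f) W Ψ) (hf : IsSprayOn O f) (hp : (0, p) ∈ W)
include h hf hp

lemma exists_isLinearFlow_sprayField [CompleteSpace E] : ∃ T ⊆ {t | (t, p) ∈ W}, IsLinearFlow T
    (fun t => companion (fderiv ℝ f (Ψ (t, p)) ∘L ContinuousLinearMap.inl ℝ E E)
      (fderiv ℝ f (Ψ (t, p)) ∘L ContinuousLinearMap.inr ℝ E E))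
    fun t => fderiv ℝ (fun q => Ψ (t, q)) p := by
  have hdiff : ∀ q ∈ O, DifferentiableAt ℝ f q := fun q hq =>
    (hf.contDiffAt hq).differentiableAt (by simp)
  obtain ⟨T, hT, hlinear⟩ := h.exists_isLinearFlow
    (fun q hq => (differentiableAt_snd.prodMk (hdiff q hq)).differentiableWithinAt) hf.isOpen hp
  refine ⟨T, hT, { hlinear with hasDerivAt := fun t ht => ?_ }⟩
  rw [← fderiv_sprayField (hdiff _ (h.mapsTo (hT ht)))]
  exact hlinear.hasDerivAt t ht

variable [FiniteDimensional ℝ E]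
  (hℓ : ∀ t, (t, p) ∈ W → ∀ X, X ∈ ℓ t ↔ (fderiv ℝ (fun q => Ψ (t, q)) p X).1 = 0)
include hℓ

lemma isFanningAt_of_sprayField : IsFanningAt ℓ 0 := by
  have : CompleteSpace E := FiniteDimensional.complete ℝ E
  obtain ⟨T, hT, hlinear⟩ := exists_isLinearFlow_sprayField h hf hp
  exact isFanningAt_vertical hlinear (fun t ht => hℓ t (hT ht)) hlinear.zero_mem

lemma wronskian_of_sprayField {Ω : E × E → E × E → ℝ} {x : E × E} {c : E →L[ℝ] ℝ}
    (hΩ : ∀ Y, Ω x Y = -c Y.1) (e : E) : wronskian Ω ℓ 0 x (0, e) = c e := by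
  have : CompleteSpace E := FiniteDimensional.complete ℝ E
  obtain ⟨T, hT, hlinear⟩ := exists_isLinearFlow_sprayField h hf hp
  rw [wronskian_vertical hlinear (fun t ht => hℓ t (hT ht)) (c := fun e => -c e) hΩ, map_neg,
    neg_neg]

lemma jacobiEndomorphism_of_sprayField (e : E) :
    jacobiEndomorphism ℓ 0 (0, e) = (0, sprayCurvature f p e) := by
  have : CompleteSpace E := FiniteDimensional.complete ℝ E
  obtain ⟨T, hT, hlinear⟩ := exists_isLinearFlow_sprayField h hf hp
  have hΨ₀ := h.apply_zero p hp
  have hderiv : HasDerivAt (fun t => fderiv ℝ f (Ψ (t, p)))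
      (fderiv ℝ (fderiv ℝ f) (Ψ (0, p)) (sprayField f (Ψ (0, p)))) 0 :=
    (hasFDerivAt_fderiv (hf.contDiffAt (h.mapsTo hp))).comp_hasDerivAt (0 : ℝ)
      (h.hasDerivAt (0, p) hp)
  have hderiv_inr := hderiv.clm_comp (hasDerivAt_const 0 (ContinuousLinearMap.inr ℝ E E))
  refine (jacobiEndomorphism_vertical hlinear (fun t ht => hℓ t (hT ht)) hderiv_inr e).trans ?_
  rw [sprayCurvature_apply, hΨ₀]
  simp only [ContinuousLinearMap.comp_apply, ContinuousLinearMap.inl_apply,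
    ContinuousLinearMap.inr_apply, ContinuousLinearMap.comp_zero, add_zero]

end SprayFlow

section FlowInChart

variable {E : Type*} [NormedAddCommGroup E] [NormedSpace ℝ E]
  {M : Type*} [TopologicalSpace M] [ChartedSpace E M] [IsManifold 𝓘(ℝ, E) ∞ M]
  {v : TangentBundle 𝓘(ℝ, E) M} {f : E × E → E} {t : ℝ}
  {S : ∀ w : TangentBundle 𝓘(ℝ, E) M, TangentSpace 𝓘(ℝ, E).tangent w}
  {Φ : ℝ → TangentBundle 𝓘(ℝ, E) M → TangentBundle 𝓘(ℝ, E) M}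

/-- The flow `Φ`, read in the preferred chart at `v`, as a function of time and initial point. -/
def flowInChart (v : TangentBundle 𝓘(ℝ, E) M)
    (Φ : ℝ → TangentBundle 𝓘(ℝ, E) M → TangentBundle 𝓘(ℝ, E) M) (z : ℝ × (E × E)) : E × E :=
  tangentChart v (Φ z.1 ((tangentChart v).symm z.2))

/-- The times in `(-ε, ε)` and initial points in `U` for which the flow `Φ` can be read in the
preferred chart at `v`. -/
def flowInChartDomain (v : TangentBundle 𝓘(ℝ, E) M)
    (Φ : ℝ → TangentBundle 𝓘(ℝ, E) M → TangentBundle 𝓘(ℝ, E) M) (ε : ℝ)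
    (U : Set (TangentBundle 𝓘(ℝ, E) M)) : Set (ℝ × (E × E)) :=
  Ioo (-ε) ε ×ˢ ((tangentChart v).target ∩ (tangentChart v).symm ⁻¹' U) ∩
    (fun z => Φ z.1 ((tangentChart v).symm z.2)) ⁻¹' (tangentChart v).source

lemma chartSymmDeriv_self :
    chartSymmDeriv v (tangentChart v v) = ContinuousLinearMap.id ℝ (E × E) := by
  have h := chartDeriv_comp_chartSymmDeriv (mem_extChartAt_target (I := 𝓘(ℝ, E).tangent) v)
  rwa [(tangentChart v).left_inv (mem_extChartAt_source v), chartDeriv_self,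
    ContinuousLinearMap.id_comp] at h

lemma mem_jacobiCurve_iff
    (hΦ : MDifferentiableAt 𝓘(ℝ, E).tangent 𝓘(ℝ, E).tangent (Φ t) v)
    (ht : Φ t v ∈ (tangentChart v).source) (X : E × E) :
    X ∈ jacobiCurve Φ v t ↔
      (fderiv ℝ (fun q => flowInChart v Φ (t, q)) (tangentChart v v) X).1 = 0 := by
  have hleft := (tangentChart v).left_inv (mem_extChartAt_source v)
  have hflow : HasMFDerivAt 𝓘(ℝ, E).tangent 𝓘(ℝ, E × E) (tangentChart v ∘ Φ t)
      ((tangentChart v).symm (tangentChart v v)) (chartDeriv v (Φ t v) ∘L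
        (show E × E →L[ℝ] E × E from mfderiv 𝓘(ℝ, E).tangent 𝓘(ℝ, E).tangent (Φ t) v)) := by
    rw [hleft]
    exact (hasMFDerivAt_tangentChart ht).comp v hΦ.hasMFDerivAt
  have hchart : HasFDerivAt (fun q => flowInChart v Φ (t, q)) ((chartDeriv v (Φ t v) ∘L
      (show E × E →L[ℝ] E × E from mfderiv 𝓘(ℝ, E).tangent 𝓘(ℝ, E).tangent (Φ t) v)) ∘L
      chartSymmDeriv v (tangentChart v v)) (tangentChart v v) :=
    (hflow.comp _ (hasMFDerivAt_tangentChart_symm (mem_extChartAt_target v))).hasFDerivAt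
  rw [chartSymmDeriv_self, ContinuousLinearMap.comp_id] at hchart
  rw [hchart.fderiv]
  exact mem_verticalSpace_iff ht _

section Domain

variable {ε : ℝ} {U : Set (TangentBundle 𝓘(ℝ, E) M)} (hU : IsOpen U)
  (hsmooth : ContMDiffOn (𝓘(ℝ, ℝ).prod 𝓘(ℝ, E).tangent) 𝓘(ℝ, E).tangent ∞
    (fun p : ℝ × TangentBundle 𝓘(ℝ, E) M => Φ p.1 p.2) (Ioo (-ε) ε ×ˢ U))

include hsmooth in
lemma contMDiffOn_flow_tangentChart_symm :
    ContMDiffOn 𝓘(ℝ, ℝ × (E × E)) 𝓘(ℝ, E).tangent ∞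
      (fun z : ℝ × (E × E) => Φ z.1 ((tangentChart v).symm z.2))
      (Ioo (-ε) ε ×ˢ ((tangentChart v).target ∩ (tangentChart v).symm ⁻¹' U)) :=
  hsmooth.comp (contDiff_fst.contMDiff.contMDiffOn.prodMk
    ((contMDiffOn_extChartAt_symm v).comp contDiff_snd.contMDiff.contMDiffOn fun _ hz => hz.2.1))
    fun _ hz => ⟨hz.1, hz.2.2⟩

include hU hsmooth in
lemma isOpen_flowInChartDomain : IsOpen (flowInChartDomain v Φ ε U) :=
  (contMDiffOn_flow_tangentChart_symm hsmooth).continuousOn.isOpen_inter_preimage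
    (isOpen_Ioo.prod ((contMDiffOn_extChartAt_symm (n := ∞) v).continuousOn.isOpen_inter_preimage
      (isOpen_extChartAt_target v) hU)) (isOpen_extChartAt_source v)

include hsmooth in
lemma contDiffOn_flowInChart : ContDiffOn ℝ ∞ (flowInChart v Φ) (flowInChartDomain v Φ ε U) := by
  refine (contMDiffOn_extChartAt.comp
    ((contMDiffOn_flow_tangentChart_symm hsmooth).mono inter_subset_left) fun z hz => ?_).contDiffOn
  have hsource := hz.2
  rwa [mem_preimage, extChartAt_source] at hsource

end Domain

lemma hasDerivAt_flowInChart {J : Set ℝ} {p : E × E} (hJ : J ∈ 𝓝 t)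
    (hS : ∀ p ∈ chartDomain v, readField v S p = sprayField f p)
    (hcurve : IsMIntegralCurveOn (fun s => Φ s ((tangentChart v).symm p)) S J)
    (hpunctured : Φ t ((tangentChart v).symm p) ∈ puncturedTangentBundle E M)
    (hsource : Φ t ((tangentChart v).symm p) ∈ (tangentChart v).source) :
    HasDerivAt (fun s => flowInChart v Φ (s, p)) (sprayField f (flowInChart v Φ (t, p))) t := by
  have hflow := (hcurve t (mem_of_mem_nhds hJ)).hasMFDerivAt hJ
  have hchart : HasFDerivAt (fun s => flowInChart v Φ (s, p))
      (chartDeriv v (Φ t ((tangentChart v).symm p)) ∘L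
        (1 : ℝ →L[ℝ] ℝ).smulRight (show E × E from S (Φ t ((tangentChart v).symm p)))) t :=
    ((hasMFDerivAt_tangentChart hsource).comp t hflow).hasFDerivAt
  refine hchart.hasDerivAt.congr_deriv ?_
  refine Eq.trans ?_ ((readField_tangentChart hsource).symm.trans
    (hS _ ((tangentChart_mem_chartDomain_iff hsource).2 hpunctured)))
  exact congrArg (chartDeriv v _) (one_smul ℝ _)

theorem exists_isLocalFlow_flowInChart (hΦ : IsLocalFlowNear S v Φ)
    (hS : ∀ p ∈ chartDomain v, readField v S p = sprayField f p) :
    ∃ W, IsLocalFlow (chartDomain v) (sprayField f) W (flowInChart v Φ) ∧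
      (0, tangentChart v v) ∈ W ∧ ∀ t, (t, tangentChart v v) ∈ W → ∀ X, X ∈ jacobiCurve Φ v t ↔
        (fderiv ℝ (fun q => flowInChart v Φ (t, q)) (tangentChart v v) X).1 = 0 := by
  obtain ⟨ε, hε, U, hU, hvU, hsmooth, hflow⟩ := hΦ
  have hleft := (tangentChart v).left_inv (mem_extChartAt_source v)
  refine ⟨flowInChartDomain v Φ ε U,
    { isOpen := isOpen_flowInChartDomain hU hsmooth
      contDiffOn := contDiffOn_flowInChart hsmooth
      mapsTo := fun z hz =>
        (tangentChart_mem_chartDomain_iff hz.2).2 ((hflow _ hz.1.2.2).2.1 _ hz.1.1)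
      apply_zero := fun p hp => ?_
      hasDerivAt := fun z hz => hasDerivAt_flowInChart (isOpen_Ioo.mem_nhds hz.1.1) hS
        (hflow _ hz.1.2.2).2.2 ((hflow _ hz.1.2.2).2.1 _ hz.1.1) hz.2 }, ?_, fun t ht => ?_⟩
  · rw [flowInChart, (hflow _ hp.1.2.2).1, (tangentChart v).right_inv hp.1.2.1]
  · have hU₀ : (tangentChart v).symm (tangentChart v v) ∈ U := hleft.symm ▸ hvU
    refine ⟨⟨⟨neg_lt_zero.2 hε, hε⟩, mem_extChartAt_target v, hU₀⟩, ?_⟩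
    rw [mem_preimage, (hflow _ hU₀).1, hleft]
    exact mem_extChartAt_source v
  · refine mem_jacobiCurve_iff ?_ ?_
    · exact ((hsmooth.contMDiffAt ((isOpen_Ioo.prod hU).mem_nhds
        (show (t, v) ∈ _ from ⟨ht.1.1, hvU⟩))).mdifferentiableAt (by simp)).comp v
        (mdifferentiableAt_const.prodMk mdifferentiableAt_id)
    · have hsource := ht.2
      rwa [mem_preimage, hleft] at hsource

end FlowInChart

section Flags

variable {𝕜 V : Type*} [Field 𝕜] [AddCommGroup V] [Module 𝕜 V] {y u u' : V}

lemma exists_eq_smul_add_smul_of_span_pair_eq (hyu : LinearIndependent 𝕜 ![y, u])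
    (hspan : Submodule.span 𝕜 {y, u} = Submodule.span 𝕜 {y, u'}) :
    ∃ α β : 𝕜, α ≠ 0 ∧ u' = α • u + β • y := by
  have hu' : u' ∈ Submodule.span 𝕜 {y, u} := hspan ▸ Submodule.subset_span (by simp)
  have hu : u ∈ Submodule.span 𝕜 {y, u'} := hspan ▸ Submodule.subset_span (by simp)
  obtain ⟨β, α, rfl⟩ := Submodule.mem_span_pair.1 hu'
  obtain ⟨δ, γ, hδγ⟩ := Submodule.mem_span_pair.1 hu
  refine ⟨α, β, ?_, add_comm _ _⟩
  rintro rfl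
  have hcoeff := LinearIndependent.pair_iff.1 hyu (δ + γ * β) (-1)
    (by rw [← sub_eq_zero] at hδγ; rw [← hδγ]; module)
  exact one_ne_zero (neg_eq_zero.1 hcoeff.2)

lemma flag_quotient_eq_of_orthogonal {g : LinearMap.BilinForm 𝕜 V} (hg : ∀ a b, g a b = g b a)
    {R : V →ₗ[𝕜] V} (hRy : R y = 0) (hRu : g (R u) y = 0) (hyu : g y u = 0)
    {α : 𝕜} (hα : α ≠ 0) (β : 𝕜) :
    g (R (α • u + β • y)) (α • u + β • y) /
        (g y y * g (α • u + β • y) (α • u + β • y) - g y (α • u + β • y) ^ 2) =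
      1 / g y y * (g (R u) u / g u u) := by
  have hnumerator : g (R (α • u + β • y)) (α • u + β • y) = α ^ 2 * g (R u) u := by
    simp only [map_add, map_smul, hRy, hRu, LinearMap.smul_apply, smul_zero, add_zero,
      smul_eq_mul]
    ring
  have hdenominator : g y y * g (α • u + β • y) (α • u + β • y) - g y (α • u + β • y) ^ 2 =
      α ^ 2 * (g y y * g u u) := by
    simp only [map_add, map_smul, LinearMap.add_apply, LinearMap.smul_apply, hyu, hg u y,
      smul_eq_mul]
    ring
  rw [hnumerator, hdenominator, mul_div_mul_left _ _ (pow_ne_zero 2 hα), div_mul_div_comm, one_mul]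

end Flags

section Finsler

variable {E : Type*} [NormedAddCommGroup E] [NormedSpace ℝ E]
  {M : Type*} [TopologicalSpace M] [ChartedSpace E M] [IsManifold 𝓘(ℝ, E) ∞ M]
  {F : TangentBundle 𝓘(ℝ, E) M → ℝ} {v : TangentBundle 𝓘(ℝ, E) M}

lemma verticalLift_self (u : E) : verticalLift v u = ((0, u) : E × E) := by
  have h := chartDeriv_verticalLift (mem_extChartAt_source v) u
  rwa [chartDeriv_self, fibreDeriv_self] at h

lemma tangentChart_self_mem_chartDomain (hv : v ∈ puncturedTangentBundle E M) :
    tangentChart v v ∈ chartDomain v :=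
  (tangentChart_mem_chartDomain_iff (mem_extChartAt_source v)).2 hv

lemma fundamentalTensor_eq_coordMetric (hF : IsFinslerMetric F)
    (hv : v ∈ puncturedTangentBundle E M) (u₁ u₂ : E) :
    fundamentalTensor F v u₁ u₂ = coordMetric (coordEnergy F v) (tangentChart v v) u₁ u₂ := by
  have h := fundamentalTensor_apply hF (mem_extChartAt_source v) hv u₁ u₂
  rwa [fibreDeriv_self] at h

lemma omegaForm_vertical (hF : IsFinslerMetric F) (hv : v ∈ puncturedTangentBundle E M) (u : E)
    (Y : E × E) : omegaForm F v ((0, u) : E × E) Y =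
      -coordMetric (coordEnergy F v) (tangentChart v v) u Y.1 := by
  have h := omegaForm_eq hF (mem_extChartAt_source v) hv ((0, u) : E × E) Y
  rw [chartDeriv_self] at h
  exact h.trans (coordOmega_vertical _ _ u Y)

lemma fundamentalTensor_self_self (hF : IsFinslerMetric F)
    (hv : v ∈ puncturedTangentBundle E M) : fundamentalTensor F v v.2 v.2 = F v ^ 2 := by
  have h := (isCoordEnergy hF).coordMetric_self_self (tangentChart_self_mem_chartDomain hv)
  rw [coordEnergy_tangentChart (mem_extChartAt_source v), energy, snd_tangentChart_self] at h
  refine (fundamentalTensor_eq_coordMetric hF hv v.2 v.2).trans (h.trans ?_)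
  ring

section Connection

variable [FiniteDimensional ℝ E] (hF : IsFinslerMetric F)
  {D : (∀ w : TangentBundle 𝓘(ℝ, E) M, VerticalBundle E M w) →
    ∀ w : TangentBundle 𝓘(ℝ, E) M,
      TangentSpace 𝓘(ℝ, E).tangent w →L[ℝ] VerticalBundle E M w}
  (hD : IsVerticalConnection (geodesicSpray F) D) (hv : v ∈ puncturedTangentBundle E M)
include hF hD hv

lemma curvatureEndomorphism_geodesicSpray (u : E) :
    curvatureEndomorphism (geodesicSpray F) D v u =
      sprayCurvature (coordForce (coordEnergy F v)) (tangentChart v v) u :=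
  curvatureEndomorphism_eq_sprayCurvature hD (isCoordEnergy hF).isSprayOn
    (fun _ hp => readField_geodesicSpray_eventuallyEq hF hp) hv u

theorem flagCurvature_of_orthogonal {u : E}
    (hvu : LinearIndependent ℝ ![(v.2 : E), u]) (hort : fundamentalTensor F v v.2 u = 0) :
    flagCurvature F D v (Submodule.span ℝ {v.2, u}) = 1 / F v ^ 2 *
      (fundamentalTensor F v (curvatureEndomorphism (geodesicSpray F) D v u) u /
        fundamentalTensor F v u u) := by
  have hp := tangentChart_self_mem_chartDomain hv
  have hL := isCoordEnergy (v := v) hF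
  have hself := snd_tangentChart_self (v := v)
  let g : LinearMap.BilinForm ℝ E := (show E →L[ℝ] E →L[ℝ] ℝ from fundamentalTensor F v).toBilinForm
  let R : E →L[ℝ] E := sprayCurvature (coordForce (coordEnergy F v)) (tangentChart v v)
  have hg : ∀ a b, g a b = coordMetric (coordEnergy F v) (tangentChart v v) a b :=
    fundamentalTensor_eq_coordMetric hF hv
  have hR : ∀ a : E, curvatureEndomorphism (geodesicSpray F) D v a = R a :=
    curvatureEndomorphism_geodesicSpray hF hD hv
  have hRv : R v.2 = 0 := hself ▸ (hL.isSprayOn.sprayCurvature_self hp)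
  have hRu : g (R u) v.2 = 0 := (hg _ _).trans (hself ▸ hL.coordMetric_sprayCurvature_self hp u)
  have hsymm : ∀ a b, g a b = g b a := fun a b => by rw [hg, hg, hL.coordMetric_symm hp]
  obtain ⟨u', hu', hvalue⟩ : ∃ u' : E,
      (Submodule.span ℝ {(v.2 : E), u} : Submodule ℝ E) = Submodule.span ℝ {(v.2 : E), u'} ∧
      flagCurvature F D v (Submodule.span ℝ {v.2, u}) =
        g (curvatureEndomorphism (geodesicSpray F) D v u') u' /
          (g v.2 v.2 * g u' u' - g v.2 u' ^ 2) :=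
    ⟨_, Classical.epsilon_spec (p := fun u' : E => (Submodule.span ℝ {(v.2 : E), u} :
      Submodule ℝ E) = Submodule.span ℝ {(v.2 : E), u'}) ⟨u, rfl⟩, rfl⟩
  obtain ⟨α, β, hα, rfl⟩ := exists_eq_smul_add_smul_of_span_pair_eq (V := E) hvu hu'
  have hquotient := flag_quotient_eq_of_orthogonal hsymm (R := R.toLinearMap) hRv hRu hort hα β
  rw [ContinuousLinearMap.coe_coe, ← hR, ← hR] at hquotient
  rw [hvalue, ← fundamentalTensor_self_self hF hv]
  exact hquotient

end Connection

section JacobiCurve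

variable [FiniteDimensional ℝ E] (hF : IsFinslerMetric F)
  {Φ : ℝ → TangentBundle 𝓘(ℝ, E) M → TangentBundle 𝓘(ℝ, E) M}
  (hΦ : IsLocalFlowNear (geodesicSpray F) v Φ)
include hF hΦ

lemma exists_isLocalFlow_geodesicFlow :
    ∃ W, IsLocalFlow (chartDomain v) (sprayField (coordForce (coordEnergy F v))) W
        (flowInChart v Φ) ∧
      (0, tangentChart v v) ∈ W ∧ ∀ t, (t, tangentChart v v) ∈ W → ∀ X, X ∈ jacobiCurve Φ v t ↔
        (fderiv ℝ (fun q => flowInChart v Φ (t, q)) (tangentChart v v) X).1 = 0 :=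
  exists_isLocalFlow_flowInChart hΦ
    fun _ hp => (readField_geodesicSpray_eventuallyEq hF hp).self_of_nhds

theorem isFanningAt_jacobiCurve : IsFanningAt (jacobiCurve Φ v) 0 := by
  obtain ⟨W, hflow, hW, hℓ⟩ := exists_isLocalFlow_geodesicFlow hF hΦ
  exact isFanningAt_of_sprayField hflow (isCoordEnergy hF).isSprayOn hW hℓ

theorem jacobiEndomorphism_jacobiCurve
    {D : (∀ w : TangentBundle 𝓘(ℝ, E) M, VerticalBundle E M w) →
      ∀ w : TangentBundle 𝓘(ℝ, E) M,
        TangentSpace 𝓘(ℝ, E).tangent w →L[ℝ] VerticalBundle E M w}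
    (hD : IsVerticalConnection (geodesicSpray F) D) (hv : v ∈ puncturedTangentBundle E M)
    (u : E) :
    jacobiEndomorphism (jacobiCurve Φ v) 0 (verticalLift v u) =
      verticalLift v (curvatureEndomorphism (geodesicSpray F) D v u) := by
  obtain ⟨W, hflow, hW, hℓ⟩ := exists_isLocalFlow_geodesicFlow hF hΦ
  have hjacobi := jacobiEndomorphism_of_sprayField hflow (isCoordEnergy hF).isSprayOn hW hℓ u
  refine (congrArg (jacobiEndomorphism (jacobiCurve Φ v) 0) (verticalLift_self u)).trans
    (hjacobi.trans ?_)
  exact (congrArg (Prod.mk (0 : E)) (curvatureEndomorphism_geodesicSpray hF hD hv u).symm).trans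
    (verticalLift_self _).symm

theorem wronskian_jacobiCurve (hv : v ∈ puncturedTangentBundle E M)
    (u₁ u₂ : E) :
    wronskian (V := E × E) (omegaForm F v) (jacobiCurve Φ v) 0 (verticalLift v u₁)
      (verticalLift v u₂) = fundamentalTensor F v u₁ u₂ := by
  obtain ⟨W, hflow, hW, hℓ⟩ := exists_isLocalFlow_geodesicFlow hF hΦ
  have hwronskian := wronskian_of_sprayField hflow (isCoordEnergy hF).isSprayOn hW hℓ
    (Ω := omegaForm F v) (omegaForm_vertical hF hv u₁) u₂
  exact (congrArg₂ (wronskian (V := E × E) (omegaForm F v) (jacobiCurve Φ v) 0)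
    (verticalLift_self u₁) (verticalLift_self u₂)).trans
    (hwronskian.trans (fundamentalTensor_eq_coordMetric hF hv u₁ u₂).symm)

end JacobiCurve

end Finsler

end FinslerJacobi

end

theorem mainTheorem1_general {E : Type*} [NormedAddCommGroup E] [NormedSpace ℝ E]
    [FiniteDimensional ℝ E]
    {M : Type*} [TopologicalSpace M] [ChartedSpace E M] [IsManifold 𝓘(ℝ, E) ∞ M]
    {F : TangentBundle 𝓘(ℝ, E) M → ℝ} (hF : FinslerJacobi.IsFinslerMetric F)
    {D : (∀ w : TangentBundle 𝓘(ℝ, E) M, FinslerJacobi.VerticalBundle E M w) →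
      ∀ w : TangentBundle 𝓘(ℝ, E) M,
        TangentSpace 𝓘(ℝ, E).tangent w →L[ℝ] FinslerJacobi.VerticalBundle E M w}
    (hD : FinslerJacobi.IsVerticalConnection (FinslerJacobi.geodesicSpray F) D)
    {v : TangentBundle 𝓘(ℝ, E) M} {u : TangentSpace 𝓘(ℝ, E) v.proj}
    (hvu : LinearIndependent ℝ ![v.2, u])
    (hort : FinslerJacobi.fundamentalTensor F v v.2 u = 0)
    {Φ : ℝ → TangentBundle 𝓘(ℝ, E) M → TangentBundle 𝓘(ℝ, E) M}
    (hΦ : FinslerJacobi.IsLocalFlowNear (FinslerJacobi.geodesicSpray F) v Φ)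
    {W : E × E → E × E → ℝ}
    (hW : W = FinslerJacobi.wronskian (V := E × E) (FinslerJacobi.omegaForm F v)
      (FinslerJacobi.jacobiCurve Φ v) 0)
    {a : E × E} (ha : a = FinslerJacobi.verticalLift v u) :
    FinslerJacobi.IsFanningAt (FinslerJacobi.jacobiCurve Φ v) 0 ∧ W a a ≠ 0 ∧
      FinslerJacobi.flagCurvature F D v (Submodule.span ℝ {v.2, u}) =
        1 / F v ^ 2 * (W (FinslerJacobi.jacobiEndomorphism (FinslerJacobi.jacobiCurve Φ v) 0 a) a /
          W a a) := by
  have hv : v ∈ FinslerJacobi.puncturedTangentBundle E M := hvu.ne_zero 0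
  have hKa := FinslerJacobi.jacobiEndomorphism_jacobiCurve hF hΦ hD hv u
  have hWaa : W a a = FinslerJacobi.fundamentalTensor F v u u := by
    rw [hW, ha]
    exact FinslerJacobi.wronskian_jacobiCurve hF hΦ hv u u
  have hWKa : W (FinslerJacobi.jacobiEndomorphism (FinslerJacobi.jacobiCurve Φ v) 0 a) a =
      FinslerJacobi.fundamentalTensor F v
        (FinslerJacobi.curvatureEndomorphism (FinslerJacobi.geodesicSpray F) D v u) u := by
    rw [hW, ha, hKa]
    exact FinslerJacobi.wronskian_jacobiCurve hF hΦ hv _ u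
  rw [hWaa, hWKa]
  exact ⟨FinslerJacobi.isFanningAt_jacobiCurve hF hΦ, (hF.posDef v hv u (hvu.ne_zero 1)).ne',
    FinslerJacobi.flagCurvature_of_orthogonal hF hD hv hvu hort⟩

theorem mainTheorem1 {E : Type*} [NormedAddCommGroup E] [NormedSpace ℝ E] [FiniteDimensional ℝ E]
    {M : Type*} [TopologicalSpace M] [T2Space M] [ChartedSpace E M] [IsManifold 𝓘(ℝ, E) ∞ M]
    (F : TangentBundle 𝓘(ℝ, E) M → ℝ) (hF : FinslerJacobi.IsFinslerMetric F)
    (D : (∀ w : TangentBundle 𝓘(ℝ, E) M, FinslerJacobi.VerticalBundle E M w) →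
      ∀ w : TangentBundle 𝓘(ℝ, E) M,
        TangentSpace 𝓘(ℝ, E).tangent w →L[ℝ] FinslerJacobi.VerticalBundle E M w)
    (hD : FinslerJacobi.IsSprayConnection (FinslerJacobi.geodesicSpray F) D)
    (v : TangentBundle 𝓘(ℝ, E) M) (u : TangentSpace 𝓘(ℝ, E) v.proj)
    (hvu : LinearIndependent ℝ ![v.2, u])
    (hort : FinslerJacobi.fundamentalTensor F v v.2 u = 0)
    (Φ : ℝ → TangentBundle 𝓘(ℝ, E) M → TangentBundle 𝓘(ℝ, E) M)
    (hΦ : FinslerJacobi.IsLocalFlowNear (FinslerJacobi.geodesicSpray F) v Φ)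
    (ℓ : ℝ → Submodule ℝ (E × E)) (hℓ : ℓ = FinslerJacobi.jacobiCurve Φ v)
    (W : E × E → E × E → ℝ)
    (hW : W = FinslerJacobi.wronskian (V := E × E) (FinslerJacobi.omegaForm F v) ℓ 0)
    (K : E × E →L[ℝ] E × E) (hK : K = FinslerJacobi.jacobiEndomorphism ℓ 0)
    (a : E × E) (ha : a = FinslerJacobi.verticalLift v u) :
    FinslerJacobi.IsFanningAt ℓ 0 ∧ W a a ≠ 0 ∧
      FinslerJacobi.flagCurvature F D v (Submodule.span ℝ {v.2, u}) =
        1 / F v ^ 2 * (W (K a) a / W a a) := by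
  subst hℓ hK
  exact mainTheorem1_general hF ⟨hD.isCovariantDerivativeOn, hD.smooth, hD.lift⟩ hvu hort hΦ hW ha
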